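/- Fix $K$, ranks $r_k\ge 1$ and $r_{e,k}\ge 0$ ($k\in[K]$). Consider a sequence of sample sizes along which $T\to\infty$ and $d_k\to\infty$ for every $k\in[K]$, and the tensor factor model $$\mathcal Y_t=\mathcal F_t\times_1\mathbf A_1\times_2\cdots\times_K\mathbf A_K+\mathcal E_t\in\mathbb R^{d_1\times\cdots\times d_K},\qquad t\in[T],$$ with $\mathcal F_t\in\mathbb R^{r_1\times\cdots\times r_K}$, $\mathbf A_k\in\mathbb R^{d_k\times r_k}$, and missingness tensors $\mathcal M_t$ with entries in $\{0,1\}$ ($1$ = observed). Write $d=\prod_l d_l$, $d_{\text{-}k}=d/d_k$, $r_{\text{-}k}=\prod_{l\ne k}r_l$, $\mathrm{mat}_k$ for the mode-$k$ unfolding, $\mathbf X_{i\cdot}$ for the $i$-th row of $\mathbf X$ as a column vector, $\mathbf X_{\cdot m}$ for its $m$-th column, $\mathbf Z_k=\mathrm{diag}(\mathbf A_k'\mathbf A_k)$, $\mathbf Q_k=\mathbf A_k\mathbf Z_k^{-1/2}$, $\mathcal F_{Z,t}=\mathcal F_t\times_1\mathbf Z_1^{1/2}\cdots\times_K\mathbf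 Z_K^{1/2}$, $\boldsymbol\Lambda_k=\otimes_{l\neq k}\mathbf Q_l$ (in the order of the columns of $\mathrm{mat}_k$), and $$\psi_{k,ij,h}=\{t\in[T]:\mathrm{mat}_k(\mathcal M_t)_{ih}\,\mathrm{mat}_k(\mathcal M_t)_{jh}=1\},\qquad (\widehat S_k)_{ij}=\sum_{h=1}^{d_{\text{-}k}}\frac1{|\psi_{k,ij,h}|}\sum_{t\in\psi_{k,ij,h}}\mathrm{mat}_k(\mathcal Y_t)_{ih}\,\mathrm{mat}_k(\mathcal Y_t)_{jh}.$$ Let $\widehat{\mathbf Q}_k\in\mathbb R^{d_k\times r_k}$ have as columns orthonormal eigenvectors of $\widehat{\mathbf S}_k$ for its $r_k$ largest eigenvalues in descending order, $\widehat{\mathbf D}_k=\widehat{\mathbf Q}_k'\widehat{\mathbf S}_k\widehat{\mathbf Q}_k$, and put $\mathbf f_{k,h,t}=\sum_{m=1}^{r_{\text{-}k}}\Lambda_{k,hm}\,\mathrm{mat}_k(\mathcal F_{Z,t})_{\cdot m}$, $$\mathbf H_{k,j}=\widehat{\mathbf D}_k^{-1}\sum_{i=1}^{d_k}\widehat{\mathbf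 Q}_{k,i\cdot}\sum_{h=1}^{d_{\text{-}k}}\frac1{|\psi_{k,ij,h}|}\sum_{t\in\psi_{k,ij,h}}\mathbf f_{k,h,t}'\mathbf Q_{k,i\cdot}\,\mathbf f_{k,h,t}',\qquad \mathbf H_k^a=\frac1T\sum_{t=1}^T\widehat{\mathbf D}_k^{-1}\widehat{\mathbf Q}_k'\mathbf Q_k\,\mathrm{mat}_k(\mathcal F_{Z,t})\boldsymbol\Lambda_k'\boldsymbol\Lambda_k\,\mathrm{mat}_k(\mathcal F_{Z,t})'.$$ Assume: - (O1) The observation pattern $(\mathcal M_t)_{t\in[T]}$ and the (possibly random) loadings $(\mathbf A_k)_{k\in[K]}$, which may depend on each other, are jointly independent of $(\mathcal F_t,\mathcal E_t)_{t\in[T]}$; and there is a constant $\psi_0>0$ such that almost surely $|\psi_{k,ij,h}|/T\ge\psi_0$ for all $k,i,j,h$. - (M1) Each element of $\mathcal F_t$ and of $\mathcal E_t$ is an $\alpha$-mixing process, with $\sum_{h\ge1}\alpha(h)^{1-2/\gamma}<\infty$ for some $\gamma>2$. - (F1) $\mathcal F_t=\sum_{q\ge0}a_{f,q}\mathcal X_{f,t-q}$,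 where the elements of $\{\mathcal X_{f,t}\}$ are i.i.d. with mean $0$, variance $1$ and uniformly bounded fourth moments, $\sum_q a_{f,q}^2=1$ and $\sum_q|a_{f,q}|<\infty$. - (L1) $\mathbf A_k$ has full column rank, $\mathbf Z_k^{-1/2}\mathbf A_k'\mathbf A_k\mathbf Z_k^{-1/2}\to\boldsymbol\Sigma_{A,k}$ in probability with $\boldsymbol\Sigma_{A,k}$ a fixed positive definite matrix, and $(\mathbf Z_k)_{jj}\asymp_P d_k^{\alpha_{k,j}}$, where $1/2<\alpha_{k,r_k}\le\cdots\le\alpha_{k,1}\le1$ are constants. (For every $\varepsilon>0$ there are $0<c\le C$ with $\mathbb P(c\,d_k^{\alpha_{k,j}}\le(\mathbf Z_k)_{jj}\le C\,d_k^{\alpha_{k,j}})\ge1-\varepsilon$ eventually.) - (E1) $\mathcal E_t=\mathcal F_{e,t}\times_1\mathbf A_{e,1}\cdots\times_K\mathbf A_{e,K}+\boldsymbol\Sigma_\epsilon\circ\boldsymbol\epsilon_t$ with $\mathcal F_{e,t}\in\mathbb R^{r_{e,1}\times\cdots\times r_{e,K}}$; for each $t$ the elements of $\mathcal F_{e,t}$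 are independent with mean $0$ and variance $1$, and so are those of $\boldsymbol\epsilon_t$; $\{\boldsymbol\epsilon_t\}$ and $\{\mathcal F_{e,t}\}$ are independent; $\boldsymbol\Sigma_\epsilon$ and $\mathbf A_{e,k}$ are deterministic, $\boldsymbol\Sigma_\epsilon$ has nonnegative, uniformly bounded elements, and the maximal absolute column sum of each $\mathbf A_{e,k}$ is $O(1)$. - (E2) $\mathcal F_{e,t}=\sum_{q\ge0}a_{e,q}\mathcal X_{e,t-q}$ and $\boldsymbol\epsilon_t=\sum_{q\ge0}a_{\epsilon,q}\mathcal X_{\epsilon,t-q}$, where each of $\{\mathcal X_{e,t}\}$, $\{\mathcal X_{\epsilon,t}\}$ has independent elements (over times and entries) with mean $0$, variance $1$ and uniformly bounded fourth moments; $\{\mathcal X_{e,t}\}$ and $\{\mathcal X_{\epsilon,t}\}$ are independent of each other and jointly independent of $\{\mathcal X_{f,t}\}$; $\sum_qa_{e,q}^2=\sum_qa_{\epsilon,q}^2=1$, and $\sum_q|a_{e,q}|,\ \sum_q|a_{\epsilon,q}|<\infty$. - (R1) With $g_s=\prod_ld_l^{\alpha_{l,1}}$, for every $k\in[K]$: $dg_s^{-2}T^{-1}d_k^{2(\alpha_{k,1}-\alpha_{k,r_k})+1}=o(1)$,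 $dg_s^{-1}T^{-1}d_k^{2(\alpha_{k,1}-\alpha_{k,r_k})}=o(1)$ and $dg_s^{-1}d_k^{\alpha_{k,1}-\alpha_{k,r_k}-1/2}=o(1)$. Then for every $k\in[K]$, $$\frac1{d_k}\sum_{j=1}^{d_k}\big\|\widehat{\mathbf Q}_{k,j\cdot}-\mathbf H_{k,j}\mathbf Q_{k,j\cdot}\big\|^2=O_P\Big(d_k^{2(\alpha_{k,1}-\alpha_{k,r_k})-1}\Big(\frac1{Td_{\text{-}k}}+\frac1{d_k}\Big)\frac{d^2}{g_s^2}\Big)=o_P(1).$$ Furthermore, if $0\le\eta<1$ (a constant such as $1-\psi_0$, or depending on the sample size) is such that almost surely $|\psi_{k,ij,h}|/T\ge1-\eta$ for all $i,j\in[d_k]$, $h\in[d_{\text{-}k}]$, then $$\frac1{d_k}\sum_{j=1}^{d_k}\big\|\widehat{\mathbf Q}_{k,j\cdot}-\mathbf H_k^a\mathbf Q_{k,j\cdot}\big\|^2=\frac1{d_k}\big\|\widehat{\mathbf Q}_k-\mathbf Q_k\mathbf H_k^{a\prime}\big\|_F^2=O_P\Big(d_k^{2(\alpha_{k,1}-\alpha_{k,r_k})-1}\Big[\Big(\frac1{Td_{\text{-}k}}+\frac1{d_k}\Big)\frac{d^2}{g_s^2}+\min\Big(\frac1T,\frac{\eta^2}{(1-\eta)^2}\Big)\Big]\Big)=o_P(1).$$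 -/

import Mathlib

open MeasureTheory ProbabilityTheory Filter Topology Matrix

noncomputable section

namespace TensorPCA

/-! ### Tensors, unfoldings and multilinear products -/

/-- Multi-indices `(i_1, …, i_K)` of an order-`K` tensor with dimensions `d_1 × ⋯ × d_K`. -/
abbrev MultiIndex {K : ℕ} (d : Fin K → ℕ) : Type := ∀ k, Fin (d k)

/-- Real order-`K` tensors with dimensions `d_1 × ⋯ × d_K`. -/
abbrev Tensor {K : ℕ} (d : Fin K → ℕ) : Type := MultiIndex d → ℝ

/-- Indices of the mode-`k` fibres (the columns of the mode-`k` unfolding): the coordinates of a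
multi-index in all the modes other than `k`. There are `d_1 ⋯ d_K / d_k` of them. -/
abbrev CoIndex {K : ℕ} (d : Fin K → ℕ) (k : Fin K) : Type := ∀ l : {l : Fin K // l ≠ k}, Fin (d l)

/-- Mode-`k` unfolding: the `(i, h)` entry is the tensor entry whose `k`-th coordinate is `i` and
whose other coordinates are given by `h`. -/
def unfold {K : ℕ} {d : Fin K → ℕ} {β : Type*} (k : Fin K) (X : MultiIndex d → β) :
    Matrix (Fin (d k)) (CoIndex d k) β :=
  Matrix.of fun i h => X ((Equiv.piSplitAt k fun l => Fin (d l)).symm (i, h))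

/-- The multilinear product `G ×₁ B₁ ×₂ ⋯ ×_K B_K`, entrywise. -/
def multiProd {K : ℕ} {d r : Fin K → ℕ} (G : Tensor r)
    (B : ∀ k, Matrix (Fin (d k)) (Fin (r k)) ℝ) : Tensor d :=
  fun i => ∑ j : MultiIndex r, (∏ k, B k (i k) (j k)) * G j

/-- The Kronecker product of the matrices `B_l` over all the modes `l ≠ k`, with rows and columns
indexed by multi-indices in the same way as the columns of the mode-`k` unfolding. -/
def kronExcept {K : ℕ} {d r : Fin K → ℕ} (k : Fin K)
    (B : ∀ k, Matrix (Fin (d k)) (Fin (r k)) ℝ) : Matrix (CoIndex d k) (CoIndex r k) ℝ :=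
  Matrix.of fun h m => ∏ l : {l : Fin K // l ≠ k}, B l (h l) (m l)

/-! ### Norms and leading eigenvectors -/

/-- Euclidean norm of a vector. -/
def euclNorm {p : ℕ} (v : Fin p → ℝ) : ℝ := ‖(WithLp.toLp 2 v : EuclideanSpace ℝ (Fin p))‖

/-- Frobenius norm of a matrix. -/
def frobNorm {p q : ℕ} (X : Matrix (Fin p) (Fin q) ℝ) : ℝ :=
  (Matrix.frobeniusNormedAddCommGroup (m := Fin p) (n := Fin q) (α := ℝ)).toNorm.norm X

/-- The columns of `Q` are orthonormal eigenvectors of the symmetric matrix `S` that belong to its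
`q` largest eigenvalues, in descending order and counted with multiplicity. -/
def IsLeadingEigenvectors {p q : ℕ} (S : Matrix (Fin p) (Fin p) ℝ)
    (Q : Matrix (Fin p) (Fin q) ℝ) : Prop :=
  Qᵀ * Q = 1 ∧ ∃ (hS : S.IsHermitian) (hq : q ≤ Fintype.card (Fin p)),
    S * Q = Q * Matrix.diagonal fun j => hS.eigenvalues₀ (Fin.castLE hq j)

/-! ### Stochastic orders and mixing -/

section Stochastic

variable {Ω : Type*} [MeasurableSpace Ω]

/-- `X_n = O_P(b_n)`. -/
def IsBigOP (μ : Measure Ω) (X : ℕ → Ω → ℝ) (b : ℕ → ℝ) : Prop :=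
  ∀ ε : ℝ, 0 < ε → ∃ C : ℝ, 0 < C ∧
    ∀ᶠ n in atTop, μ {ω | C * |b n| < |X n ω|} ≤ ENNReal.ofReal ε

/-- `X_n = o_P(1)`. -/
def IsLittleOPOne (μ : Measure Ω) (X : ℕ → Ω → ℝ) : Prop :=
  TendstoInMeasure μ X atTop fun _ => 0

/-- `X_n ≍ b_n` in probability: with probability arbitrarily close to one, `X_n / b_n` eventually
lies between two positive constants. For deterministic `X_n` this is `X_n ≍ b_n`. -/
def IsAsympP (μ : Measure Ω) (X : ℕ → Ω → ℝ) (b : ℕ → ℝ) : Prop :=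
  ∀ ε : ℝ, 0 < ε → ∃ c C : ℝ, 0 < c ∧ 0 < C ∧
    ∀ᶠ n in atTop, μ {ω | ¬ (c * b n ≤ X n ω ∧ X n ω ≤ C * b n)} ≤ ENNReal.ofReal ε

/-- The σ-field generated by `x_t`, `t ≤ τ`. -/
@[reducible] def pastSigma (x : ℤ → Ω → ℝ) (τ : ℤ) : MeasurableSpace Ω :=
  ⨆ t : {t : ℤ // t ≤ τ}, MeasurableSpace.comap (x t) inferInstance

/-- The σ-field generated by `x_t`, `t ≥ τ`. -/
@[reducible] def futureSigma (x : ℤ → Ω → ℝ) (τ : ℤ) : MeasurableSpace Ω :=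
  ⨆ t : {t : ℤ // τ ≤ t}, MeasurableSpace.comap (x t) inferInstance

/-- The `α`-mixing coefficient at lag `h` (a supremum of a nonempty bounded set). -/
def mixingCoeff (μ : Measure Ω) (x : ℤ → Ω → ℝ) (h : ℕ) : ℝ :=
  sSup {a : ℝ | ∃ (τ : ℤ) (A B : Set Ω), MeasurableSet[pastSigma x τ] A ∧
    MeasurableSet[futureSigma x (τ + h)] B ∧ a = |μ.real (A ∩ B) - μ.real A * μ.real B|}

/-- `α`-mixing with `∑_{h ≥ 1} α(h)^{1 - 2/γ} < ∞` for some `γ > 2`. -/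
def IsAlphaMixing (μ : Measure Ω) (x : ℤ → Ω → ℝ) : Prop :=
  ∃ γ : ℝ, 2 < γ ∧ Summable fun h : ℕ => mixingCoeff μ x (h + 1) ^ (1 - 2 / γ)

end Stochastic

/-! ### The tensor factor model at one sample size -/

/-- The primitive objects of the model at one sample size: the dimensions, the random loadings, the
factor and noise processes with their innovations, and the missingness indicators. All laws are
stated in the assumptions below. -/
structure Model (Ω : Type*) {K : ℕ} (r re : Fin K → ℕ) where
  /-- number of time points; the observation times are `1, …, T` -/
  T : ℕ
  /-- dimensions of the observed tensors -/
  d : Fin K → ℕ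
  /-- loading matrices `A_k` -/
  A : ∀ k, Ω → Matrix (Fin (d k)) (Fin (r k)) ℝ
  /-- core factor series `F_t` -/
  F : ℤ → Ω → Tensor r
  /-- innovations of the core factor series -/
  Xf : ℤ → Ω → Tensor r
  /-- loading matrices `A_{e,k}` of the common noise component -/
  Ae : ∀ k, Matrix (Fin (d k)) (Fin (re k)) ℝ
  /-- core series `F_{e,t}` of the common noise component -/
  Fe : ℤ → Ω → Tensor re
  /-- innovations of `F_{e,t}` -/
  Xe : ℤ → Ω → Tensor re
  /-- standard deviations of the idiosyncratic noise -/
  Sig : Tensor d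
  /-- standardised idiosyncratic noise `ε_t` -/
  eps : ℤ → Ω → Tensor d
  /-- innovations of `ε_t` -/
  Xeps : ℤ → Ω → Tensor d
  /-- missingness tensor: `true` means observed -/
  M : ℤ → Ω → MultiIndex d → Bool

namespace Model

variable {Ω : Type*} {K : ℕ} {r re : Fin K → ℕ} (S : Model Ω r re)

/-- The set of observation times `[T]`. -/
abbrev times : Finset ℤ := Finset.Icc 1 (S.T : ℤ)

/-- Noise tensor `E_t = F_{e,t} ×₁ A_{e,1} ⋯ ×_K A_{e,K} + Σ_ε ∘ ε_t`. -/
def E (t : ℤ) (ω : Ω) : Tensor S.d :=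
  fun i => multiProd (S.Fe t ω) S.Ae i + S.Sig i * S.eps t ω i

/-- Observations `Y_t = F_t ×₁ A_1 ⋯ ×_K A_K + E_t`. -/
def Y (t : ℤ) (ω : Ω) : Tensor S.d :=
  fun i => multiProd (S.F t ω) (fun k => S.A k ω) i + S.E t ω i

/-- Diagonal entries of `Z_k = diag(A_k' A_k)`. -/
def Z (k : Fin K) (ω : Ω) : Fin (r k) → ℝ := ((S.A k ω)ᵀ * S.A k ω).diag

/-- `Z_k^{1/2}`. -/
def Zsqrt (k : Fin K) (ω : Ω) : Matrix (Fin (r k)) (Fin (r k)) ℝ :=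
  Matrix.diagonal fun j => √(S.Z k ω j)

/-- `Z_k^{-1/2}`. -/
def ZinvSqrt (k : Fin K) (ω : Ω) : Matrix (Fin (r k)) (Fin (r k)) ℝ :=
  Matrix.diagonal fun j => (√(S.Z k ω j))⁻¹

/-- Normalised loadings `Q_k = A_k Z_k^{-1/2}`. -/
def Q (k : Fin K) (ω : Ω) : Matrix (Fin (S.d k)) (Fin (r k)) ℝ := S.A k ω * S.ZinvSqrt k ω

/-- `F_{Z,t} = F_t ×₁ Z_1^{1/2} ⋯ ×_K Z_K^{1/2}`. -/
def FZ (t : ℤ) (ω : Ω) : Tensor r := multiProd (S.F t ω) fun k => S.Zsqrt k ω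

/-- `Λ_k`, the Kronecker product of the `Q_l`, `l ≠ k`. -/
def Lam (k : Fin K) (ω : Ω) : Matrix (CoIndex S.d k) (CoIndex r k) ℝ :=
  kronExcept k fun l => S.Q l ω

/-- `ψ_{k,ij,h}`: the times at which entries `i` and `j` of the `h`-th mode-`k` fibre are both
observed. -/
def psi (k : Fin K) (i j : Fin (S.d k)) (h : CoIndex S.d k) (ω : Ω) : Finset ℤ :=
  S.times.filter fun t =>
    unfold k (S.M t ω) i h = true ∧ unfold k (S.M t ω) j h = true

/-- The mode-`k` covariance matrix `Ŝ_k` computed from the observed entries. -/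
def Shat (k : Fin K) (ω : Ω) : Matrix (Fin (S.d k)) (Fin (S.d k)) ℝ :=
  Matrix.of fun i j => ∑ h : CoIndex S.d k, ((S.psi k i j h ω).card : ℝ)⁻¹ *
    ∑ t ∈ S.psi k i j h ω, unfold k (S.Y t ω) i h * unfold k (S.Y t ω) j h

/-- `D̂_k = Q̂_k' Ŝ_k Q̂_k`. -/
def Dhat (k : Fin K) (Qh : Matrix (Fin (S.d k)) (Fin (r k)) ℝ) (ω : Ω) :
    Matrix (Fin (r k)) (Fin (r k)) ℝ := Qhᵀ * S.Shat k ω * Qh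

/-- The vector `∑_m Λ_{k,hm} mat_k(F_{Z,t})_{·m}`. -/
def fvec (k : Fin K) (h : CoIndex S.d k) (t : ℤ) (ω : Ω) : Fin (r k) → ℝ :=
  fun a => ∑ m : CoIndex r k, S.Lam k ω h m * unfold k (S.FZ t ω) a m

/-- The row-specific rotation `H_{k,j}`. -/
def Hrow (k : Fin K) (Qh : Matrix (Fin (S.d k)) (Fin (r k)) ℝ) (j : Fin (S.d k)) (ω : Ω) :
    Matrix (Fin (r k)) (Fin (r k)) ℝ :=
  (S.Dhat k Qh ω)⁻¹ * ∑ i : Fin (S.d k), ∑ h : CoIndex S.d k,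
    ((S.psi k i j h ω).card : ℝ)⁻¹ • ∑ t ∈ S.psi k i j h ω,
      (S.fvec k h t ω ⬝ᵥ S.Q k ω i) • Matrix.vecMulVec (Qh i) (S.fvec k h t ω)

/-- The common rotation `H_k^a`. -/
def Hall (k : Fin K) (Qh : Matrix (Fin (S.d k)) (Fin (r k)) ℝ) (ω : Ω) :
    Matrix (Fin (r k)) (Fin (r k)) ℝ :=
  (S.T : ℝ)⁻¹ • ∑ t ∈ S.times, (S.Dhat k Qh ω)⁻¹ * Qhᵀ * S.Q k ω * unfold k (S.FZ t ω) *
    (S.Lam k ω)ᵀ * S.Lam k ω * (unfold k (S.FZ t ω))ᵀ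

/-- `d_k⁻¹ ∑_j ‖Q̂_{k,j·} - G_j Q_{k,j·}‖²` for given rotations `G_j`. -/
def avgRowError (k : Fin K) (Qh : Matrix (Fin (S.d k)) (Fin (r k)) ℝ)
    (G : Fin (S.d k) → Matrix (Fin (r k)) (Fin (r k)) ℝ) (ω : Ω) : ℝ :=
  (S.d k : ℝ)⁻¹ * ∑ j : Fin (S.d k), euclNorm (Qh j - G j *ᵥ S.Q k ω j) ^ 2

/-- `d = d_1 ⋯ d_K`. -/
def dTot : ℝ := ∏ k, (S.d k : ℝ)

/-- `d_{-k} = ∏_{l ≠ k} d_l`. -/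
def dMinus (k : Fin K) : ℝ := ∏ l ∈ Finset.univ.erase k, (S.d l : ℝ)

end Model

/-! ### Factor strengths and rates -/

section Rates

variable {Ω : Type*} {K : ℕ} {r re : Fin K → ℕ}

/-- The strongest factor strength `α_{k,1}`. -/
def alphaFirst (hr : ∀ k, 0 < r k) (α : ∀ k, Fin (r k) → ℝ) (k : Fin K) : ℝ := α k ⟨0, hr k⟩

/-- The weakest factor strength `α_{k,r_k}`. -/
def alphaLast (hr : ∀ k, 0 < r k) (α : ∀ k, Fin (r k) → ℝ) (k : Fin K) : ℝ :=
  α k ⟨r k - 1, Nat.sub_lt (hr k) Nat.one_pos⟩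

/-- `g_s = ∏_k d_k^{α_{k,1}}`. -/
def gs (hr : ∀ k, 0 < r k) (α : ∀ k, Fin (r k) → ℝ) (S : Model Ω r re) : ℝ :=
  ∏ k, (S.d k : ℝ) ^ alphaFirst hr α k

/-- `d_k^{2(α_{k,1} - α_{k,r_k}) - 1}`. -/
def strengthFactor (hr : ∀ k, 0 < r k) (α : ∀ k, Fin (r k) → ℝ) (k : Fin K) (S : Model Ω r re) :
    ℝ :=
  (S.d k : ℝ) ^ (2 * (alphaFirst hr α k - alphaLast hr α k) - 1)

/-- `(1 / (T d_{-k}) + 1 / d_k) d² / g_s²`. -/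
def baseRate (hr : ∀ k, 0 < r k) (α : ∀ k, Fin (r k) → ℝ) (k : Fin K) (S : Model Ω r re) : ℝ :=
  (1 / (S.T * S.dMinus k) + 1 / (S.d k : ℝ)) * (S.dTot ^ 2 / gs hr α S ^ 2)

end Rates

/-! ### Assumptions on a sequence of models -/

section Assumptions

variable {Ω : Type*} [MeasurableSpace Ω] {K : ℕ} {r re : Fin K → ℕ}

/-- All the random objects are measurable. -/
structure IsMeasurableModel (S : Model Ω r re) : Prop where
  A : ∀ k i j, Measurable fun ω => S.A k ω i j
  F : ∀ t i, Measurable fun ω => S.F t ω i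
  Xf : ∀ t i, Measurable fun ω => S.Xf t ω i
  Fe : ∀ t i, Measurable fun ω => S.Fe t ω i
  Xe : ∀ t i, Measurable fun ω => S.Xe t ω i
  eps : ∀ t i, Measurable fun ω => S.eps t ω i
  Xeps : ∀ t i, Measurable fun ω => S.Xeps t ω i
  M : ∀ t i, Measurable fun ω => S.M t ω i

/-- `x_t = ∑_{q ≥ 0} a_q X_{t-q}`, entrywise and almost surely. -/
def IsLinearProcess {ι : Type*} (μ : Measure Ω) (a : ℕ → ℝ) (X x : ℤ → Ω → ι → ℝ) : Prop :=
  ∀ t i, ∀ᵐ ω ∂μ, HasSum (fun q : ℕ => a q * X (t - q) ω i) (x t ω i)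

/-- Square-summing to one, and absolutely summable. -/
structure IsCoeffSeq (a : ℕ → ℝ) : Prop where
  sq : HasSum (fun q => a q ^ 2) 1
  abs : Summable fun q => |a q|

/-- The elements of the tensor series are independent over times and entries, with mean zero, unit
variance and fourth moments at most `C`. -/
structure IsInnovation {ι : Type*} (μ : Measure Ω) (C : ℝ) (X : ℤ → Ω → ι → ℝ) : Prop where
  indep : iIndepFun (fun (p : ℤ × ι) ω => X p.1 ω p.2) μ
  mean : ∀ t i, ∫ ω, X t ω i ∂μ = 0
  var : ∀ t i, variance (fun ω => X t ω i) μ = 1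
  fourth : ∀ t i, Integrable (fun ω => X t ω i ^ 4) μ ∧ ∫ ω, X t ω i ^ 4 ∂μ ≤ C

/-- Independence of the observation pattern and the loadings from the factors and the noise: the
pattern `(M_t)_{t ∈ [T]}` and the loadings `A_1, …, A_K` (which may depend on each other) are
jointly independent of `(F_t, E_t)_{t ∈ [T]}`. -/
def PatternLoadingsIndep (μ : Measure Ω) (S : Model Ω r re) : Prop :=
  IndepFun (fun ω => ((fun (t : S.times) i => S.M t ω i), fun k i j => S.A k ω i j))
    (fun ω => ((fun (t : S.times) i => S.F t ω i), fun (t : S.times) i => S.E t ω i)) μ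

/-- Observation patterns: any two entries of a fibre are jointly observed at least a fixed positive
proportion of the time. -/
def AssumptionO1 (μ : Measure Ω) (S : ℕ → Model Ω r re) : Prop :=
  ∃ ψ₀ : ℝ, 0 < ψ₀ ∧ ∀ n, ∀ᵐ ω ∂μ, ∀ k i j h,
    ψ₀ ≤ (((S n).psi k i j h ω).card : ℝ) / (S n).T

/-- The elements of the factor and of the noise series are `α`-mixing. -/
def AssumptionM1 (μ : Measure Ω) (S : ℕ → Model Ω r re) : Prop :=
  ∀ n, (∀ i, IsAlphaMixing μ fun t ω => (S n).F t ω i) ∧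
    ∀ i, IsAlphaMixing μ fun t ω => (S n).E t ω i

/-- Time series structure of the factors. -/
structure AssumptionF1 (μ : Measure Ω) (S : ℕ → Model Ω r re) (af : ℕ → ℝ) : Prop where
  coeff : IsCoeffSeq af
  linear : ∀ n, IsLinearProcess μ af (S n).Xf (S n).F
  innov : ∃ C, ∀ n, IsInnovation μ C (S n).Xf
  ident : ∀ n t i s j, IdentDistrib (fun ω => (S n).Xf t ω i) (fun ω => (S n).Xf s ω j) μ μ

/-- Factor strength. -/
structure AssumptionL1 (μ : Measure Ω) (S : ℕ → Model Ω r re) (α : ∀ k, Fin (r k) → ℝ)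
    (SigA : ∀ k, Matrix (Fin (r k)) (Fin (r k)) ℝ) : Prop where
  rank : ∀ n k, ∀ᵐ ω ∂μ, ((S n).A k ω).rank = r k
  posDef : ∀ k, (SigA k).PosDef
  limit : ∀ k a b, TendstoInMeasure μ
    (fun n ω => ((S n).ZinvSqrt k ω * ((S n).A k ω)ᵀ * (S n).A k ω * (S n).ZinvSqrt k ω) a b)
    atTop fun _ => SigA k a b
  strength : ∀ k j, IsAsympP μ (fun n ω => (S n).Z k ω j) fun n => ((S n).d k : ℝ) ^ α k j
  anti : ∀ k, Antitone (α k)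
  gt_half : ∀ k j, 1 / 2 < α k j
  le_one : ∀ k j, α k j ≤ 1

/-- Decomposition of the noise: moments and independence of the two components, bounded standard
deviations, and bounded column-sum norms of the noise loadings. -/
structure AssumptionE1 (μ : Measure Ω) (S : ℕ → Model Ω r re) : Prop where
  fe_indep : ∀ n t, iIndepFun (fun i ω => (S n).Fe t ω i) μ
  fe_mean : ∀ n t i, ∫ ω, (S n).Fe t ω i ∂μ = 0
  fe_var : ∀ n t i, variance (fun ω => (S n).Fe t ω i) μ = 1
  eps_indep : ∀ n t, iIndepFun (fun i ω => (S n).eps t ω i) μ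
  eps_mean : ∀ n t i, ∫ ω, (S n).eps t ω i ∂μ = 0
  eps_var : ∀ n t i, variance (fun ω => (S n).eps t ω i) μ = 1
  indep : ∀ n, IndepFun (fun ω t i => (S n).eps t ω i) (fun ω t i => (S n).Fe t ω i) μ
  sig : ∃ C : ℝ, ∀ n i, 0 ≤ (S n).Sig i ∧ (S n).Sig i ≤ C
  sparse : ∃ C : ℝ, ∀ n k j, ∑ i, |(S n).Ae k i j| ≤ C

/-- Time series structure of the noise. -/
structure AssumptionE2 (μ : Measure Ω) (S : ℕ → Model Ω r re) (ae aeps : ℕ → ℝ) : Prop where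
  coeff_e : IsCoeffSeq ae
  coeff_eps : IsCoeffSeq aeps
  linear_e : ∀ n, IsLinearProcess μ ae (S n).Xe (S n).Fe
  linear_eps : ∀ n, IsLinearProcess μ aeps (S n).Xeps (S n).eps
  innov_e : ∃ C, ∀ n, IsInnovation μ C (S n).Xe
  innov_eps : ∃ C, ∀ n, IsInnovation μ C (S n).Xeps
  indep_e_eps : ∀ n, IndepFun (fun ω t i => (S n).Xe t ω i) (fun ω t i => (S n).Xeps t ω i) μ
  indep_f : ∀ n, IndepFun
    (fun ω => ((fun t i => (S n).Xe t ω i), fun t i => (S n).Xeps t ω i))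
    (fun ω t i => (S n).Xf t ω i) μ

/-- Rate conditions. -/
def AssumptionR1 (hr : ∀ k, 0 < r k) (α : ∀ k, Fin (r k) → ℝ) (S : ℕ → Model Ω r re) : Prop :=
  ∀ k,
    Tendsto (fun n => (S n).dTot / gs hr α (S n) ^ 2 / (S n).T *
      ((S n).d k : ℝ) ^ (2 * (alphaFirst hr α k - alphaLast hr α k) + 1)) atTop (𝓝 0) ∧
    Tendsto (fun n => (S n).dTot / gs hr α (S n) / (S n).T *
      ((S n).d k : ℝ) ^ (2 * (alphaFirst hr α k - alphaLast hr α k))) atTop (𝓝 0) ∧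
    Tendsto (fun n => (S n).dTot / gs hr α (S n) *
      ((S n).d k : ℝ) ^ (alphaFirst hr α k - alphaLast hr α k - 1 / 2)) atTop (𝓝 0)

end Assumptions

end TensorPCA

end

open TensorPCA

/-!
Write `Ŝ = Ŝ_k` for the covariance matrix computed from the observed entries, `R*` for its
factor-factor part, and `R` for the factor-factor part of the covariance matrix of the complete data.
The eigenvector equation gives `Q̂_j = D̂⁻¹ Q̂' Ŝ_j`, while the rotations are such that
`H_j Q_j = D̂⁻¹ Q̂' R*_j` and `H^a Q_j = D̂⁻¹ Q̂' R_j`. The columns of `Q̂` being orthonormal, Bessel's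
inequality bounds the sum of the squared row errors by `λ⁻² ‖Ŝ - R*‖_F²`, respectively
`λ⁻² ‖Ŝ - R‖_F²`, where `λ` is the `r_k`-th eigenvalue of `Ŝ`
(`IsLeadingEigenvectors.sum_row_error_le`). No perturbation theorem for eigenvectors is needed, only a
lower bound for `λ` and upper bounds for Frobenius norms.

*Frobenius norms.* The factors and the noise are linear processes in independent innovations, so
given the observation pattern and the loadings all the entries are quadratic forms in independent
variables. The variance of such a form is at most a multiple of the squared Frobenius norm of its
matrix (`IsStdNoise.integral_quadForm_sq_le`); for linear processes this follows by truncation and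
Fatou's lemma, and the time dependence enters only through summable bounds of the
autocovariances (`lintegral_sum_mul_sq_le`). As the spatial covariance of the noise has bounded row
sums, with probability close to one
`‖Ŝ - R*‖_F² = O(d_k d / T + d d_{-k})`, the second term being the mean of the noise-noise part.
The pattern and the loadings are independent of the factors and the noise, so these conditional
bounds hold in probability by Markov's inequality (`Model.IsDecoupled.measure_le`).

*The missing observations.* `R* - R` has weights `1{t ∈ ψ} / |ψ| - 1 / T`, of total zero. They are of
size `O(1 / T)` each, and at most `2 η` in total; the two bounds give
`‖R* - R‖_F² = O(g_s² min(1 / T, η²))` (`HasNoiseBounds.measure_commGap_le`).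

*The eigenvalue.* Given the loadings, `R*` is centered at `∏_{l ≠ k} tr(A_l' A_l) A_k A_k'`, up to an
error whose squared Frobenius norm is `O(g_s² / T)`. Courant–Fischer on the range of `A_k`, together
with the limit of the normalised Gram matrix of `A_k`, shows that `λ` is at least of order
`d_k^{α_{k,r_k} - α_{k,1}} g_s` (`Model.avgRowError_le`, `exists_loading_bounds`), as the errors are of
smaller order by the rate conditions.
-/

namespace TensorPCA

/-! ### Quadratic forms in independent variables -/

section QuadraticForms

variable {Ω : Type*} [MeasurableSpace Ω] {μ : Measure Ω} {P : Type*}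

/-- A family of independent standardised real random variables whose fourth moments are at most
`κ`. -/
structure IsStdNoise (μ : Measure Ω) (κ : ℝ) (ξ : P → Ω → ℝ) : Prop where
  meas : ∀ p, Measurable (ξ p)
  indep : iIndepFun ξ μ
  mean : ∀ p, ∫ ω, ξ p ω ∂μ = 0
  second : ∀ p, ∫ ω, ξ p ω ^ 2 ∂μ = 1
  integrable_fourth : ∀ p, Integrable (fun ω => ξ p ω ^ 4) μ
  fourth : ∀ p, ∫ ω, ξ p ω ^ 4 ∂μ ≤ κ

variable {κ : ℝ} {ξ : P → Ω → ℝ}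

lemma abs_mul_four_le (a b c d : ℝ) : |a * b * c * d| ≤ a ^ 4 + b ^ 4 + c ^ 4 + d ^ 4 := by
  rw [abs_le]
  constructor <;>
  nlinarith [sq_nonneg (a * b + c * d), sq_nonneg (a * b - c * d), sq_nonneg (a ^ 2 - b ^ 2),
    sq_nonneg (c ^ 2 - d ^ 2), sq_nonneg (a ^ 2 + b ^ 2), sq_nonneg (c ^ 2 + d ^ 2)]

lemma IsStdNoise.integrable_mul_four (h : IsStdNoise μ κ ξ) (p q r s : P) :
    Integrable (fun ω => ξ p ω * ξ q ω * ξ r ω * ξ s ω) μ := by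
  have hm := h.meas
  refine ((((h.integrable_fourth p).add (h.integrable_fourth q)).add
    (h.integrable_fourth r)).add (h.integrable_fourth s)).mono' ?_ ?_
  · exact (((((hm p).mul (hm q)).mul (hm r)).mul (hm s))).aestronglyMeasurable
  · exact Eventually.of_forall fun ω => abs_mul_four_le _ _ _ _

lemma IsStdNoise.integrable_mul_two [IsProbabilityMeasure μ] (h : IsStdNoise μ κ ξ) (p q : P) :
    Integrable (fun ω => ξ p ω * ξ q ω) μ := by
  have hm := h.meas
  refine ((((h.integrable_fourth p).add (h.integrable_fourth q)).add
    (integrable_const (1 : ℝ))).add (integrable_const (1 : ℝ))).mono' ?_ ?_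
  · exact ((hm p).mul (hm q)).aestronglyMeasurable
  · exact Eventually.of_forall fun ω => by
      simpa using abs_mul_four_le (ξ p ω) (ξ q ω) 1 1

lemma IsStdNoise.integral_mul_two [IsProbabilityMeasure μ] [DecidableEq P]
    (h : IsStdNoise μ κ ξ) (p q : P) :
    ∫ ω, ξ p ω * ξ q ω ∂μ = if p = q then 1 else 0 := by
  split_ifs with hpq
  · subst hpq
    simpa only [pow_two] using h.second p
  · rw [(h.indep.indepFun hpq).integral_fun_mul_eq_mul_integral
      (h.meas p).aestronglyMeasurable (h.meas q).aestronglyMeasurable, h.mean, zero_mul]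

/-- A product in which one index occurs exactly once has mean zero. -/
lemma IsStdNoise.integral_mul_four_single (h : IsStdNoise μ κ ξ) {p q r s : P}
    (hq : p ≠ q) (hr : p ≠ r) (hs : p ≠ s) :
    ∫ ω, ξ p ω * (ξ q ω * ξ r ω * ξ s ω) ∂μ = 0 := by
  classical
  have hd : Disjoint ({p} : Finset P) {q, r, s} := by simp [hq, hr, hs]
  have hi := h.indep.indepFun_finset {p} {q, r, s} hd h.meas
  have hi' : IndepFun (ξ p) (fun ω => ξ q ω * ξ r ω * ξ s ω) μ :=
    hi.comp (φ := fun x : ({p} : Finset P) → ℝ => x ⟨p, by simp⟩)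
      (ψ := fun x : ({q, r, s} : Finset P) → ℝ =>
        x ⟨q, by simp⟩ * x ⟨r, by simp⟩ * x ⟨s, by simp⟩)
      (by fun_prop) (by fun_prop)
  rw [hi'.integral_fun_mul_eq_mul_integral (h.meas p).aestronglyMeasurable
    ((((h.meas q).mul (h.meas r)).mul (h.meas s))).aestronglyMeasurable, h.mean, zero_mul]

lemma IsStdNoise.integral_sq_mul_sq (h : IsStdNoise μ κ ξ) {p q : P} (hpq : p ≠ q) :
    ∫ ω, ξ p ω * ξ p ω * ξ q ω * ξ q ω ∂μ = 1 := by
  have hi : IndepFun (fun ω => ξ p ω ^ 2) (fun ω => ξ q ω ^ 2) μ :=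
    (h.indep.indepFun hpq).comp (φ := fun x => x ^ 2) (ψ := fun x => x ^ 2)
      (by fun_prop) (by fun_prop)
  have := hi.integral_fun_mul_eq_mul_integral ((h.meas p).pow_const 2).aestronglyMeasurable
    ((h.meas q).pow_const 2).aestronglyMeasurable
  rw [h.second, h.second, one_mul] at this
  rw [← this]
  congr 1; ext ω; ring

lemma IsStdNoise.integral_mul_centered [IsProbabilityMeasure μ] [DecidableEq P]
    (h : IsStdNoise μ κ ξ) (p q r s : P) :
    ∫ ω, (ξ p ω * ξ q ω - if p = q then 1 else 0) * (ξ r ω * ξ s ω - if r = s then 1 else 0) ∂μ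
      = ∫ ω, ξ p ω * ξ q ω * ξ r ω * ξ s ω ∂μ -
        (if p = q then 1 else 0) * (if r = s then 1 else 0) := by
  have e : ∀ ω, (ξ p ω * ξ q ω - if p = q then (1 : ℝ) else 0) *
      (ξ r ω * ξ s ω - if r = s then 1 else 0) =
      ξ p ω * ξ q ω * ξ r ω * ξ s ω - (if r = s then (1 : ℝ) else 0) * (ξ p ω * ξ q ω)
      - (if p = q then (1 : ℝ) else 0) * (ξ r ω * ξ s ω)
      + (if p = q then (1 : ℝ) else 0) * (if r = s then (1 : ℝ) else 0) := fun ω => by ring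
  have i1 := h.integrable_mul_four p q r s
  have i2 := (h.integrable_mul_two p q).const_mul (if r = s then (1 : ℝ) else 0)
  have i3 := (h.integrable_mul_two r s).const_mul (if p = q then (1 : ℝ) else 0)
  simp_rw [e]
  rw [integral_add (by exact (i1.sub i2).sub i3) (integrable_const _),
    integral_sub (by exact i1.sub i2) i3, integral_sub i1 i2, integral_const_mul,
    integral_const_mul, h.integral_mul_two, h.integral_mul_two]
  simp only [integral_const, probReal_univ, smul_eq_mul, one_mul]
  ring

/-- Centered products of pairs are uncorrelated unless the two pairs have the same elements. -/
lemma IsStdNoise.abs_integral_mul_centered_le [IsProbabilityMeasure μ] [DecidableEq P]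
    (h : IsStdNoise μ κ ξ) (p q r s : P) :
    |∫ ω, (ξ p ω * ξ q ω - if p = q then 1 else 0) *
      (ξ r ω * ξ s ω - if r = s then 1 else 0) ∂μ|
      ≤ (κ + 1) * ((if (r, s) = (p, q) then 1 else 0) + (if (r, s) = (q, p) then 1 else 0)) := by
  rw [h.integral_mul_centered]
  have hκ : 0 ≤ κ := le_trans (integral_nonneg fun ω => by positivity) (h.fourth p)
  have single : ∀ a b c d : P, a ≠ b → a ≠ c → a ≠ d →
      ∫ ω, ξ a ω * (ξ b ω * ξ c ω * ξ d ω) ∂μ = 0 := fun a b c d => h.integral_mul_four_single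
  have perm : ∀ {a b c d : P}, ∫ ω, ξ a ω * (ξ b ω * ξ c ω * ξ d ω) ∂μ = 0 →
      (∀ ω, ξ p ω * ξ q ω * ξ r ω * ξ s ω = ξ a ω * (ξ b ω * ξ c ω * ξ d ω)) →
      ∫ ω, ξ p ω * ξ q ω * ξ r ω * ξ s ω ∂μ = 0 := by
    intro a b c d h0 he
    simp_rw [he]; exact h0
  by_cases hA : (r, s) = (p, q) ∨ (r, s) = (q, p)
  -- the expectation is that of `ξ_p² ξ_q²`, at most `κ`, minus a number in `[0, 1]`
  · have h1 : (1 : ℝ) ≤ (if (r, s) = (p, q) then 1 else 0) +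
        (if (r, s) = (q, p) then 1 else 0) := by
      rcases hA with hA | hA <;> rw [if_pos hA] <;> split_ifs <;> norm_num
    have e : ∀ ω, ξ p ω * ξ q ω * ξ r ω * ξ s ω = ξ p ω ^ 2 * ξ q ω ^ 2 := by
      intro ω
      rcases hA with hA | hA <;> obtain ⟨rfl, rfl⟩ := Prod.mk.inj hA <;> ring
    have h2 : 0 ≤ ∫ ω, ξ p ω * ξ q ω * ξ r ω * ξ s ω ∂μ :=
      integral_nonneg fun ω => by simp only [e]; positivity
    have h3 : ∫ ω, ξ p ω * ξ q ω * ξ r ω * ξ s ω ∂μ ≤ κ := by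
      have : ∫ ω, ξ p ω * ξ q ω * ξ r ω * ξ s ω ∂μ ≤
          ∫ ω, (ξ p ω ^ 4 + ξ q ω ^ 4) / 2 ∂μ := by
        refine integral_mono (h.integrable_mul_four p q r s)
          (((h.integrable_fourth p).add (h.integrable_fourth q)).div_const 2) fun ω => ?_
        simp only [e]
        nlinarith [sq_nonneg (ξ p ω ^ 2 - ξ q ω ^ 2)]
      rw [integral_div, integral_add (h.integrable_fourth p) (h.integrable_fourth q)] at this
      linarith [h.fourth p, h.fourth q]
    have h4 : (0 : ℝ) ≤ (if p = q then 1 else 0) * (if r = s then 1 else 0) := by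
      split_ifs <;> norm_num
    have h5 : (if p = q then (1 : ℝ) else 0) * (if r = s then 1 else 0) ≤ 1 := by
      split_ifs <;> norm_num
    rw [abs_le]
    constructor <;> nlinarith
  -- otherwise an index occurs exactly once, or the pairs are `(p, p)` and `(r, r)` with `p ≠ r`
  · push Not at hA
    have h0 : ∫ ω, ξ p ω * ξ q ω * ξ r ω * ξ s ω ∂μ -
        (if p = q then 1 else 0) * (if r = s then 1 else 0) = 0 := by
      simp only [ne_eq, Prod.mk.injEq, not_and] at hA
      obtain ⟨hA1, hA2⟩ := hA
      by_cases hpq : p = q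
      · subst hpq
        by_cases hrs : r = s
        · subst hrs
          have hpr : p ≠ r := fun e => hA1 e.symm e.symm
          rw [h.integral_sq_mul_sq hpr]; simp
        · rw [if_neg hrs, mul_zero, sub_zero]
          by_cases hrp : r = p
          · refine perm (single s p p r ?_ ?_ ?_) fun ω => by ring
            · exact fun e => hA1 hrp e
            · exact fun e => hA1 hrp e
            · exact fun e => hrs e.symm
          · exact perm (single r p p s hrp hrp hrs) fun ω => by ring
      · rw [if_neg hpq, zero_mul, sub_zero]
        by_cases hp : p = r ∨ p = s
        · have hq : q ≠ r ∧ q ≠ s := by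
            rcases hp with rfl | rfl
            · exact ⟨fun e => hpq e.symm, fun e => hA1 rfl e.symm⟩
            · exact ⟨fun e => hA2 e.symm rfl, fun e => hpq e.symm⟩
          exact perm (single q p r s (fun e => hpq e.symm) hq.1 hq.2) fun ω => by ring
        · push Not at hp
          exact perm (single p q r s hpq hp.1 hp.2) fun ω => by ring
    rw [h0, abs_zero]
    refine mul_nonneg (by linarith) (add_nonneg ?_ ?_) <;> split_ifs <;> norm_num

/-- The variance of a quadratic form in independent variables is at most a multiple of the squared
Frobenius norm of its matrix, because the product over a pair of indices is correlated only with itself. -/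
lemma IsStdNoise.integral_quadForm_sq_le [IsProbabilityMeasure μ] [DecidableEq P]
    (h : IsStdNoise μ κ ξ) (s : Finset P) (B : P × P → ℝ) :
    Integrable (fun ω => (∑ z ∈ s ×ˢ s,
        B z * (ξ z.1 ω * ξ z.2 ω - if z.1 = z.2 then 1 else 0)) ^ 2) μ ∧
    ∫ ω, (∑ z ∈ s ×ˢ s, B z * (ξ z.1 ω * ξ z.2 ω - if z.1 = z.2 then 1 else 0)) ^ 2 ∂μ
      ≤ 2 * (κ + 1) * ∑ z ∈ s ×ˢ s, B z ^ 2 := by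
  rcases isEmpty_or_nonempty P with hP | ⟨⟨p0⟩⟩
  · have hs : s = ∅ := Subsingleton.elim _ _
    subst hs; simp
  have hκ : 0 ≤ κ := le_trans (integral_nonneg fun ω => by positivity) (h.fourth p0)
  set ζ : P × P → Ω → ℝ := fun z ω => ξ z.1 ω * ξ z.2 ω - if z.1 = z.2 then 1 else 0 with hζ
  have hint : ∀ z z', Integrable (fun ω => ζ z ω * ζ z' ω) μ := by
    rintro ⟨p, q⟩ ⟨r, t⟩
    have i1 := h.integrable_mul_four p q r t
    have i2 := (h.integrable_mul_two p q).const_mul (if r = t then (1 : ℝ) else 0)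
    have i3 := (h.integrable_mul_two r t).const_mul (if p = q then (1 : ℝ) else 0)
    refine (((i1.sub i2).sub i3).add (integrable_const
      ((if p = q then (1 : ℝ) else 0) * (if r = t then (1 : ℝ) else 0)))).congr ?_
    exact Eventually.of_forall fun ω => by simp only [hζ, Pi.add_apply, Pi.sub_apply]; ring
  have hsq : ∀ ω, (∑ z ∈ s ×ˢ s, B z * ζ z ω) ^ 2 =
      ∑ z ∈ s ×ˢ s, ∑ z' ∈ s ×ˢ s, B z * B z' * (ζ z ω * ζ z' ω) := by
    intro ω
    rw [pow_two, Finset.sum_mul_sum]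
    exact Finset.sum_congr rfl fun z _ => Finset.sum_congr rfl fun z' _ => by ring
  have hint2 : ∀ z ∈ s ×ˢ s, Integrable
      (fun ω => ∑ z' ∈ s ×ˢ s, B z * B z' * (ζ z ω * ζ z' ω)) μ := fun z _ =>
    integrable_finsetSum _ fun z' _ => (hint z z').const_mul _
  change Integrable (fun ω => (∑ z ∈ s ×ˢ s, B z * ζ z ω) ^ 2) μ ∧
    ∫ ω, (∑ z ∈ s ×ˢ s, B z * ζ z ω) ^ 2 ∂μ ≤ _
  simp_rw [hsq]
  refine ⟨integrable_finsetSum _ hint2, ?_⟩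
  rw [integral_finsetSum _ hint2]
  have hb : ∀ z ∈ s ×ˢ s, ∫ ω, ∑ z' ∈ s ×ˢ s, B z * B z' * (ζ z ω * ζ z' ω) ∂μ ≤
      (κ + 1) * (B z ^ 2 + |B z| * |B z.swap|) := by
    intro z hz
    rw [integral_finsetSum _ fun z' _ => (hint z z').const_mul _]
    have hz' : z.swap ∈ s ×ˢ s := by
      rw [Finset.mem_product] at hz ⊢; exact ⟨hz.2, hz.1⟩
    calc ∑ z' ∈ s ×ˢ s, ∫ ω, B z * B z' * (ζ z ω * ζ z' ω) ∂μ
        ≤ ∑ z' ∈ s ×ˢ s, |B z| * |B z'| * ((κ + 1) *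
          ((if z' = z then 1 else 0) + (if z' = z.swap then 1 else 0))) := by
          refine Finset.sum_le_sum fun z' _ => ?_
          rw [integral_const_mul]
          refine (le_abs_self _).trans ?_
          rw [abs_mul, abs_mul]
          exact mul_le_mul_of_nonneg_left (h.abs_integral_mul_centered_le z.1 z.2 z'.1 z'.2)
            (by positivity)
      _ = (κ + 1) * (B z ^ 2 + |B z| * |B z.swap|) := by
          simp only [mul_add, Finset.sum_add_distrib, mul_ite, mul_one, mul_zero,
            Finset.sum_ite_eq', hz, hz', if_true]
          rw [← sq_abs (B z)]; ring
  refine (Finset.sum_le_sum hb).trans ?_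
  rw [← Finset.mul_sum, Finset.sum_add_distrib]
  have h1 : ∑ z ∈ s ×ˢ s, |B z| * |B z.swap| ≤
      ∑ z ∈ s ×ˢ s, (B z ^ 2 / 2 + B z.swap ^ 2 / 2) := by
    refine Finset.sum_le_sum fun z _ => ?_
    nlinarith [sq_nonneg (|B z| - |B z.swap|), sq_abs (B z), sq_abs (B z.swap)]
  have h2 : ∑ z ∈ s ×ˢ s, B z.swap ^ 2 / 2 = ∑ z ∈ s ×ˢ s, B z ^ 2 / 2 := by
    refine Finset.sum_nbij' Prod.swap Prod.swap ?_ ?_ ?_ ?_ ?_ <;> simp +contextual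
  rw [Finset.sum_add_distrib, h2, ← Finset.sum_add_distrib] at h1
  simp only [add_halves] at h1
  nlinarith

/-- Sums of products of linear forms in independent variables: only covariances enter the bound for
the variance. -/
lemma IsStdNoise.integral_sum_mul_sq_le [IsProbabilityMeasure μ] [DecidableEq P]
    (h : IsStdNoise μ κ ξ) (s : Finset P) {𝒜 : Type*} (S : Finset 𝒜) (w : 𝒜 → ℝ)
    (b b' : 𝒜 → P → ℝ) :
    Integrable (fun ω => (∑ a ∈ S, w a * ((∑ p ∈ s, b a p * ξ p ω) * (∑ p ∈ s, b' a p * ξ p ω)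
      - ∑ p ∈ s, b a p * b' a p)) ^ 2) μ ∧
    ∫ ω, (∑ a ∈ S, w a * ((∑ p ∈ s, b a p * ξ p ω) * (∑ p ∈ s, b' a p * ξ p ω)
      - ∑ p ∈ s, b a p * b' a p)) ^ 2 ∂μ
      ≤ 2 * (κ + 1) * ∑ a ∈ S, ∑ a' ∈ S, w a * w a' *
        ((∑ p ∈ s, b a p * b a' p) * (∑ p ∈ s, b' a p * b' a' p)) := by
  have e1 : ∀ ω, ∑ a ∈ S, w a * ((∑ p ∈ s, b a p * ξ p ω) * (∑ p ∈ s, b' a p * ξ p ω)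
      - ∑ p ∈ s, b a p * b' a p) = ∑ z ∈ s ×ˢ s, (∑ a ∈ S, w a * b a z.1 * b' a z.2) *
        (ξ z.1 ω * ξ z.2 ω - if z.1 = z.2 then 1 else 0) := by
    intro ω
    simp_rw [Finset.sum_mul (s := S)]
    rw [Finset.sum_comm]
    refine Finset.sum_congr rfl fun a _ => ?_
    rw [Finset.sum_mul_sum, Finset.sum_product]
    have : ∑ p ∈ s, b a p * b' a p =
        ∑ p ∈ s, ∑ q ∈ s, b a p * b' a q * (if p = q then 1 else 0) :=
      Finset.sum_congr rfl fun p hp => by simp [hp]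
    rw [this, ← Finset.sum_sub_distrib, Finset.mul_sum]
    refine Finset.sum_congr rfl fun p _ => ?_
    rw [← Finset.sum_sub_distrib, Finset.mul_sum]
    exact Finset.sum_congr rfl fun q _ => by ring
  -- the matrix of the quadratic form is a combination of rank-one matrices `b_a b'_a'`
  have e2 : ∑ z ∈ s ×ˢ s, (∑ a ∈ S, w a * b a z.1 * b' a z.2) ^ 2 =
      ∑ a ∈ S, ∑ a' ∈ S, w a * w a' *
        ((∑ p ∈ s, b a p * b a' p) * (∑ p ∈ s, b' a p * b' a' p)) := by
    simp_rw [pow_two, Finset.sum_mul_sum (s := S)]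
    rw [Finset.sum_comm]
    refine Finset.sum_congr rfl fun a _ => ?_
    rw [Finset.sum_comm]
    refine Finset.sum_congr rfl fun a' _ => ?_
    rw [Finset.sum_mul_sum, Finset.mul_sum, Finset.sum_product]
    refine Finset.sum_congr rfl fun p _ => ?_
    rw [Finset.mul_sum]
    exact Finset.sum_congr rfl fun q _ => by ring
  have := h.integral_quadForm_sq_le s (fun z => ∑ a ∈ S, w a * b a z.1 * b' a z.2)
  simp_rw [e1]
  rw [← e2]
  exact this

end QuadraticForms

/-! ### Linear processes -/

section LinearProcesses

/-- `∑ |a_q| |a_{q'}|` over the pairs with `q - q' = τ`: a bound for the autocovariance at lag `τ`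
of a linear process with coefficients `a` and unit-variance innovations, and of all its
truncations. -/
noncomputable def autocovBound (a : ℕ → ℝ) (τ : ℤ) : ℝ :=
  ∑' z : ℕ × ℕ, if (z.1 : ℤ) - z.2 = τ then |a z.1| * |a z.2| else 0

variable {a : ℕ → ℝ}

lemma autocovBound_nonneg (a : ℕ → ℝ) (τ : ℤ) : 0 ≤ autocovBound a τ :=
  tsum_nonneg fun z => by split_ifs <;> positivity

lemma summable_abs_mul_abs (ha : Summable fun q => |a q|) :
    Summable fun z : ℕ × ℕ => |a z.1| * |a z.2| :=
  Summable.mul_of_nonneg ha ha (fun _ => abs_nonneg _) fun _ => abs_nonneg _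

lemma summable_autocovBound (ha : Summable fun q => |a q|) (τ : ℤ) :
    Summable fun z : ℕ × ℕ => if (z.1 : ℤ) - z.2 = τ then |a z.1| * |a z.2| else 0 := by
  refine (summable_abs_mul_abs ha).of_nonneg_of_le (fun z => ?_) fun z => ?_
  · split_ifs <;> positivity
  · split_ifs
    · exact le_rfl
    · positivity

lemma sum_autocovBound_le (ha : Summable fun q => |a q|) (F : Finset ℤ) :
    ∑ τ ∈ F, autocovBound a τ ≤ (∑' q, |a q|) ^ 2 := by
  unfold autocovBound
  rw [← Summable.tsum_finsetSum fun τ _ => summable_autocovBound ha τ, pow_two,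
    ha.tsum_mul_tsum ha (summable_abs_mul_abs ha)]
  refine Summable.tsum_le_tsum (fun z => ?_) (summable_sum fun τ _ => summable_autocovBound ha τ)
    (summable_abs_mul_abs ha)
  rw [Finset.sum_ite_eq]
  split_ifs
  · exact le_rfl
  · positivity

/-- The coefficient of the innovation at time `u` in the linear process at time `t`, truncated
after `N` terms. -/
noncomputable def truncCoeff (a : ℕ → ℝ) (N : ℕ) (t u : ℤ) : ℝ :=
  ∑ q ∈ Finset.range N, if t - q = u then a q else 0

lemma sum_truncCoeff_mul (a : ℕ → ℝ) (N : ℕ) (t : ℤ) (U : Finset ℤ)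
    (hU : ∀ q < N, t - (q : ℤ) ∈ U) (X : ℤ → ℝ) :
    ∑ u ∈ U, truncCoeff a N t u * X u = ∑ q ∈ Finset.range N, a q * X (t - q) := by
  simp only [truncCoeff, Finset.sum_mul]
  rw [Finset.sum_comm]
  refine Finset.sum_congr rfl fun q hq => ?_
  simp [hU q (Finset.mem_range.1 hq)]

lemma sum_truncCoeff_mul_truncCoeff (a : ℕ → ℝ) (N : ℕ) (t t' : ℤ) (U : Finset ℤ)
    (hU : ∀ q < N, t - (q : ℤ) ∈ U) :
    ∑ u ∈ U, truncCoeff a N t u * truncCoeff a N t' u = ∑ q ∈ Finset.range N,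
      ∑ q' ∈ Finset.range N, if (q : ℤ) - q' = t - t' then a q * a q' else 0 := by
  rw [sum_truncCoeff_mul a N t U hU]
  refine Finset.sum_congr rfl fun q _ => ?_
  rw [truncCoeff, Finset.mul_sum]
  refine Finset.sum_congr rfl fun q' _ => ?_
  have : t' - (q' : ℤ) = t - q ↔ (q : ℤ) - q' = t - t' := by constructor <;> intro h <;> linarith
  simp [this]

lemma abs_sum_truncCoeff_le (ha : Summable fun q => |a q|) (N : ℕ) (t t' : ℤ) (U : Finset ℤ)
    (hU : ∀ q < N, t - (q : ℤ) ∈ U) :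
    |∑ u ∈ U, truncCoeff a N t u * truncCoeff a N t' u| ≤ autocovBound a (t - t') := by
  rw [sum_truncCoeff_mul_truncCoeff a N t t' U hU, ← Finset.sum_product']
  refine (Finset.abs_sum_le_sum_abs _ _).trans ?_
  refine le_trans (Finset.sum_le_sum fun z _ => le_of_eq ?_)
    ((summable_autocovBound ha (t - t')).sum_le_tsum (Finset.range N ×ˢ Finset.range N)
      fun z _ => ?_)
  · split_ifs
    · rw [abs_mul]
    · simp
  · split_ifs <;> positivity

lemma sum_truncCoeff_sq (a : ℕ → ℝ) (N : ℕ) (t : ℤ) (U : Finset ℤ)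
    (hU : ∀ q < N, t - (q : ℤ) ∈ U) :
    ∑ u ∈ U, truncCoeff a N t u * truncCoeff a N t u = ∑ q ∈ Finset.range N, a q ^ 2 := by
  rw [sum_truncCoeff_mul_truncCoeff a N t t U hU]
  refine Finset.sum_congr rfl fun q hq => ?_
  have : ∀ q' : ℕ, ((q : ℤ) - q' = t - t) ↔ q = q' := fun q' => by omega
  simp only [this, Finset.sum_ite_eq, hq, if_true, pow_two]

variable {Ω : Type*} [MeasurableSpace Ω] {μ : Measure Ω} [IsProbabilityMeasure μ]
  {ι : Type*} [Fintype ι] [DecidableEq ι] {κ : ℝ}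

/-- Variance bound for sums of products of linear combinations of linear processes. It is proved
for the truncated processes, and passes to the limit by Fatou's lemma. -/
lemma lintegral_sum_mul_sq_le {ac : ι → ℕ → ℝ} {X x : ℤ → Ω → ι → ℝ}
    (hX : IsStdNoise μ κ fun (p : ℤ × ι) ω => X p.1 ω p.2)
    (hx : ∀ t c, ∀ᵐ ω ∂μ, HasSum (fun q : ℕ => ac c q * X (t - q) ω c) (x t ω c))
    (hac : ∀ c, IsCoeffSeq (ac c)) {R : ℤ → ℝ} (hR : ∀ c τ, autocovBound (ac c) τ ≤ R τ)
    {𝒜 : Type*} (S : Finset 𝒜) (time : 𝒜 → ℤ) (w : 𝒜 → ℝ) (β β' : 𝒜 → ι → ℝ) (hκ : 0 ≤ κ) :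
    ∫⁻ ω, ENNReal.ofReal ((∑ a ∈ S, w a * ((∑ c, β a c * x (time a) ω c) *
      (∑ c, β' a c * x (time a) ω c) - ∑ c, β a c * β' a c)) ^ 2) ∂μ ≤
    ENNReal.ofReal (2 * (κ + 1) * ∑ a ∈ S, ∑ a' ∈ S, |w a| * |w a'| * R (time a - time a') ^ 2 *
      ((∑ c, |β a c| * |β a' c|) * ∑ c, |β' a c| * |β' a' c|)) := by
  set B := 2 * (κ + 1) * ∑ a ∈ S, ∑ a' ∈ S, |w a| * |w a'| * R (time a - time a') ^ 2 *
      ((∑ c, |β a c| * |β a' c|) * ∑ c, |β' a c| * |β' a' c|) with hB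
  -- the truncated processes; their variances are `∑_{q < N} a_q²`, not yet `1`
  set xN : ℕ → ℤ → Ω → ι → ℝ := fun N t ω c => ∑ q ∈ Finset.range N, ac c q * X (t - q) ω c
  set f : ℕ → Ω → ℝ := fun N ω => (∑ a ∈ S, w a * ((∑ c, β a c * xN N (time a) ω c) *
      (∑ c, β' a c * xN N (time a) ω c) -
      ∑ c, β a c * β' a c * ∑ q ∈ Finset.range N, ac c q ^ 2)) ^ 2 with hf
  have key : ∀ N, Integrable (f N) μ ∧ ∫ ω, f N ω ∂μ ≤ B := by
    intro N
    -- the times of the finitely many innovations that enter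
    set U : Finset ℤ := S.biUnion fun a => (Finset.range N).image fun q : ℕ => time a - (q : ℤ)
    have hU : ∀ a ∈ S, ∀ q < N, time a - (q : ℤ) ∈ U := fun a ha q hq =>
      Finset.mem_biUnion.2 ⟨a, ha, Finset.mem_image.2 ⟨q, Finset.mem_range.2 hq, rfl⟩⟩
    have H := hX.integral_sum_mul_sq_le (U ×ˢ Finset.univ) S w
      (fun a p => β a p.2 * truncCoeff (ac p.2) N (time a) p.1)
      (fun a p => β' a p.2 * truncCoeff (ac p.2) N (time a) p.1)
    have lin : ∀ (γ : 𝒜 → ι → ℝ), ∀ a ∈ S, ∀ ω, ∑ p ∈ U ×ˢ (Finset.univ : Finset ι),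
        γ a p.2 * truncCoeff (ac p.2) N (time a) p.1 * X p.1 ω p.2 =
        ∑ c, γ a c * xN N (time a) ω c := by
      intro γ a ha ω
      rw [Finset.sum_product_right]
      refine Finset.sum_congr rfl fun c _ => ?_
      change _ = γ a c * ∑ q ∈ Finset.range N, ac c q * X (time a - q) ω c
      rw [← sum_truncCoeff_mul (ac c) N (time a) U (hU a ha) (fun u => X u ω c), Finset.mul_sum]
      exact Finset.sum_congr rfl fun u _ => by ring
    have cov : ∀ (γ γ' : 𝒜 → ι → ℝ), ∀ a ∈ S, ∀ a', ∑ p ∈ U ×ˢ (Finset.univ : Finset ι),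
        (γ a p.2 * truncCoeff (ac p.2) N (time a) p.1) *
          (γ' a' p.2 * truncCoeff (ac p.2) N (time a') p.1) =
        ∑ c, γ a c * γ' a' c *
          ∑ u ∈ U, truncCoeff (ac c) N (time a) u * truncCoeff (ac c) N (time a') u := by
      intro γ γ' a ha a'
      rw [Finset.sum_product_right]
      refine Finset.sum_congr rfl fun c _ => ?_
      rw [Finset.mul_sum]
      exact Finset.sum_congr rfl fun u _ => by ring
    have covle : ∀ (γ : 𝒜 → ι → ℝ), ∀ a ∈ S, ∀ a', |∑ p ∈ U ×ˢ (Finset.univ : Finset ι),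
        (γ a p.2 * truncCoeff (ac p.2) N (time a) p.1) *
          (γ a' p.2 * truncCoeff (ac p.2) N (time a') p.1)| ≤
        R (time a - time a') * ∑ c, |γ a c| * |γ a' c| := by
      intro γ a ha a'
      rw [cov γ γ a ha a', Finset.mul_sum]
      refine (Finset.abs_sum_le_sum_abs _ _).trans (Finset.sum_le_sum fun c _ => ?_)
      rw [abs_mul, abs_mul, mul_comm]
      exact mul_le_mul_of_nonneg_right
        ((abs_sum_truncCoeff_le (hac c).abs N _ _ U (hU a ha)).trans (hR c _)) (by positivity)
    have ef : ∀ ω, (∑ a ∈ S, w a * ((∑ p ∈ U ×ˢ (Finset.univ : Finset ι),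
        β a p.2 * truncCoeff (ac p.2) N (time a) p.1 * X p.1 ω p.2) *
        (∑ p ∈ U ×ˢ (Finset.univ : Finset ι),
        β' a p.2 * truncCoeff (ac p.2) N (time a) p.1 * X p.1 ω p.2) -
        ∑ p ∈ U ×ˢ (Finset.univ : Finset ι), (β a p.2 * truncCoeff (ac p.2) N (time a) p.1) *
          (β' a p.2 * truncCoeff (ac p.2) N (time a) p.1))) ^ 2 = f N ω := by
      intro ω
      simp only [hf]
      congr 1
      refine Finset.sum_congr rfl fun a ha => ?_
      rw [lin β a ha, lin β' a ha, cov β β' a ha a]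
      congr 2
      exact Finset.sum_congr rfl fun c _ => by
        rw [sum_truncCoeff_sq (ac c) N (time a) U (hU a ha)]
    simp only [ef] at H
    refine ⟨H.1, H.2.trans ?_⟩
    rw [hB]
    refine mul_le_mul_of_nonneg_left ?_ (by linarith)
    refine Finset.sum_le_sum fun a ha => Finset.sum_le_sum fun a' _ => ?_
    refine (le_abs_self _).trans ?_
    rw [abs_mul, abs_mul, abs_mul]
    calc _ ≤ |w a| * |w a'| * ((R (time a - time a') * ∑ c, |β a c| * |β a' c|) *
          (R (time a - time a') * ∑ c, |β' a c| * |β' a' c|)) := by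
          refine mul_le_mul_of_nonneg_left ?_ (by positivity)
          exact mul_le_mul (covle β a ha a') (covle β' a ha a') (abs_nonneg _)
            ((abs_nonneg _).trans (covle β a ha a'))
      _ = _ := by ring
  have hmeas : ∀ N, Measurable fun ω => ENNReal.ofReal (f N ω) := by
    intro N
    have hXm : ∀ t c, Measurable fun ω => X t ω c := fun t c => hX.meas (t, c)
    have hxm : ∀ t c, Measurable fun ω => xN N t ω c := fun t c =>
      Finset.measurable_sum _ fun q _ => (hXm _ _).const_mul _
    exact ENNReal.measurable_ofReal.comp (by simp only [hf]; fun_prop)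
  have hlim : ∀ᵐ ω ∂μ, ENNReal.ofReal ((∑ a ∈ S, w a * ((∑ c, β a c * x (time a) ω c) *
      (∑ c, β' a c * x (time a) ω c) - ∑ c, β a c * β' a c)) ^ 2) =
      liminf (fun N => ENNReal.ofReal (f N ω)) atTop := by
    have hall : ∀ᵐ ω ∂μ, ∀ (t : ℤ) (c : ι), HasSum (fun q : ℕ => ac c q * X (t - q) ω c)
        (x t ω c) := by
      rw [ae_all_iff]; intro t; rw [ae_all_iff]; exact fun c => hx t c
    filter_upwards [hall] with ω hω
    refine (Tendsto.liminf_eq ?_).symm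
    refine (ENNReal.continuous_ofReal.tendsto _).comp ?_
    have h1 : ∀ t c, Tendsto (fun N => xN N t ω c) atTop (𝓝 (x t ω c)) :=
      fun t c => (hω t c).tendsto_sum_nat
    have h2 : ∀ c, Tendsto (fun N => ∑ q ∈ Finset.range N, ac c q ^ 2) atTop (𝓝 1) :=
      fun c => (hac c).sq.tendsto_sum_nat
    simp only [hf]
    refine Tendsto.pow (tendsto_finsetSum _ fun a _ => Tendsto.const_mul _ (Tendsto.sub
      (Tendsto.mul (tendsto_finsetSum _ fun c _ => (h1 _ c).const_mul _)
        (tendsto_finsetSum _ fun c _ => (h1 _ c).const_mul _)) ?_)) 2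
    refine tendsto_finsetSum _ fun c _ => ?_
    simpa using (h2 c).const_mul (β a c * β' a c)
  rw [lintegral_congr_ae hlim]
  refine (lintegral_liminf_le hmeas).trans ?_
  refine (liminf_le_liminf (v := fun _ : ℕ => ENNReal.ofReal B)
    (Eventually.of_forall fun N => ?_)).trans (by simp)
  rw [← ofReal_integral_eq_lintegral_ofReal (key N).1
    (Eventually.of_forall fun ω => sq_nonneg _)]
  exact ENNReal.ofReal_le_ofReal (key N).2

/-- Variance bound for sums over fibres `h` and times `t`. The weights enter only through the bound
`W` for their quadratic forms in the squared autocovariances. -/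
lemma lintegral_sum_sum_mul_sq_le {ac : ι → ℕ → ℝ} {X x : ℤ → Ω → ι → ℝ}
    (hX : IsStdNoise μ κ fun (p : ℤ × ι) ω => X p.1 ω p.2)
    (hx : ∀ t c, ∀ᵐ ω ∂μ, HasSum (fun q : ℕ => ac c q * X (t - q) ω c) (x t ω c))
    (hac : ∀ c, IsCoeffSeq (ac c)) {R : ℤ → ℝ} (hR : ∀ c τ, autocovBound (ac c) τ ≤ R τ)
    {H : Type*} [Fintype H] (𝒯 : Finset ℤ) (w : H → ℤ → ℝ) (β β' : H → ι → ℝ) (hκ : 0 ≤ κ) {W : ℝ}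
    (hW : ∀ h h', ∑ t ∈ 𝒯, ∑ s ∈ 𝒯, |w h t| * |w h' s| * R (t - s) ^ 2 ≤ W) :
    ∫⁻ ω, ENNReal.ofReal ((∑ h, ∑ t ∈ 𝒯, w h t * ((∑ c, β h c * x t ω c) *
      (∑ c, β' h c * x t ω c) - ∑ c, β h c * β' h c)) ^ 2) ∂μ ≤
    ENNReal.ofReal (2 * (κ + 1) * W * ∑ h, ∑ h',
      (∑ c, |β h c| * |β h' c|) * ∑ c, |β' h c| * |β' h' c|) := by
  have H := lintegral_sum_mul_sq_le hX hx hac hR ((Finset.univ : Finset H) ×ˢ 𝒯) (fun a => a.2)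
    (fun a => w a.1 a.2) (fun a => β a.1) (fun a => β' a.1) hκ
  simp only [Finset.sum_product] at H
  refine H.trans (ENNReal.ofReal_le_ofReal ?_)
  rw [mul_assoc _ W]
  refine mul_le_mul_of_nonneg_left ?_ (by linarith)
  rw [Finset.mul_sum]
  refine Finset.sum_le_sum fun h _ => ?_
  rw [Finset.sum_comm, Finset.mul_sum]
  refine Finset.sum_le_sum fun h' _ => ?_
  simp_rw [← Finset.sum_mul]
  exact mul_le_mul_of_nonneg_right (hW h h') (by positivity)

end LinearProcesses

section Weights

variable {R : ℤ → ℝ} {L : ℝ}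

lemma sum_sub_sq_le (hR0 : ∀ τ, 0 ≤ R τ) (hL : ∀ F : Finset ℤ, ∑ τ ∈ F, R τ ≤ L)
    (𝒯 : Finset ℤ) (t : ℤ) : ∑ s ∈ 𝒯, R (t - s) ^ 2 ≤ L ^ 2 := by
  have h1 : ∑ s ∈ 𝒯, R (t - s) ≤ L := by
    have := hL (𝒯.image fun s => t - s)
    rwa [Finset.sum_image fun a _ b _ h => by simpa using h] at this
  calc ∑ s ∈ 𝒯, R (t - s) ^ 2 ≤ (∑ s ∈ 𝒯, R (t - s)) ^ 2 :=
        Finset.sum_sq_le_sq_sum_of_nonneg fun s _ => hR0 _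
    _ ≤ L ^ 2 := by
        have := Finset.sum_nonneg fun s (_ : s ∈ 𝒯) => hR0 (t - s)
        gcongr

/-- Weights of size at most `b` on each of `|𝒯|` times: by the summability of `R`, the quadratic
form is of order `b² |𝒯|` instead of `b² |𝒯|²`. -/
lemma weights_bound_of_abs_le {H : Type*} (hR0 : ∀ τ, 0 ≤ R τ)
    (hL : ∀ F : Finset ℤ, ∑ τ ∈ F, R τ ≤ L) (𝒯 : Finset ℤ) (w : H → ℤ → ℝ) {b : ℝ}
    (hb : ∀ h, ∀ t ∈ 𝒯, |w h t| ≤ b) (h h' : H) :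
    ∑ t ∈ 𝒯, ∑ s ∈ 𝒯, |w h t| * |w h' s| * R (t - s) ^ 2 ≤ L ^ 2 * (b ^ 2 * 𝒯.card) := by
  calc ∑ t ∈ 𝒯, ∑ s ∈ 𝒯, |w h t| * |w h' s| * R (t - s) ^ 2
      ≤ ∑ t ∈ 𝒯, ∑ s ∈ 𝒯, b * b * R (t - s) ^ 2 := by
        refine Finset.sum_le_sum fun t ht => Finset.sum_le_sum fun s hs => ?_
        have h1 := hb h t ht
        have h2 := hb h' s hs
        have := (abs_nonneg _).trans h1
        gcongr
    _ ≤ ∑ t ∈ 𝒯, b * b * L ^ 2 := by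
        refine Finset.sum_le_sum fun t _ => ?_
        rw [← Finset.mul_sum]
        exact mul_le_mul_of_nonneg_left (sum_sub_sq_le hR0 hL 𝒯 t) (mul_self_nonneg b)
    _ = _ := by rw [Finset.sum_const, nsmul_eq_mul]; ring

/-- Weights of total size at most `η`: the bound does not depend on the number of times. -/
lemma weights_bound_of_sum_abs_le {H : Type*} (hR0 : ∀ τ, 0 ≤ R τ)
    (hL : ∀ F : Finset ℤ, ∑ τ ∈ F, R τ ≤ L) (𝒯 : Finset ℤ) (w : H → ℤ → ℝ) {η : ℝ}
    (hb : ∀ h, ∑ t ∈ 𝒯, |w h t| ≤ η) (h h' : H) :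
    ∑ t ∈ 𝒯, ∑ s ∈ 𝒯, |w h t| * |w h' s| * R (t - s) ^ 2 ≤ L ^ 2 * η ^ 2 := by
  have hRL : ∀ τ, R τ ^ 2 ≤ L ^ 2 := fun τ => by
    have := hL {τ}
    rw [Finset.sum_singleton] at this
    exact pow_le_pow_left₀ (hR0 τ) this 2
  calc ∑ t ∈ 𝒯, ∑ s ∈ 𝒯, |w h t| * |w h' s| * R (t - s) ^ 2
      ≤ ∑ t ∈ 𝒯, ∑ s ∈ 𝒯, |w h t| * |w h' s| * L ^ 2 := by
        refine Finset.sum_le_sum fun t _ => Finset.sum_le_sum fun s _ => ?_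
        exact mul_le_mul_of_nonneg_left (hRL _) (by positivity)
    _ = L ^ 2 * ((∑ t ∈ 𝒯, |w h t|) * ∑ s ∈ 𝒯, |w h' s|) := by
        simp_rw [← Finset.sum_mul]
        rw [Finset.sum_mul_sum]; ring
    _ ≤ L ^ 2 * η ^ 2 := by
        have h0 : 0 ≤ ∑ t ∈ 𝒯, |w h' t| := Finset.sum_nonneg fun _ _ => abs_nonneg _
        have h1 := hb h
        have h2 := hb h'
        have h3 : 0 ≤ η := h0.trans h2
        rw [pow_two η]
        gcongr

end Weights

/-! ### The innovations of all the series -/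

section Combine

variable {Ω : Type*} [MeasurableSpace Ω] {μ : Measure Ω} {P₁ P₂ : Type*} {κ : ℝ}

/-- Two mutually independent families that are independent of each other form one mutually
independent family. -/
lemma iIndepFun_sumElim {f : P₁ → Ω → ℝ} {g : P₂ → Ω → ℝ} (hf : iIndepFun f μ)
    (hg : iIndepFun g μ) (hfg : IndepFun (fun ω p => f p ω) (fun ω p => g p ω) μ) :
    iIndepFun (Sum.elim f g) μ := by
  classical
  rw [iIndepFun_iff_measure_inter_preimage_eq_mul] at hf hg ⊢
  intro S sets hS
  have e : (⋂ i ∈ S, Sum.elim f g i ⁻¹' sets i) =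
      ((fun ω p => f p ω) ⁻¹' (⋂ i ∈ S.toLeft, (fun x : P₁ → ℝ => x i) ⁻¹' sets (Sum.inl i))) ∩
      ((fun ω p => g p ω) ⁻¹' (⋂ i ∈ S.toRight, (fun x : P₂ → ℝ => x i) ⁻¹' sets (Sum.inr i))) := by
    ext ω
    simp only [Set.mem_iInter, Set.mem_preimage, Sum.forall, Sum.elim_inl, Sum.elim_inr,
      Set.mem_inter_iff, Finset.mem_toLeft, Finset.mem_toRight]
  have hl : ∀ i ∈ S.toLeft, MeasurableSet (sets (Sum.inl i)) := fun i hi =>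
    hS _ (Finset.mem_toLeft.1 hi)
  have hr : ∀ i ∈ S.toRight, MeasurableSet (sets (Sum.inr i)) := fun i hi =>
    hS _ (Finset.mem_toRight.1 hi)
  rw [e, indepFun_iff_measure_inter_preimage_eq_mul.1 hfg _ _
    (Finset.measurableSet_biInter _ fun i hi => measurable_pi_apply i (hl i hi))
    (Finset.measurableSet_biInter _ fun i hi => measurable_pi_apply i (hr i hi))]
  have el : ((fun ω p => f p ω) ⁻¹' (⋂ i ∈ S.toLeft, (fun x : P₁ → ℝ => x i) ⁻¹'
      sets (Sum.inl i))) = ⋂ i ∈ S.toLeft, f i ⁻¹' sets (Sum.inl i) := by ext ω; simp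
  have er : ((fun ω p => g p ω) ⁻¹' (⋂ i ∈ S.toRight, (fun x : P₂ → ℝ => x i) ⁻¹'
      sets (Sum.inr i))) = ⋂ i ∈ S.toRight, g i ⁻¹' sets (Sum.inr i) := by ext ω; simp
  rw [el, er, hf S.toLeft (sets := fun i => sets (Sum.inl i)) hl,
    hg S.toRight (sets := fun i => sets (Sum.inr i)) hr]
  conv_rhs => rw [← Finset.toLeft_disjSum_toRight (u := S), Finset.prod_disjSum]
  rfl

lemma IsStdNoise.sumElim {f : P₁ → Ω → ℝ} {g : P₂ → Ω → ℝ} (hf : IsStdNoise μ κ f)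
    (hg : IsStdNoise μ κ g) (hfg : IndepFun (fun ω p => f p ω) (fun ω p => g p ω) μ) :
    IsStdNoise μ κ (Sum.elim f g) where
  meas := by rintro (p | p); exacts [hf.meas p, hg.meas p]
  indep := iIndepFun_sumElim hf.indep hg.indep hfg
  mean := by rintro (p | p); exacts [hf.mean p, hg.mean p]
  second := by rintro (p | p); exacts [hf.second p, hg.second p]
  integrable_fourth := by rintro (p | p); exacts [hf.integrable_fourth p, hg.integrable_fourth p]
  fourth := by rintro (p | p); exacts [hf.fourth p, hg.fourth p]

lemma IsStdNoise.precomp {ξ : P₁ → Ω → ℝ} (h : IsStdNoise μ κ ξ) {g : P₂ → P₁}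
    (hg : Function.Injective g) : IsStdNoise μ κ fun p => ξ (g p) where
  meas p := h.meas (g p)
  indep := h.indep.precomp hg
  mean p := h.mean (g p)
  second p := h.second (g p)
  integrable_fourth p := h.integrable_fourth (g p)
  fourth p := h.fourth (g p)

lemma IsInnovation.isStdNoise [IsProbabilityMeasure μ] {ι : Type*} {X : ℤ → Ω → ι → ℝ}
    (h : IsInnovation μ κ X) (hm : ∀ t i, Measurable fun ω => X t ω i) :
    IsStdNoise μ κ fun (p : ℤ × ι) ω => X p.1 ω p.2 where
  meas p := hm p.1 p.2
  indep := h.indep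
  mean p := h.mean p.1 p.2
  second p := by
    have := h.var p.1 p.2
    rw [variance_eq_integral (hm p.1 p.2).aemeasurable, h.mean p.1 p.2] at this
    simpa using this
  integrable_fourth p := (h.fourth p.1 p.2).1
  fourth p := (h.fourth p.1 p.2).2

end Combine

section ModelNoise

variable {Ω : Type*} [MeasurableSpace Ω] {μ : Measure Ω} [IsProbabilityMeasure μ] {K : ℕ}
  {r re : Fin K → ℕ} (S : Model Ω r re)

/-- Index set of the elements of the factor, of the common noise and of the idiosyncratic noise
series together. -/
abbrev SeriesIndex (S : Model Ω r re) : Type := MultiIndex r ⊕ (MultiIndex re ⊕ MultiIndex S.d)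

namespace Model

/-- The innovations of all the series. -/
def innov (t : ℤ) (ω : Ω) : SeriesIndex S → ℝ :=
  Sum.elim (S.Xf t ω) (Sum.elim (S.Xe t ω) (S.Xeps t ω))

/-- The factor, the common noise and the idiosyncratic noise series. -/
def series (t : ℤ) (ω : Ω) : SeriesIndex S → ℝ :=
  Sum.elim (S.F t ω) (Sum.elim (S.Fe t ω) (S.eps t ω))

/-- The coefficients of the linear processes. -/
def coeffs (af ae aeps : ℕ → ℝ) : SeriesIndex S → ℕ → ℝ :=
  Sum.elim (fun _ => af) (Sum.elim (fun _ => ae) fun _ => aeps)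

end Model

lemma isStdNoise_innov {κ : ℝ} (hm : IsMeasurableModel S) (hf : IsInnovation μ κ S.Xf)
    (he : IsInnovation μ κ S.Xe) (hs : IsInnovation μ κ S.Xeps)
    (hes : IndepFun (fun ω t i => S.Xe t ω i) (fun ω t i => S.Xeps t ω i) μ)
    (hfes : IndepFun (fun ω => ((fun t i => S.Xe t ω i), fun t i => S.Xeps t ω i))
      (fun ω t i => S.Xf t ω i) μ) :
    IsStdNoise μ κ fun (p : ℤ × SeriesIndex S) ω => S.innov p.1 ω p.2 := by
  have nf := hf.isStdNoise hm.Xf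
  have ne := he.isStdNoise hm.Xe
  have ns := hs.isStdNoise hm.Xeps
  have nes := ne.sumElim ns (hes.comp
    (φ := fun (x : ℤ → MultiIndex re → ℝ) (p : ℤ × MultiIndex re) => x p.1 p.2)
    (ψ := fun (x : ℤ → MultiIndex S.d → ℝ) (p : ℤ × MultiIndex S.d) => x p.1 p.2)
    (by fun_prop) (by fun_prop))
  have nall := nf.sumElim nes ((hfes.symm.comp
    (φ := fun (x : ℤ → MultiIndex r → ℝ) (p : ℤ × MultiIndex r) => x p.1 p.2)
    (ψ := fun (x : (ℤ → MultiIndex re → ℝ) × (ℤ → MultiIndex S.d → ℝ))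
      (p : (ℤ × MultiIndex re) ⊕ (ℤ × MultiIndex S.d)) =>
        Sum.elim (fun p => x.1 p.1 p.2) (fun p => x.2 p.1 p.2) p)
    (by fun_prop) (measurable_pi_lambda _ (by
      rintro (p | p) <;> simp only [Sum.elim_inl, Sum.elim_inr] <;> fun_prop))).congr
      (Filter.EventuallyEq.rfl) (Eventually.of_forall fun ω => by
        funext p; rcases p with p | p <;> rfl))
  have := nall.precomp (P₂ := ℤ × SeriesIndex S)
    (g := fun p => Sum.elim (fun m => Sum.inl (p.1, m))
      (Sum.elim (fun m => Sum.inr (Sum.inl (p.1, m))) fun m => Sum.inr (Sum.inr (p.1, m))) p.2)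
    (by
      rintro ⟨t, (m | m | m)⟩ ⟨t', (m' | m' | m')⟩ h <;> simp_all)
  convert this using 2 with p
  obtain ⟨t, (m | m | m)⟩ := p <;> rfl

end ModelNoise

/-! ### Sums of absolute Gram entries -/

section Gram

variable {ι : Type*} [Fintype ι]

/-- The inner product of the absolute values of two coefficient vectors. -/
def absGram (β β' : ι → ℝ) : ℝ := ∑ c, |β c| * |β' c|

lemma absGram_nonneg (β β' : ι → ℝ) : 0 ≤ absGram β β' :=
  Finset.sum_nonneg fun _ _ => by positivity

lemma absGram_comm (β β' : ι → ℝ) : absGram β β' = absGram β' β :=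
  Finset.sum_congr rfl fun _ _ => mul_comm _ _

lemma abs_sum_mul_le_absGram (β β' : ι → ℝ) : |∑ c, β c * β' c| ≤ absGram β β' :=
  (Finset.abs_sum_le_sum_abs _ _).trans (Finset.sum_le_sum fun _ _ => (abs_mul _ _).le)

lemma absGram_le_half (β β' : ι → ℝ) :
    absGram β β' ≤ ((∑ c, β c ^ 2) + ∑ c, β' c ^ 2) / 2 := by
  rw [← Finset.sum_add_distrib, Finset.sum_div]
  refine Finset.sum_le_sum fun c _ => ?_
  nlinarith [sq_nonneg (|β c| - |β' c|), sq_abs (β c), sq_abs (β' c)]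

variable {p : ℕ} {H : Type*} [Fintype H] {e c : Fin p → H → ι → ℝ} {Γ : ℝ}

lemma sum_fiber_absGram_le (he : ∀ i h, ∑ j, ∑ h', absGram (e i h) (e j h') ≤ Γ) (i : Fin p)
    (h : H) : ∑ h', absGram (e i h) (e i h') ≤ Γ :=
  (Finset.single_le_sum (f := fun j => ∑ h', absGram (e i h) (e j h'))
    (fun _ _ => Finset.sum_nonneg fun _ _ => absGram_nonneg _ _) (Finset.mem_univ i)).trans (he i h)

lemma absGram_le (he : ∀ i h, ∑ j, ∑ h', absGram (e i h) (e j h') ≤ Γ) (i j : Fin p) (h h' : H) :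
    absGram (e i h) (e j h') ≤ Γ := by
  refine le_trans ?_ (he i h)
  refine le_trans ?_ (Finset.single_le_sum (f := fun j => ∑ h', absGram (e i h) (e j h'))
    (fun j _ => Finset.sum_nonneg fun h' _ => absGram_nonneg _ _) (Finset.mem_univ j))
  exact Finset.single_le_sum (f := fun h' => absGram (e i h) (e j h'))
    (fun h' _ => absGram_nonneg _ _) (Finset.mem_univ h')

lemma sum_absGram_mul_self_le (hΓ : 0 ≤ Γ)
    (he : ∀ i h, ∑ j, ∑ h', absGram (e i h) (e j h') ≤ Γ) :
    ∑ i, ∑ j, ∑ h, ∑ h', absGram (e i h) (e i h') * absGram (e j h) (e j h') ≤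
      Γ ^ 2 * (p ^ 2 * Fintype.card H) := by
  calc _ ≤ ∑ i : Fin p, ∑ _j : Fin p, ∑ _h : H, Γ * Γ := by
        refine Finset.sum_le_sum fun i _ => Finset.sum_le_sum fun j _ =>
          Finset.sum_le_sum fun h _ => ?_
        calc _ ≤ ∑ h', absGram (e i h) (e i h') * Γ :=
              Finset.sum_le_sum fun h' _ =>
                mul_le_mul_of_nonneg_left (absGram_le he j j h h') (absGram_nonneg _ _)
          _ ≤ Γ * Γ := by
              rw [← Finset.sum_mul]
              exact mul_le_mul_of_nonneg_right (sum_fiber_absGram_le he i h) hΓ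
    _ = _ := by simp; ring

/-- Schur's test: against a kernel with bounded row sums, the Gram matrix of the `c j h` counts only
by its diagonal. -/
lemma sum_absGram_mul_le
    (he : ∀ i h, ∑ j, ∑ h', absGram (e i h) (e j h') ≤ Γ) :
    ∑ i, ∑ j, ∑ h, ∑ h', absGram (e i h) (e i h') * absGram (c j h) (c j h') ≤
      Γ * (p * ∑ j, ∑ h, ∑ a, c j h a ^ 2) := by
  have key : ∀ i j, ∑ h, ∑ h', absGram (e i h) (e i h') * absGram (c j h) (c j h') ≤
      Γ * ∑ h, ∑ a, c j h a ^ 2 := by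
    intro i j
    have h1 : ∑ h, ∑ h', absGram (e i h) (e i h') * ∑ a, c j h a ^ 2 ≤
        Γ * ∑ h, ∑ a, c j h a ^ 2 := by
      rw [Finset.mul_sum]
      refine Finset.sum_le_sum fun h _ => ?_
      rw [← Finset.sum_mul]
      exact mul_le_mul_of_nonneg_right (sum_fiber_absGram_le he i h) (by positivity)
    have h2 : ∑ h, ∑ h', absGram (e i h) (e i h') * ∑ a, c j h' a ^ 2 =
        ∑ h, ∑ h', absGram (e i h) (e i h') * ∑ a, c j h a ^ 2 := by
      rw [Finset.sum_comm]
      exact Finset.sum_congr rfl fun h _ => Finset.sum_congr rfl fun h' _ => by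
        rw [absGram_comm]
    calc _ ≤ ∑ h, ∑ h', (absGram (e i h) (e i h') * (∑ a, c j h a ^ 2) / 2 +
          absGram (e i h) (e i h') * (∑ a, c j h' a ^ 2) / 2) := by
          refine Finset.sum_le_sum fun h _ => Finset.sum_le_sum fun h' _ => ?_
          have := mul_le_mul_of_nonneg_left (absGram_le_half (c j h) (c j h'))
            (absGram_nonneg (e i h) (e i h'))
          linarith
      _ ≤ _ := by
          simp_rw [Finset.sum_add_distrib, ← Finset.sum_div]
          rw [h2]; linarith
  calc _ ≤ ∑ i : Fin p, ∑ j, Γ * ∑ h, ∑ a, c j h a ^ 2 :=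
        Finset.sum_le_sum fun i _ => Finset.sum_le_sum fun j _ => key i j
    _ = _ := by simp_rw [← Finset.mul_sum]; simp

/-- Without decay of the Gram entries: Cauchy–Schwarz bounds them by their diagonal. -/
lemma sum_absGram_mul_le_sq :
    ∑ i, ∑ j, ∑ h, ∑ h', absGram (c i h) (c i h') * absGram (c j h) (c j h') ≤
      (∑ i, ∑ h, ∑ a, c i h a ^ 2) ^ 2 := by
  have e1 : ∑ i, ∑ j, ∑ h, ∑ h', absGram (c i h) (c i h') * absGram (c j h) (c j h') =
      ∑ h, ∑ h', (∑ i, absGram (c i h) (c i h')) ^ 2 := by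
    simp_rw [pow_two, Finset.sum_mul_sum]
    calc _ = ∑ i, ∑ h, ∑ j, ∑ h', absGram (c i h) (c i h') * absGram (c j h) (c j h') :=
          Finset.sum_congr rfl fun i _ => Finset.sum_comm
      _ = ∑ h, ∑ i, ∑ j, ∑ h', absGram (c i h) (c i h') * absGram (c j h) (c j h') :=
          Finset.sum_comm
      _ = _ := by
          refine Finset.sum_congr rfl fun h _ => ?_
          calc _ = ∑ i, ∑ h', ∑ j, absGram (c i h) (c i h') * absGram (c j h) (c j h') :=
                Finset.sum_congr rfl fun i _ => Finset.sum_comm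
            _ = _ := Finset.sum_comm
  rw [e1, Finset.sum_comm (f := fun i h => ∑ a, c i h a ^ 2), pow_two, Finset.sum_mul_sum]
  refine Finset.sum_le_sum fun h _ => Finset.sum_le_sum fun h' _ => ?_
  simp only [absGram]
  have := Finset.sum_mul_sq_le_sq_mul_sq (Finset.univ : Finset (Fin p × ι))
    (fun z => |c z.1 h z.2|) (fun z => |c z.1 h' z.2|)
  simpa only [Fintype.sum_prod_type, sq_abs] using this

/-- Each entry is at most `Γ |H|`, and so is each row sum. -/
lemma sum_sq_sum_mul_le (hΓ : 0 ≤ Γ) (he : ∀ i h, ∑ j, ∑ h', absGram (e i h) (e j h') ≤ Γ) :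
    ∑ i, ∑ j, (∑ h, ∑ a, e i h a * e j h a) ^ 2 ≤ Γ ^ 2 * (p * (Fintype.card H : ℝ) ^ 2) := by
  have h1 : ∀ i j, (∑ h, ∑ a, e i h a * e j h a) ^ 2 ≤
      (Γ * Fintype.card H) * ∑ h, absGram (e i h) (e j h) := by
    intro i j
    have hle : |∑ h, ∑ a, e i h a * e j h a| ≤ ∑ h, absGram (e i h) (e j h) :=
      (Finset.abs_sum_le_sum_abs _ _).trans
        (Finset.sum_le_sum fun h _ => abs_sum_mul_le_absGram _ _)
    have hle2 : ∑ h, absGram (e i h) (e j h) ≤ Γ * Fintype.card H := by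
      refine (Finset.sum_le_sum fun h _ => absGram_le he i j h h).trans (le_of_eq ?_)
      simp [mul_comm]
    have h0 := abs_nonneg (∑ h, ∑ a, e i h a * e j h a)
    rw [← sq_abs]
    nlinarith
  have h2 : ∀ i, ∑ j, ∑ h, absGram (e i h) (e j h) ≤ Γ * Fintype.card H := by
    intro i
    rw [Finset.sum_comm]
    calc _ ≤ ∑ _h : H, Γ := by
          refine Finset.sum_le_sum fun h _ => le_trans (Finset.sum_le_sum fun j _ => ?_) (he i h)
          exact Finset.single_le_sum (f := fun h' => absGram (e i h) (e j h'))
            (fun h' _ => absGram_nonneg _ _) (Finset.mem_univ h)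
      _ = _ := by simp [mul_comm]
  calc _ ≤ ∑ i : Fin p, (Γ * Fintype.card H) * (Γ * Fintype.card H) := by
        refine Finset.sum_le_sum fun i _ => ?_
        refine (Finset.sum_le_sum fun j _ => h1 i j).trans ?_
        rw [← Finset.mul_sum]
        exact mul_le_mul_of_nonneg_left (h2 i) (by positivity)
    _ = _ := by simp; ring

end Gram

section FrobeniusBound

variable {Ω : Type*} [MeasurableSpace Ω] {μ : Measure Ω} [IsProbabilityMeasure μ]
  {ι : Type*} [Fintype ι] [DecidableEq ι] {κ : ℝ}

/-- Variance bound, in squared Frobenius norm, for a matrix whose `(i, j)` entry is a weighted sum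
over fibres and times of products of linear processes. -/
lemma lintegral_sum_sq_le {ac : ι → ℕ → ℝ} {X x : ℤ → Ω → ι → ℝ}
    (hX : IsStdNoise μ κ fun (p : ℤ × ι) ω => X p.1 ω p.2)
    (hx : ∀ t c, ∀ᵐ ω ∂μ, HasSum (fun q : ℕ => ac c q * X (t - q) ω c) (x t ω c))
    (hxm : ∀ t c, Measurable fun ω => x t ω c)
    (hac : ∀ c, IsCoeffSeq (ac c)) {R : ℤ → ℝ} (hR : ∀ c τ, autocovBound (ac c) τ ≤ R τ)
    {p : ℕ} {H : Type*} [Fintype H] (𝒯 : Finset ℤ) (w : Fin p → Fin p → H → ℤ → ℝ)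
    (β β' : Fin p → H → ι → ℝ) (hκ : 0 ≤ κ) {W : ℝ}
    (hW : ∀ i j h h', ∑ t ∈ 𝒯, ∑ s ∈ 𝒯, |w i j h t| * |w i j h' s| * R (t - s) ^ 2 ≤ W) :
    ∫⁻ ω, ENNReal.ofReal (∑ i, ∑ j, (∑ h, ∑ t ∈ 𝒯, w i j h t * ((∑ c, β i h c * x t ω c) *
      (∑ c, β' j h c * x t ω c) - ∑ c, β i h c * β' j h c)) ^ 2) ∂μ ≤
    ENNReal.ofReal (2 * (κ + 1) * W * ∑ i, ∑ j, ∑ h, ∑ h',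
      absGram (β i h) (β i h') * absGram (β' j h) (β' j h')) := by
  by_cases hne : Nonempty H ∧ 0 < p
  swap
  · have e0 : ∀ ω, (∑ i : Fin p, ∑ j : Fin p, (∑ h, ∑ t ∈ 𝒯, w i j h t *
        ((∑ c, β i h c * x t ω c) * (∑ c, β' j h c * x t ω c) -
          ∑ c, β i h c * β' j h c)) ^ 2) = 0 := by
      intro ω
      rcases isEmpty_or_nonempty H with hH | hH
      · simp
      · have : p = 0 := by
          by_contra hp; exact hne ⟨hH, Nat.pos_of_ne_zero hp⟩
        subst this; simp
    simp [e0]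
  obtain ⟨⟨h0⟩, hp⟩ := hne
  have hW0 : 0 ≤ W := le_trans (Finset.sum_nonneg fun t _ => Finset.sum_nonneg fun s _ => by
    positivity) (hW ⟨0, hp⟩ ⟨0, hp⟩ h0 h0)
  have hm : ∀ i j, Measurable fun ω => ENNReal.ofReal ((∑ h, ∑ t ∈ 𝒯, w i j h t *
      ((∑ c, β i h c * x t ω c) * (∑ c, β' j h c * x t ω c) -
        ∑ c, β i h c * β' j h c)) ^ 2) := fun i j =>
    ENNReal.measurable_ofReal.comp (by fun_prop)
  have hs : ∀ ω, ENNReal.ofReal (∑ i, ∑ j, (∑ h, ∑ t ∈ 𝒯, w i j h t *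
      ((∑ c, β i h c * x t ω c) * (∑ c, β' j h c * x t ω c) - ∑ c, β i h c * β' j h c)) ^ 2) =
      ∑ i, ∑ j, ENNReal.ofReal ((∑ h, ∑ t ∈ 𝒯, w i j h t *
      ((∑ c, β i h c * x t ω c) * (∑ c, β' j h c * x t ω c) - ∑ c, β i h c * β' j h c)) ^ 2) := by
    intro ω
    rw [ENNReal.ofReal_sum_of_nonneg fun i _ => Finset.sum_nonneg fun j _ => sq_nonneg _]
    exact Finset.sum_congr rfl fun i _ => ENNReal.ofReal_sum_of_nonneg fun j _ => sq_nonneg _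
  simp_rw [hs]
  rw [lintegral_finsetSum _ fun i _ => Finset.measurable_sum _ fun j _ => hm i j]
  rw [Finset.mul_sum, ENNReal.ofReal_sum_of_nonneg]
  swap
  · exact fun i _ => mul_nonneg (by positivity) (Finset.sum_nonneg fun j _ =>
      Finset.sum_nonneg fun h _ => Finset.sum_nonneg fun h' _ =>
        mul_nonneg (absGram_nonneg _ _) (absGram_nonneg _ _))
  refine Finset.sum_le_sum fun i _ => ?_
  rw [lintegral_finsetSum _ fun j _ => hm i j, Finset.mul_sum, ENNReal.ofReal_sum_of_nonneg]
  swap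
  · exact fun j _ => mul_nonneg (by positivity) (
      Finset.sum_nonneg fun h _ => Finset.sum_nonneg fun h' _ =>
        mul_nonneg (absGram_nonneg _ _) (absGram_nonneg _ _))
  refine Finset.sum_le_sum fun j _ => ?_
  exact lintegral_sum_sum_mul_sq_le hX hx hac hR 𝒯 (w i j) (β i) (β' j) hκ (hW i j)

end FrobeniusBound

/-! ### The model as linear combinations of the underlying series -/

section ModelLoadings

variable {Ω : Type*} {K : ℕ} {r re : Fin K → ℕ}

namespace Model

variable (S : Model Ω r re)

/-- The multi-index with mode-`k` coordinate `i` and the other coordinates `h`. -/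
def fiberIndex (k : Fin K) (i : Fin (S.d k)) (h : CoIndex S.d k) : MultiIndex S.d :=
  (Equiv.piSplitAt k fun l => Fin (S.d l)).symm (i, h)

/-- Coefficients of the common component at `I` on the series. -/
def commLoad (ω : Ω) (I : MultiIndex S.d) : SeriesIndex S → ℝ :=
  Sum.elim (fun m => ∏ l, S.A l ω (I l) (m l)) 0

/-- Coefficients of the noise at `I` on the series. -/
def noiseLoad (I : MultiIndex S.d) : SeriesIndex S → ℝ :=
  Sum.elim 0 (Sum.elim (fun m => ∏ l, S.Ae l (I l) (m l)) fun J => if J = I then S.Sig I else 0)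

/-- The common component with the loadings at `ω` and the factors at `ω'`; the two arguments are
decoupled because loadings and factors are independent. -/
def comm (t : ℤ) (ω ω' : Ω) (I : MultiIndex S.d) : ℝ :=
  multiProd (S.F t ω') (fun l => S.A l ω) I

/-- `∏_k tr(A_k' A_k)`. -/
def traceProd (ω : Ω) : ℝ := ∏ l, ∑ j, S.Z l ω j

lemma sum_commLoad_mul (ω ω' : Ω) (t : ℤ) (I : MultiIndex S.d) :
    ∑ c, S.commLoad ω I c * S.series t ω' c = S.comm t ω ω' I := by
  simp [commLoad, series, comm, multiProd, Fintype.sum_sum_type]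

lemma sum_noiseLoad_mul (ω : Ω) (t : ℤ) (I : MultiIndex S.d) :
    ∑ c, S.noiseLoad I c * S.series t ω c = S.E t ω I := by
  simp [noiseLoad, series, E, multiProd, Fintype.sum_sum_type]

lemma sum_noiseLoad_mul_commLoad (ω : Ω) (I J : MultiIndex S.d) :
    ∑ c, S.noiseLoad I c * S.commLoad ω J c = 0 := by
  simp [noiseLoad, commLoad, Fintype.sum_sum_type]

lemma Z_eq (l : Fin K) (ω : Ω) (j : Fin (r l)) : S.Z l ω j = ∑ i, S.A l ω i j ^ 2 := by
  simp [Z, Matrix.diag, Matrix.mul_apply, pow_two]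

lemma Z_nonneg (l : Fin K) (ω : Ω) (j : Fin (r l)) : 0 ≤ S.Z l ω j := by
  rw [Z_eq]; positivity

lemma traceProd_nonneg (ω : Ω) : 0 ≤ S.traceProd ω :=
  Finset.prod_nonneg fun l _ => Finset.sum_nonneg fun j _ => S.Z_nonneg l ω j

lemma sum_fiberIndex (k : Fin K) (f : MultiIndex S.d → ℝ) :
    ∑ i, ∑ h, f (S.fiberIndex k i h) = ∑ I, f I := by
  rw [← Fintype.sum_prod_type' (f := fun i h => f (S.fiberIndex k i h))]
  exact Equiv.sum_comp (Equiv.piSplitAt k fun l => Fin (S.d l)).symm f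

lemma sum_commLoad_sq (ω : Ω) :
    ∑ I, ∑ c, S.commLoad ω I c ^ 2 = S.traceProd ω := by
  have h1 : ∀ I, ∑ c, S.commLoad ω I c ^ 2 = ∏ l, ∑ j, S.A l ω (I l) j ^ 2 := by
    intro I
    rw [Finset.prod_univ_sum, Fintype.piFinset_univ]
    simp [commLoad, Fintype.sum_sum_type, Finset.prod_pow]
  simp_rw [h1, traceProd, Z_eq]
  have h2 : ∀ l, ∑ j, ∑ i, S.A l ω i j ^ 2 = ∑ i, ∑ j, S.A l ω i j ^ 2 := fun l => Finset.sum_comm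
  simp_rw [h2]
  rw [Finset.prod_univ_sum, Fintype.piFinset_univ]

/-- The covariance kernel of the noise tensor has bounded row sums. -/
lemma sum_absGram_noiseLoad_le {Ca Cs : ℝ} (hCa0 : 0 ≤ Ca)
    (hCa : ∀ k j, ∑ i, |S.Ae k i j| ≤ Ca) (hCs : ∀ I, 0 ≤ S.Sig I ∧ S.Sig I ≤ Cs)
    (I : MultiIndex S.d) :
    ∑ J, absGram (S.noiseLoad I) (S.noiseLoad J) ≤
      Fintype.card (MultiIndex re) * (Ca ^ K * Ca ^ K) + Cs ^ 2 := by
  have e : ∀ J, absGram (S.noiseLoad I) (S.noiseLoad J) =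
      (∑ m : MultiIndex re, |∏ l, S.Ae l (I l) (m l)| * |∏ l, S.Ae l (J l) (m l)|) +
        if I = J then S.Sig I ^ 2 else 0 := by
    intro J
    simp only [absGram, noiseLoad, Fintype.sum_sum_type, Sum.elim_inl, Sum.elim_inr, Pi.zero_apply,
      abs_zero, zero_mul, Finset.sum_const_zero, zero_add]
    congr 1
    by_cases h : I = J
    · subst h
      rw [Finset.sum_eq_single I] <;> simp +contextual [pow_two]
    · rw [if_neg h]
      refine Finset.sum_eq_zero fun J' _ => ?_
      by_cases h1 : J' = I
      · subst h1; simp [h]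
      · simp [h1]
  simp_rw [e]
  rw [Finset.sum_add_distrib]
  refine add_le_add ?_ ?_
  · rw [Finset.sum_comm]
    calc _ ≤ ∑ _m : MultiIndex re, Ca ^ K * Ca ^ K := by
          refine Finset.sum_le_sum fun m _ => ?_
          rw [← Finset.mul_sum]
          have h1 : |∏ l, S.Ae l (I l) (m l)| ≤ Ca ^ K := by
            rw [Finset.abs_prod]
            refine (Finset.prod_le_prod (fun l _ => abs_nonneg _) (g := fun _ => Ca) fun l _ => ?_).trans
              (by simp)
            exact (Finset.single_le_sum (f := fun i => |S.Ae l i (m l)|)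
              (fun _ _ => abs_nonneg _) (Finset.mem_univ _)).trans (hCa l (m l))
          have h2 : ∑ J : MultiIndex S.d, |∏ l, S.Ae l (J l) (m l)| ≤ Ca ^ K := by
            simp_rw [Finset.abs_prod]
            have := Finset.prod_univ_sum (fun l => (Finset.univ : Finset (Fin (S.d l))))
              (fun l i => |S.Ae l i (m l)|)
            rw [Fintype.piFinset_univ] at this
            rw [← this]
            exact (Finset.prod_le_prod (fun l _ => Finset.sum_nonneg fun _ _ => abs_nonneg _)
              (g := fun _ => Ca) fun l _ => hCa l (m l)).trans (by simp)
          exact mul_le_mul h1 h2 (Finset.sum_nonneg fun _ _ => abs_nonneg _) (by positivity)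
      _ = _ := by simp
  · rw [Finset.sum_ite_eq]
    simp only [Finset.mem_univ, if_true]
    exact pow_le_pow_left₀ (hCs I).1 (hCs I).2 2

end Model

end ModelLoadings

section ModelMoments

variable {Ω : Type*} [MeasurableSpace Ω] {μ : Measure Ω} {K : ℕ} {r re : Fin K → ℕ}

/-- The moment and dependence properties of a model that enter the variance bounds: `κ` bounds the
fourth moments of the innovations, `R` the autocovariances, `L` the sums of `R`, and `Γ` the row
sums of the spatial covariance of the noise. -/
structure HasNoiseBounds (μ : Measure Ω) (S : Model Ω r re) (κ L Γ : ℝ) (R : ℤ → ℝ)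
    (ac : SeriesIndex S → ℕ → ℝ) : Prop where
  meas : IsMeasurableModel S
  noise : IsStdNoise μ κ fun (p : ℤ × SeriesIndex S) ω => S.innov p.1 ω p.2
  linear : ∀ t c, ∀ᵐ ω ∂μ, HasSum (fun q : ℕ => ac c q * S.innov (t - q) ω c) (S.series t ω c)
  coeff : ∀ c, IsCoeffSeq (ac c)
  autocov : ∀ c τ, autocovBound (ac c) τ ≤ R τ
  R_nonneg : ∀ τ, 0 ≤ R τ
  sum_R : ∀ F : Finset ℤ, ∑ τ ∈ F, R τ ≤ L
  κ_nonneg : 0 ≤ κ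
  Γ_nonneg : 0 ≤ Γ
  row : ∀ I, ∑ J, absGram (S.noiseLoad I) (S.noiseLoad J) ≤ Γ

variable {S : Model Ω r re} {κ L Γ : ℝ} {R : ℤ → ℝ} {ac : SeriesIndex S → ℕ → ℝ}

lemma IsMeasurableModel.series (hm : IsMeasurableModel S) (t : ℤ) (c : SeriesIndex S) :
    Measurable fun ω => S.series t ω c := by
  rcases c with m | m | m
  exacts [hm.F t m, hm.Fe t m, hm.eps t m]

namespace HasNoiseBounds

variable (k : Fin K) {w : Fin (S.d k) → Fin (S.d k) → CoIndex S.d k → ℤ → ℝ} {W : ℝ}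

lemma row_fiber (hS : HasNoiseBounds μ S κ L Γ R ac) (i : Fin (S.d k))
    (h : CoIndex S.d k) :
    ∑ j, ∑ h', absGram (S.noiseLoad (S.fiberIndex k i h)) (S.noiseLoad (S.fiberIndex k j h')) ≤
      Γ := by
  rw [S.sum_fiberIndex k fun J => absGram (S.noiseLoad (S.fiberIndex k i h)) (S.noiseLoad J)]
  exact hS.row _

/-- Mean squared Frobenius norm of the centered noise-noise term. -/
lemma lintegral_noise_noise_le [IsProbabilityMeasure μ]
    (hS : HasNoiseBounds μ S κ L Γ R ac)
    (hW0 : 0 ≤ W)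
    (hW : ∀ i j h h', ∑ t ∈ S.times, ∑ s ∈ S.times,
    |w i j h t| * |w i j h' s| * R (t - s) ^ 2 ≤ W) :
    ∫⁻ ω, ENNReal.ofReal (∑ i, ∑ j, (∑ h, ∑ t ∈ S.times, w i j h t *
      (S.E t ω (S.fiberIndex k i h) * S.E t ω (S.fiberIndex k j h) -
        ∑ c, S.noiseLoad (S.fiberIndex k i h) c * S.noiseLoad (S.fiberIndex k j h) c)) ^ 2) ∂μ ≤
    ENNReal.ofReal (2 * (κ + 1) * W * (Γ ^ 2 *
      ((S.d k : ℝ) ^ 2 * Fintype.card (CoIndex S.d k)))) := by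
  have := lintegral_sum_sq_le hS.noise hS.linear hS.meas.series hS.coeff hS.autocov S.times w
    (fun i h => S.noiseLoad (S.fiberIndex k i h)) (fun i h => S.noiseLoad (S.fiberIndex k i h))
    hS.κ_nonneg hW
  simp only [S.sum_noiseLoad_mul] at this
  refine this.trans (ENNReal.ofReal_le_ofReal (mul_le_mul_of_nonneg_left ?_ ?_))
  · exact sum_absGram_mul_self_le hS.Γ_nonneg (hS.row_fiber k)
  · have := hS.κ_nonneg
    positivity

/-- Mean squared Frobenius norm of the noise-factor term. -/
lemma lintegral_noise_comm_le [IsProbabilityMeasure μ]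
    (hS : HasNoiseBounds μ S κ L Γ R ac)
    (hW0 : 0 ≤ W)
    (hW : ∀ i j h h', ∑ t ∈ S.times, ∑ s ∈ S.times,
    |w i j h t| * |w i j h' s| * R (t - s) ^ 2 ≤ W) (ω₀ : Ω) :
    ∫⁻ ω, ENNReal.ofReal (∑ i, ∑ j, (∑ h, ∑ t ∈ S.times, w i j h t *
      (S.E t ω (S.fiberIndex k i h) * S.comm t ω₀ ω (S.fiberIndex k j h))) ^ 2) ∂μ ≤
    ENNReal.ofReal (2 * (κ + 1) * W * (Γ * (S.d k * S.traceProd ω₀))) := by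
  have := lintegral_sum_sq_le hS.noise hS.linear hS.meas.series hS.coeff hS.autocov S.times w
    (fun i h => S.noiseLoad (S.fiberIndex k i h))
    (fun i h => S.commLoad ω₀ (S.fiberIndex k i h))
    hS.κ_nonneg hW
  simp only [S.sum_noiseLoad_mul, S.sum_commLoad_mul, S.sum_noiseLoad_mul_commLoad,
    sub_zero] at this
  refine this.trans (ENNReal.ofReal_le_ofReal (mul_le_mul_of_nonneg_left ?_ ?_))
  · have h1 := sum_absGram_mul_le (c := fun i h => S.commLoad ω₀ (S.fiberIndex k i h))
      (hS.row_fiber k)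
    rwa [S.sum_fiberIndex k fun I => ∑ a, S.commLoad ω₀ I a ^ 2, S.sum_commLoad_sq] at h1
  · have := hS.κ_nonneg
    positivity

/-- Mean squared Frobenius norm of the centered factor-factor term. -/
lemma lintegral_comm_comm_le [IsProbabilityMeasure μ]
    (hS : HasNoiseBounds μ S κ L Γ R ac)
    (hW0 : 0 ≤ W)
    (hW : ∀ i j h h', ∑ t ∈ S.times, ∑ s ∈ S.times,
    |w i j h t| * |w i j h' s| * R (t - s) ^ 2 ≤ W) (ω₀ : Ω) :
    ∫⁻ ω, ENNReal.ofReal (∑ i, ∑ j, (∑ h, ∑ t ∈ S.times, w i j h t *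
      (S.comm t ω₀ ω (S.fiberIndex k i h) * S.comm t ω₀ ω (S.fiberIndex k j h) -
        ∑ c, S.commLoad ω₀ (S.fiberIndex k i h) c * S.commLoad ω₀ (S.fiberIndex k j h) c)) ^ 2)
        ∂μ ≤
    ENNReal.ofReal (2 * (κ + 1) * W * S.traceProd ω₀ ^ 2) := by
  have := lintegral_sum_sq_le hS.noise hS.linear hS.meas.series hS.coeff hS.autocov S.times w
    (fun i h => S.commLoad ω₀ (S.fiberIndex k i h))
    (fun i h => S.commLoad ω₀ (S.fiberIndex k i h))
    hS.κ_nonneg hW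
  simp only [S.sum_commLoad_mul] at this
  refine this.trans (ENNReal.ofReal_le_ofReal (mul_le_mul_of_nonneg_left ?_ ?_))
  · have h1 := sum_absGram_mul_le_sq (c := fun i h => S.commLoad ω₀ (S.fiberIndex k i h))
    rwa [S.sum_fiberIndex k fun I => ∑ a, S.commLoad ω₀ I a ^ 2, S.sum_commLoad_sq] at h1
  · have := hS.κ_nonneg
    positivity

/-- The mean of the noise-noise term, in squared Frobenius norm. -/
lemma sum_sq_noise_mean_le (hS : HasNoiseBounds μ S κ L Γ R ac) :
    ∑ i, ∑ j, (∑ h, ∑ c, S.noiseLoad (S.fiberIndex k i h) c *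
      S.noiseLoad (S.fiberIndex k j h) c) ^ 2 ≤
    Γ ^ 2 * (S.d k * (Fintype.card (CoIndex S.d k) : ℝ) ^ 2) :=
  sum_sq_sum_mul_le hS.Γ_nonneg (hS.row_fiber k)

end HasNoiseBounds

end ModelMoments

/-! ### Conditioning on the observation pattern and the loadings -/

section ConditionalMarkov

variable {Ω : Type*} [MeasurableSpace Ω] {μ : Measure Ω} [IsProbabilityMeasure μ]

/-- Conditional Markov inequality: if `X` and `Y` are independent, then `φ(X, Y)` is of the order of
its conditional mean given `X`, on the event that this conditional mean is at most `B`. -/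
lemma measure_lt_and_lintegral_le {𝒳 𝒴 : Type*} [MeasurableSpace 𝒳] [MeasurableSpace 𝒴]
    {X : Ω → 𝒳} {Y : Ω → 𝒴} (hX : Measurable X) (hY : Measurable Y) (hXY : IndepFun X Y μ)
    {φ : 𝒳 × 𝒴 → ℝ} (hφ : Measurable φ) {B c : ℝ} (hB : 0 ≤ B) (hc : 0 < c) :
    μ {ω | c * B < φ (X ω, Y ω) ∧
      ∫⁻ ω', ENNReal.ofReal (φ (X ω, Y ω')) ∂μ ≤ ENNReal.ofReal B} ≤ ENNReal.ofReal c⁻¹ := by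
  set g : 𝒳 → ENNReal := fun x => ∫⁻ y, ENNReal.ofReal (φ (x, y)) ∂(μ.map Y) with hg
  have hofr : Measurable fun z => ENNReal.ofReal (φ z) := ENNReal.measurable_ofReal.comp hφ
  have hgm : Measurable g := hofr.lintegral_prod_right'
  set G : Set 𝒳 := {x | g x ≤ ENNReal.ofReal B} with hG
  have hGm : MeasurableSet G := measurableSet_le hgm measurable_const
  -- `φ` cut off where its conditional mean exceeds `B`, so that its mean is at most `B`
  set ψ : 𝒳 × 𝒴 → ENNReal := (G ×ˢ Set.univ).indicator fun z => ENNReal.ofReal (φ z) with hψ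
  have hψm : Measurable ψ := hofr.indicator (hGm.prod MeasurableSet.univ)
  have hgX : ∀ ω, g (X ω) = ∫⁻ ω', ENNReal.ofReal (φ (X ω, Y ω')) ∂μ := fun ω => by
    rw [hg]
    exact lintegral_map (hofr.comp measurable_prodMk_left) hY
  have hint : ∫⁻ ω, ψ (X ω, Y ω) ∂μ ≤ ENNReal.ofReal B := by
    rw [← lintegral_map hψm (hX.prodMk hY),
      (indepFun_iff_map_prod_eq_prod_map_map hX.aemeasurable hY.aemeasurable).1 hXY,
      lintegral_prod _ hψm.aemeasurable]
    have : ∀ x, ∫⁻ y, ψ (x, y) ∂(μ.map Y) ≤ ENNReal.ofReal B := by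
      intro x
      by_cases hx : x ∈ G
      · have e : ∀ y, ψ (x, y) = ENNReal.ofReal (φ (x, y)) := fun y => by
          rw [hψ, Set.indicator_of_mem]; exact ⟨hx, trivial⟩
        simp_rw [e]; exact hx
      · have e : ∀ y, ψ (x, y) = 0 := fun y => by
          rw [hψ, Set.indicator_of_notMem]; exact fun h => hx h.1
        simp [e]
    have hp : IsProbabilityMeasure (μ.map X) := Measure.isProbabilityMeasure_map hX.aemeasurable
    refine (lintegral_mono this).trans ?_
    simp
  have hmem : ∀ ω, (c * B < φ (X ω, Y ω) ∧
      ∫⁻ ω', ENNReal.ofReal (φ (X ω, Y ω')) ∂μ ≤ ENNReal.ofReal B) →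
      ψ (X ω, Y ω) = ENNReal.ofReal (φ (X ω, Y ω)) := by
    rintro ω ⟨-, h2⟩
    have hx : X ω ∈ G := by rw [hG, Set.mem_ofPred_eq, hgX]; exact h2
    rw [hψ, Set.indicator_of_mem (show (X ω, Y ω) ∈ G ×ˢ Set.univ from ⟨hx, trivial⟩)]
  -- for `B = 0` Markov's inequality has no positive level, but then `ψ` vanishes almost surely
  rcases hB.eq_or_lt with rfl | hB
  · have h0 : ∫⁻ ω, ψ (X ω, Y ω) ∂μ = 0 := by simpa using hint
    replace h0 := (lintegral_eq_zero_iff (hψm.comp (hX.prodMk hY))).1 h0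
    refine le_trans (le_of_eq (measure_mono_null ?_ h0)) bot_le
    rintro ω hω hz
    have hz' : ψ (X ω, Y ω) = 0 := hz
    rw [hmem ω hω, ENNReal.ofReal_eq_zero] at hz'
    have := hω.1
    rw [mul_zero] at this
    linarith
  have hcB : 0 < c * B := mul_pos hc hB
  refine (measure_mono ?_).trans ((meas_ge_le_lintegral_div (hψm.comp (hX.prodMk hY)).aemeasurable
    (ε := ENNReal.ofReal (c * B)) (by simpa using hcB) (by simp)).trans ?_)
  · intro ω hω
    change ENNReal.ofReal (c * B) ≤ ψ (X ω, Y ω)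
    rw [hmem ω hω]
    exact ENNReal.ofReal_le_ofReal hω.1.le
  · calc _ ≤ ENNReal.ofReal B / ENNReal.ofReal (c * B) := ENNReal.div_le_div_right hint _
      _ = ENNReal.ofReal c⁻¹ := by
          rw [← ENNReal.ofReal_div_of_pos hcB]
          congr 1
          field_simp

end ConditionalMarkov

section Decoupling

variable {Ω : Type*} {K : ℕ} {r re : Fin K → ℕ}

namespace Model

variable (S : Model Ω r re)

/-- Observation pattern and loadings. -/
def patternLoadings (ω : Ω) : (S.times → MultiIndex S.d → Bool) ×
    ((k : Fin K) → Fin (S.d k) → Fin (r k) → ℝ) :=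
  ((fun (t : S.times) i => S.M t ω i), fun k i j => S.A k ω i j)

/-- Factors and noise at the observation times. -/
def factorsNoise (ω : Ω) : (S.times → Tensor r) × (S.times → Tensor S.d) :=
  ((fun (t : S.times) i => S.F t ω i), fun (t : S.times) i => S.E t ω i)

/-- `f ω ω'` is a measurable function of the pattern and loadings at `ω` and of the factors and
noise at `ω'`. -/
def IsDecoupled (f : Ω → Ω → ℝ) : Prop :=
  ∃ φ : ((S.times → MultiIndex S.d → Bool) × ((k : Fin K) → Fin (S.d k) → Fin (r k) → ℝ)) ×
      ((S.times → Tensor r) × (S.times → Tensor S.d)) → ℝ,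
    Measurable φ ∧ ∀ ω ω', f ω ω' = φ (S.patternLoadings ω, S.factorsNoise ω')

end Model

namespace Model.IsDecoupled

variable {S : Model Ω r re} {f g : Ω → Ω → ℝ}

lemma const (a : ℝ) : S.IsDecoupled fun _ _ => a := ⟨fun _ => a, measurable_const, fun _ _ => rfl⟩

lemma mul (hf : S.IsDecoupled f) (hg : S.IsDecoupled g) :
    S.IsDecoupled fun ω ω' => f ω ω' * g ω ω' := by
  obtain ⟨φ, hφ, h1⟩ := hf
  obtain ⟨ψ, hψ, h2⟩ := hg
  exact ⟨fun z => φ z * ψ z, hφ.mul hψ, fun ω ω' => by simp only [h1, h2]⟩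

lemma sub (hf : S.IsDecoupled f) (hg : S.IsDecoupled g) :
    S.IsDecoupled fun ω ω' => f ω ω' - g ω ω' := by
  obtain ⟨φ, hφ, h1⟩ := hf
  obtain ⟨ψ, hψ, h2⟩ := hg
  exact ⟨fun z => φ z - ψ z, hφ.sub hψ, fun ω ω' => by simp only [h1, h2]⟩

lemma sq (hf : S.IsDecoupled f) : S.IsDecoupled fun ω ω' => f ω ω' ^ 2 := by
  simpa only [pow_two] using hf.mul hf

lemma sum {ι : Type*} {s : Finset ι} {F : ι → Ω → Ω → ℝ} (hF : ∀ i ∈ s, S.IsDecoupled (F i)) :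
    S.IsDecoupled fun ω ω' => ∑ i ∈ s, F i ω ω' := by
  choose! φ hφ h using hF
  exact ⟨fun z => ∑ i ∈ s, φ i z, Finset.measurable_sum _ hφ,
    fun ω ω' => Finset.sum_congr rfl fun i hi => h i hi ω ω'⟩

lemma prod {ι : Type*} {s : Finset ι} {F : ι → Ω → Ω → ℝ} (hF : ∀ i ∈ s, S.IsDecoupled (F i)) :
    S.IsDecoupled fun ω ω' => ∏ i ∈ s, F i ω ω' := by
  choose! φ hφ h using hF
  exact ⟨fun z => ∏ i ∈ s, φ i z, Finset.measurable_prod _ hφ,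
    fun ω ω' => Finset.prod_congr rfl fun i hi => h i hi ω ω'⟩

lemma loading (k : Fin K) (i : Fin (S.d k)) (j : Fin (r k)) :
    S.IsDecoupled fun ω _ => S.A k ω i j :=
  ⟨fun z => z.1.2 k i j, by fun_prop, fun _ _ => rfl⟩

lemma factor {t : ℤ} (ht : t ∈ S.times) (m : MultiIndex r) :
    S.IsDecoupled fun _ ω' => S.F t ω' m :=
  ⟨fun z => z.2.1 ⟨t, ht⟩ m, by fun_prop, fun _ _ => rfl⟩

lemma noise {t : ℤ} (ht : t ∈ S.times) (I : MultiIndex S.d) :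
    S.IsDecoupled fun _ ω' => S.E t ω' I :=
  ⟨fun z => z.2.2 ⟨t, ht⟩ I, by fun_prop, fun _ _ => rfl⟩

lemma comm {t : ℤ} (ht : t ∈ S.times) (I : MultiIndex S.d) :
    S.IsDecoupled fun ω ω' => S.comm t ω ω' I :=
  sum fun m _ => (prod fun l _ => loading l (I l) (m l)).mul (factor ht m)

lemma commLoad (I : MultiIndex S.d) (c : SeriesIndex S) :
    S.IsDecoupled fun ω _ => S.commLoad ω I c := by
  rcases c with m | m
  · exact prod (s := Finset.univ) fun l _ => loading l (I l) (m l)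
  · exact const 0

/-- Any function of the observation pattern is measurable, since there are finitely many
patterns. -/
lemma of_pattern (f : Ω → ℝ) (hf : ∀ ω₁ ω₂, (∀ t ∈ S.times, ∀ I, S.M t ω₁ I = S.M t ω₂ I) →
    f ω₁ = f ω₂) : S.IsDecoupled fun ω _ => f ω := by
  have hfac : Function.FactorsThrough f
      (fun ω (t : S.times) (I : MultiIndex S.d) => S.M t ω I) := fun ω₁ ω₂ h =>
    hf ω₁ ω₂ fun t ht I => congrFun (congrFun h ⟨t, ht⟩) I
  refine ⟨fun z => Function.extend (fun ω (t : S.times) (I : MultiIndex S.d) => S.M t ω I) f 0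
    z.1.1, (Measurable.of_discrete (f := Function.extend
      (fun ω (t : S.times) (I : MultiIndex S.d) => S.M t ω I) f 0)).comp
      (measurable_fst.comp measurable_fst), fun ω _ => ?_⟩
  exact (hfac.extend_apply 0 ω).symm

/-- A decoupled quantity is of the order of its conditional mean given the observation pattern and
the loadings. -/
lemma measure_le [MeasurableSpace Ω] {μ : Measure Ω} [IsProbabilityMeasure μ] {Φ : Ω → Ω → ℝ}
    (hΦ : S.IsDecoupled Φ) (hm : IsMeasurableModel S)
    (hI : PatternLoadingsIndep μ S) {B c : ℝ} (hB : 0 ≤ B) (hc : 0 < c) :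
    μ {ω | c * B < Φ ω ω ∧ ∫⁻ ω', ENNReal.ofReal (Φ ω ω') ∂μ ≤ ENNReal.ofReal B} ≤
      ENNReal.ofReal c⁻¹ := by
  obtain ⟨φ, hφ, h⟩ := hΦ
  have hF := hm.F
  have hA := hm.A
  have hM := hm.M
  have hE : ∀ t I, Measurable fun ω => S.E t ω I := fun t I => by
    simp only [← S.sum_noiseLoad_mul]
    exact Finset.measurable_sum _ fun c _ => (hm.series t c).const_mul _
  simp_rw [h]
  refine measure_lt_and_lintegral_le (X := S.patternLoadings) (Y := S.factorsNoise)
    ?_ ?_ hI hφ hB hc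
  · unfold Model.patternLoadings; fun_prop
  · unfold Model.factorsNoise; fun_prop

end Model.IsDecoupled

end Decoupling

/-! ### Errors of the covariance matrix of the observed entries -/

section Errors

variable {Ω : Type*} {K : ℕ} {r re : Fin K → ℕ}

namespace Model

variable (S : Model Ω r re) (k : Fin K)

/-- Weight of time `t` in the average over `ψ_{k,ij,h}`. -/
noncomputable def weight (i j : Fin (S.d k)) (h : CoIndex S.d k) (ω : Ω) (t : ℤ) : ℝ :=
  if t ∈ S.psi k i j h ω then ((S.psi k i j h ω).card : ℝ)⁻¹ else 0

/-- The average over `ψ_{k,ij,h}` uses at least a proportion `p` of the times, for all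
`i`, `j`, `h`. -/
def ObservedAtLeast (p : ℝ) (ω : Ω) : Prop :=
  ∀ i j h, p * S.T ≤ (S.psi k i j h ω).card

variable {S k}

lemma card_times : S.times.card = S.T := by simp

lemma psi_subset (i j : Fin (S.d k)) (h : CoIndex S.d k) (ω : Ω) :
    S.psi k i j h ω ⊆ S.times := Finset.filter_subset _ _

lemma psi_comm (i j : Fin (S.d k)) (h : CoIndex S.d k) (ω : Ω) :
    S.psi k i j h ω = S.psi k j i h ω :=
  Finset.filter_congr fun _ _ => and_comm

lemma weight_comm (i j : Fin (S.d k)) (h : CoIndex S.d k) (ω : Ω) (t : ℤ) :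
    S.weight k i j h ω t = S.weight k j i h ω t := by
  rw [weight, weight, psi_comm]

lemma card_psi_le (i j : Fin (S.d k)) (h : CoIndex S.d k) (ω : Ω) :
    ((S.psi k i j h ω).card : ℝ) ≤ S.T := by
  exact_mod_cast (Finset.card_le_card (psi_subset i j h ω)).trans_eq card_times

lemma sum_weight_mul (i j : Fin (S.d k)) (h : CoIndex S.d k) (ω : Ω) (g : ℤ → ℝ) :
    ∑ t ∈ S.times, S.weight k i j h ω t * g t =
      ((S.psi k i j h ω).card : ℝ)⁻¹ * ∑ t ∈ S.psi k i j h ω, g t := by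
  simp only [weight, ite_mul, zero_mul]
  rw [← Finset.sum_filter, Finset.filter_mem_eq_inter,
    Finset.inter_eq_right.2 (psi_subset i j h ω), Finset.mul_sum]

namespace ObservedAtLeast

lemma le_one {p : ℝ} {ω : Ω} (hω : S.ObservedAtLeast k p ω) (hT : 0 < S.T) (i j : Fin (S.d k))
    (h : CoIndex S.d k) : p ≤ 1 := by
  have h1 := (hω i j h).trans (card_psi_le i j h ω)
  have h2 : (0 : ℝ) < S.T := by exact_mod_cast hT
  nlinarith

variable {p : ℝ} {ω : Ω} (hω : S.ObservedAtLeast k p ω) (hp : 0 < p) (hT : 0 < S.T)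
  (i j : Fin (S.d k)) (h : CoIndex S.d k)

include hω hp hT i j h

lemma card_pos : (0 : ℝ) < (S.psi k i j h ω).card :=
  lt_of_lt_of_le (mul_pos hp (by exact_mod_cast hT)) (hω i j h)

lemma sum_weight : ∑ t ∈ S.times, S.weight k i j h ω t = 1 := by
  have := sum_weight_mul i j h ω fun _ => 1
  simp only [mul_one, Finset.sum_const, nsmul_eq_mul] at this
  rw [this, inv_mul_cancel₀ (hω.card_pos hp hT i j h).ne']

lemma abs_weight_le (t : ℤ) : |S.weight k i j h ω t| ≤ (p * S.T)⁻¹ := by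
  have hpT : 0 < p * S.T := mul_pos hp (by exact_mod_cast hT)
  rw [weight]
  split_ifs
  · rw [abs_of_nonneg (by positivity)]
    exact inv_anti₀ hpT (hω i j h)
  · rw [abs_zero]; positivity

lemma abs_weight_sub_le (t : ℤ) : |S.weight k i j h ω t - (S.T : ℝ)⁻¹| ≤ (p * S.T)⁻¹ := by
  have hT' : (0 : ℝ) < S.T := by exact_mod_cast hT
  have hpT : 0 < p * S.T := mul_pos hp hT'
  have h1 := hω.abs_weight_le hp hT i j h t
  have h2 : 0 ≤ S.weight k i j h ω t := by
    rw [weight]; split_ifs <;> positivity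
  have h3 : (S.T : ℝ)⁻¹ ≤ (p * S.T)⁻¹ :=
    inv_anti₀ hpT (mul_le_of_le_one_left hT'.le (hω.le_one hT i j h))
  have h4 : 0 ≤ (S.T : ℝ)⁻¹ := by positivity
  rw [abs_of_nonneg h2] at h1
  rw [abs_le]
  constructor <;> linarith

/-- Distance in total variation between the uniform weights on the observed times and on all times. -/
lemma sum_abs_weight_sub_le :
    ∑ t ∈ S.times, |S.weight k i j h ω t - (S.T : ℝ)⁻¹| ≤ 2 * (1 - p) := by
  have hT' : (0 : ℝ) < S.T := by exact_mod_cast hT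
  have hc := hω.card_pos hp hT i j h
  have hcT := card_psi_le i j h ω
  have hinv : (S.T : ℝ)⁻¹ ≤ ((S.psi k i j h ω).card : ℝ)⁻¹ := inv_anti₀ hc hcT
  -- the weights are at least `1 / T` on the observed times and vanish on the others
  have e : ∀ t ∈ S.times, |S.weight k i j h ω t - (S.T : ℝ)⁻¹| =
      S.weight k i j h ω t - (S.T : ℝ)⁻¹ +
        2 * (S.T : ℝ)⁻¹ * (if t ∈ S.psi k i j h ω then 0 else 1) := by
    intro t _
    rw [weight]
    split_ifs
    · rw [abs_of_nonneg (by linarith)]; ring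
    · rw [zero_sub, abs_neg, abs_of_nonneg (by positivity)]; ring
  have e2 : ∑ t ∈ S.times, (if t ∈ S.psi k i j h ω then (0 : ℝ) else 1) =
      S.T - (S.psi k i j h ω).card := by
    have : ∀ t ∈ S.times, (if t ∈ S.psi k i j h ω then (0 : ℝ) else 1) =
        1 - if t ∈ S.psi k i j h ω then (1 : ℝ) else 0 := fun t _ => by split_ifs <;> norm_num
    rw [Finset.sum_congr rfl this, Finset.sum_sub_distrib, Finset.sum_ite_mem,
      Finset.inter_eq_right.2 (psi_subset i j h ω)]
    simp
  rw [Finset.sum_congr rfl e, Finset.sum_add_distrib, Finset.sum_sub_distrib, ← Finset.mul_sum, e2,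
    hω.sum_weight hp hT i j h, Finset.sum_const, card_times, nsmul_eq_mul,
    mul_inv_cancel₀ hT'.ne']
  have := hω i j h
  have h3 : (S.T : ℝ)⁻¹ * (S.T - (S.psi k i j h ω).card) ≤ 1 - p := by
    rw [inv_mul_le_iff₀ hT']; linarith
  linarith

end ObservedAtLeast

variable (S k)

/-- Squared Frobenius norm of the centered noise-noise part of the observed covariance. -/
noncomputable def noiseNoise (ω ω' : Ω) : ℝ := ∑ i, ∑ j, (∑ h, ∑ t ∈ S.times, S.weight k i j h ω t *
  (S.E t ω' (S.fiberIndex k i h) * S.E t ω' (S.fiberIndex k j h) -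
    ∑ c, S.noiseLoad (S.fiberIndex k i h) c * S.noiseLoad (S.fiberIndex k j h) c)) ^ 2

/-- Squared Frobenius norm of the noise-factor part of the observed covariance. -/
noncomputable def noiseComm (ω ω' : Ω) : ℝ := ∑ i, ∑ j, (∑ h, ∑ t ∈ S.times, S.weight k i j h ω t *
  (S.E t ω' (S.fiberIndex k i h) * S.comm t ω ω' (S.fiberIndex k j h))) ^ 2

/-- Covariance of the common component at two elements of a fibre, given the loadings. -/
def commCov (ω : Ω) (i j : Fin (S.d k)) (h : CoIndex S.d k) : ℝ :=
  ∑ c, S.commLoad ω (S.fiberIndex k i h) c * S.commLoad ω (S.fiberIndex k j h) c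

/-- Squared Frobenius norm of the centered factor-factor part of the observed covariance. -/
noncomputable def commComm (ω ω' : Ω) : ℝ := ∑ i, ∑ j, (∑ h, ∑ t ∈ S.times, S.weight k i j h ω t *
  (S.comm t ω ω' (S.fiberIndex k i h) * S.comm t ω ω' (S.fiberIndex k j h) -
    S.commCov k ω i j h)) ^ 2

/-- Squared Frobenius norm of the difference between the factor-factor parts of the observed and
of the complete covariance. -/
noncomputable def commGap (ω ω' : Ω) : ℝ := ∑ i, ∑ j, (∑ h, ∑ t ∈ S.times,
  (S.weight k i j h ω t - (S.T : ℝ)⁻¹) *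
  (S.comm t ω ω' (S.fiberIndex k i h) * S.comm t ω ω' (S.fiberIndex k j h) -
    S.commCov k ω i j h)) ^ 2

lemma isDecoupled_weight (i j : Fin (S.d k)) (h : CoIndex S.d k) (t : ℤ) :
    S.IsDecoupled fun ω _ => S.weight k i j h ω t := by
  refine IsDecoupled.of_pattern _ fun ω₁ ω₂ hM => ?_
  have : S.psi k i j h ω₁ = S.psi k i j h ω₂ :=
    Finset.filter_congr fun t ht => by simp only [unfold, Matrix.of_apply, hM t ht]
  simp only [weight, this]

lemma isDecoupled_commCov (i j : Fin (S.d k)) (h : CoIndex S.d k) :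
    S.IsDecoupled fun ω _ => S.commCov k ω i j h :=
  .sum fun c _ => (IsDecoupled.commLoad _ c).mul (IsDecoupled.commLoad _ c)

lemma isDecoupled_noiseNoise : S.IsDecoupled (S.noiseNoise k) :=
  .sum fun i _ => .sum fun j _ => .sq <| .sum fun h _ => .sum fun t ht =>
    (S.isDecoupled_weight k i j h t).mul
      (((IsDecoupled.noise ht _).mul (IsDecoupled.noise ht _)).sub (.const _))

lemma isDecoupled_noiseComm : S.IsDecoupled (S.noiseComm k) :=
  .sum fun i _ => .sum fun j _ => .sq <| .sum fun h _ => .sum fun t ht =>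
    (S.isDecoupled_weight k i j h t).mul ((IsDecoupled.noise ht _).mul (IsDecoupled.comm ht _))

lemma isDecoupled_commComm : S.IsDecoupled (S.commComm k) :=
  .sum fun i _ => .sum fun j _ => .sq <| .sum fun h _ => .sum fun t ht =>
    (S.isDecoupled_weight k i j h t).mul
      (((IsDecoupled.comm ht _).mul (IsDecoupled.comm ht _)).sub (S.isDecoupled_commCov k i j h))

lemma isDecoupled_commGap : S.IsDecoupled (S.commGap k) :=
  .sum fun i _ => .sum fun j _ => .sq <| .sum fun h _ => .sum fun t ht =>
    ((S.isDecoupled_weight k i j h t).sub (.const _)).mul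
      (((IsDecoupled.comm ht _).mul (IsDecoupled.comm ht _)).sub (S.isDecoupled_commCov k i j h))

end Model

end Errors

section ErrorProbabilities

variable {Ω : Type*} [MeasurableSpace Ω] {μ : Measure Ω} [IsProbabilityMeasure μ] {K : ℕ}
  {r re : Fin K → ℕ} {S : Model Ω r re} {κ L Γ : ℝ} {R : ℤ → ℝ} {ac : SeriesIndex S → ℕ → ℝ}
  {p B c τ : ℝ}

namespace HasNoiseBounds

lemma measure_noiseNoise_le (hS : HasNoiseBounds μ S κ L Γ R ac) (hI : PatternLoadingsIndep μ S)
    (k : Fin K) (hp : 0 < p) (hT : 0 < S.T) (hB : 0 ≤ B) (hc : 0 < c)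
    (hle : 2 * (κ + 1) * (L ^ 2 * ((p * S.T)⁻¹ ^ 2 * S.T)) *
      (Γ ^ 2 * ((S.d k : ℝ) ^ 2 * Fintype.card (CoIndex S.d k))) ≤ B) :
    μ {ω | S.ObservedAtLeast k p ω ∧ c * B < S.noiseNoise k ω ω} ≤ ENNReal.ofReal c⁻¹ := by
  refine (measure_mono ?_).trans ((S.isDecoupled_noiseNoise k).measure_le hS.meas hI hB hc)
  rintro ω ⟨h1, h2⟩
  refine ⟨h2, (hS.lintegral_noise_noise_le k (W := L ^ 2 * ((p * S.T)⁻¹ ^ 2 * S.T))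
    (w := fun i j h t => S.weight k i j h ω t) (by positivity)
    fun i j h h' => ?_).trans (ENNReal.ofReal_le_ofReal hle)⟩
  have := weights_bound_of_abs_le hS.R_nonneg hS.sum_R S.times (fun h t => S.weight k i j h ω t)
    (fun h t _ => h1.abs_weight_le hp hT i j h t) h h'
  rwa [Model.card_times] at this

lemma measure_noiseComm_le (hS : HasNoiseBounds μ S κ L Γ R ac) (hI : PatternLoadingsIndep μ S)
    (k : Fin K) (hp : 0 < p) (hT : 0 < S.T) (hB : 0 ≤ B) (hc : 0 < c)
    (hle : 2 * (κ + 1) * (L ^ 2 * ((p * S.T)⁻¹ ^ 2 * S.T)) * (Γ * (S.d k * τ)) ≤ B) :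
    μ {ω | S.ObservedAtLeast k p ω ∧ S.traceProd ω ≤ τ ∧ c * B < S.noiseComm k ω ω} ≤
      ENNReal.ofReal c⁻¹ := by
  refine (measure_mono ?_).trans ((S.isDecoupled_noiseComm k).measure_le hS.meas hI hB hc)
  rintro ω ⟨h1, h2, h3⟩
  refine ⟨h3, (hS.lintegral_noise_comm_le k (W := L ^ 2 * ((p * S.T)⁻¹ ^ 2 * S.T))
    (w := fun i j h t => S.weight k i j h ω t) (by positivity)
    (fun i j h h' => ?_) ω).trans (ENNReal.ofReal_le_ofReal (le_trans ?_ hle))⟩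
  · have := weights_bound_of_abs_le hS.R_nonneg hS.sum_R S.times (fun h t => S.weight k i j h ω t)
      (fun h t _ => h1.abs_weight_le hp hT i j h t) h h'
    rwa [Model.card_times] at this
  · have := hS.κ_nonneg
    have := hS.Γ_nonneg
    gcongr

lemma measure_commComm_le (hS : HasNoiseBounds μ S κ L Γ R ac) (hI : PatternLoadingsIndep μ S)
    (k : Fin K) (hp : 0 < p) (hT : 0 < S.T) (hB : 0 ≤ B) (hc : 0 < c)
    (hle : 2 * (κ + 1) * (L ^ 2 * ((p * S.T)⁻¹ ^ 2 * S.T)) * τ ^ 2 ≤ B) :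
    μ {ω | S.ObservedAtLeast k p ω ∧ S.traceProd ω ≤ τ ∧ c * B < S.commComm k ω ω} ≤
      ENNReal.ofReal c⁻¹ := by
  refine (measure_mono ?_).trans ((S.isDecoupled_commComm k).measure_le hS.meas hI hB hc)
  rintro ω ⟨h1, h2, h3⟩
  refine ⟨h3, (hS.lintegral_comm_comm_le k (W := L ^ 2 * ((p * S.T)⁻¹ ^ 2 * S.T))
    (w := fun i j h t => S.weight k i j h ω t) (by positivity)
    (fun i j h h' => ?_) ω).trans (ENNReal.ofReal_le_ofReal (le_trans ?_ hle))⟩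
  · have := weights_bound_of_abs_le hS.R_nonneg hS.sum_R S.times (fun h t => S.weight k i j h ω t)
      (fun h t _ => h1.abs_weight_le hp hT i j h t) h h'
    rwa [Model.card_times] at this
  · have := hS.κ_nonneg
    have := S.traceProd_nonneg ω
    gcongr

/-- The gap between the observed and the complete covariance is controlled both by the number of
times and by the proportion `η` of missing times. -/
lemma measure_commGap_le (hS : HasNoiseBounds μ S κ L Γ R ac) (hI : PatternLoadingsIndep μ S)
    (k : Fin K) (hp : 0 < p) (hT : 0 < S.T) (hB : 0 ≤ B) (hc : 0 < c) {η : ℝ} (hη : η < 1)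
    (hle : 2 * (κ + 1) * (L ^ 2 * min ((p * S.T)⁻¹ ^ 2 * S.T) ((2 * η) ^ 2)) * τ ^ 2 ≤ B) :
    μ {ω | S.ObservedAtLeast k p ω ∧ S.ObservedAtLeast k (1 - η) ω ∧ S.traceProd ω ≤ τ ∧
      c * B < S.commGap k ω ω} ≤ ENNReal.ofReal c⁻¹ := by
  refine (measure_mono ?_).trans ((S.isDecoupled_commGap k).measure_le hS.meas hI hB hc)
  rintro ω ⟨h1, h1', h2, h3⟩
  refine ⟨h3, (hS.lintegral_comm_comm_le k
    (W := L ^ 2 * min ((p * S.T)⁻¹ ^ 2 * S.T) ((2 * η) ^ 2))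
    (w := fun i j h t => S.weight k i j h ω t - (S.T : ℝ)⁻¹) (by positivity)
    (fun i j h h' => ?_) ω).trans (ENNReal.ofReal_le_ofReal (le_trans ?_ hle))⟩
  · have b1 := weights_bound_of_abs_le hS.R_nonneg hS.sum_R S.times
      (fun h t => S.weight k i j h ω t - (S.T : ℝ)⁻¹)
      (fun h t _ => h1.abs_weight_sub_le hp hT i j h t) h h'
    have b2 := weights_bound_of_sum_abs_le hS.R_nonneg hS.sum_R S.times
      (fun h t => S.weight k i j h ω t - (S.T : ℝ)⁻¹) (η := 2 * η)
      (fun h => by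
        have := h1'.sum_abs_weight_sub_le (by linarith) hT i j h
        rwa [sub_sub_cancel] at this) h h'
    rw [Model.card_times] at b1
    rw [mul_min_of_nonneg _ _ (sq_nonneg L)]
    exact le_min b1 b2
  · have := hS.κ_nonneg
    have := S.traceProd_nonneg ω
    gcongr

end HasNoiseBounds

end ErrorProbabilities

/-! ### Leading eigenvectors of a symmetric matrix -/

section LinearAlgebra

variable {p q : ℕ}

lemma euclNorm_sq (v : Fin p → ℝ) : euclNorm v ^ 2 = ∑ a, v a ^ 2 := by
  rw [euclNorm, EuclideanSpace.real_norm_sq_eq]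

lemma frobNorm_sq (X : Matrix (Fin p) (Fin q) ℝ) : frobNorm X ^ 2 = ∑ i, ∑ j, X i j ^ 2 := by
  let _ := Matrix.frobeniusNormedAddCommGroup (m := Fin p) (n := Fin q) (α := ℝ)
  change ‖X‖ ^ 2 = _
  rw [Matrix.frobenius_norm_def, ← Real.rpow_natCast, ← Real.rpow_mul (by positivity)]
  norm_num

/-- The quadratic form of a symmetric matrix in an eigenbasis. -/
lemma dotProduct_mulVec_eq_sum {n : Type*} [Fintype n] [DecidableEq n] {M : Matrix n n ℝ}
    (hM : M.IsHermitian) (x : n → ℝ) :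
    x ⬝ᵥ (M *ᵥ x) = ∑ i, hM.eigenvalues i * ((hM.eigenvectorBasis i).ofLp ⬝ᵥ x) ^ 2 := by
  have h1 := hM.eigenvectorBasis.sum_inner_mul_inner (WithLp.toLp 2 x) (WithLp.toLp 2 (M *ᵥ x))
  simp only [EuclideanSpace.inner_eq_star_dotProduct, star_trivial] at h1
  have h2 : ∀ i, (M *ᵥ x) ⬝ᵥ (hM.eigenvectorBasis i).ofLp =
      hM.eigenvalues i * ((hM.eigenvectorBasis i).ofLp ⬝ᵥ x) := by
    intro i
    have hMt : Mᵀ = M := by simpa using hM.eq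
    rw [dotProduct_comm, dotProduct_mulVec, ← mulVec_transpose, hMt, hM.mulVec_eigenvectorBasis,
      smul_dotProduct, smul_eq_mul]
  simp only [h2] at h1
  rw [dotProduct_comm, ← h1]
  exact Finset.sum_congr rfl fun i _ => by ring

lemma dotProduct_self_eq_sum {n : Type*} [Fintype n] [DecidableEq n] {M : Matrix n n ℝ}
    (hM : M.IsHermitian) (x : n → ℝ) :
    x ⬝ᵥ x = ∑ i, ((hM.eigenvectorBasis i).ofLp ⬝ᵥ x) ^ 2 := by
  have h1 := hM.eigenvectorBasis.sum_inner_mul_inner (WithLp.toLp 2 x) (WithLp.toLp 2 x)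
  simp only [EuclideanSpace.inner_eq_star_dotProduct, star_trivial] at h1
  rw [← h1]
  refine Finset.sum_congr rfl fun i _ => ?_
  rw [dotProduct_comm x]; ring

lemma dotProduct_self_nonneg' {n : Type*} [Fintype n] (x : n → ℝ) : 0 ≤ x ⬝ᵥ x :=
  Finset.sum_nonneg fun i _ => mul_self_nonneg (x i)

/-- Courant–Fischer: a quadratic form bounded below on a `q`-dimensional subspace, the range of an
injective matrix, bounds the `q` largest eigenvalues from below. -/
lemma le_eigenvalues₀ {M : Matrix (Fin p) (Fin p) ℝ} (hM : M.IsHermitian)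
    (hq : q ≤ Fintype.card (Fin p)) (A : Matrix (Fin p) (Fin q) ℝ)
    (hA : ∀ y, A *ᵥ y = 0 → y = 0) {c : ℝ}
    (hc : ∀ y, c * ((A *ᵥ y) ⬝ᵥ (A *ᵥ y)) ≤ (A *ᵥ y) ⬝ᵥ (M *ᵥ (A *ᵥ y))) (j : Fin q) :
    c ≤ hM.eigenvalues₀ (Fin.castLE hq j) := by
  set e : Fin (Fintype.card (Fin p)) ≃ Fin p := Fintype.equivOfCardEq (by simp) with he
  -- a vector of the range that is orthogonal to the eigenvectors of the `j` largest eigenvalues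
  let f : (Fin q → ℝ) →ₗ[ℝ] (Fin j → ℝ) := LinearMap.pi fun i =>
    { toFun := fun y => (hM.eigenvectorBasis (e (Fin.castLE
          (le_trans j.2.le hq) i))).ofLp ⬝ᵥ (A *ᵥ y)
      map_add' := fun y z => by rw [mulVec_add, dotProduct_add]
      map_smul' := fun a y => by rw [mulVec_smul, dotProduct_smul]; rfl }
  have hker : LinearMap.ker f ≠ ⊥ := LinearMap.ker_ne_bot_of_finrank_lt (by simp)
  obtain ⟨y, hy, hy0⟩ := (Submodule.ne_bot_iff _).1 hker
  set x := A *ᵥ y with hx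
  have hx0 : 0 < x ⬝ᵥ x := by
    refine lt_of_le_of_ne (dotProduct_self_nonneg' x) fun h => hy0 (hA y ?_)
    exact dotProduct_self_eq_zero.1 h.symm
  have horth : ∀ i : Fin (Fintype.card (Fin p)), i < Fin.castLE hq j →
      (hM.eigenvectorBasis (e i)).ofLp ⬝ᵥ x = 0 := by
    intro i hi
    have := congrFun (LinearMap.mem_ker.1 hy) ⟨i, hi⟩
    exact this
  have hle : x ⬝ᵥ (M *ᵥ x) ≤ hM.eigenvalues₀ (Fin.castLE hq j) * (x ⬝ᵥ x) := by
    rw [dotProduct_mulVec_eq_sum hM, dotProduct_self_eq_sum hM, Finset.mul_sum]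
    refine Finset.sum_le_sum fun i _ => ?_
    obtain ⟨i, rfl⟩ := e.surjective i
    have hval : hM.eigenvalues (e i) = hM.eigenvalues₀ i := by
      simp [Matrix.IsHermitian.eigenvalues, he]
    rw [hval]
    by_cases hi : i < Fin.castLE hq j
    · rw [horth i hi]; simp
    · exact mul_le_mul_of_nonneg_right (hM.eigenvalues₀_antitone (not_lt.1 hi)) (sq_nonneg _)
  exact le_of_mul_le_mul_right ((hc y).trans hle) hx0

/-- Bessel's inequality for the columns of a matrix. -/
lemma sum_sq_vecMul_le {Q : Matrix (Fin p) (Fin q) ℝ} (hQ : Qᵀ * Q = 1) (x : Fin p → ℝ) :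
    ∑ a, (∑ i, x i * Q i a) ^ 2 ≤ ∑ i, x i ^ 2 := by
  set z : Fin q → ℝ := Qᵀ *ᵥ x with hz
  have hza : ∀ a, ∑ i, x i * Q i a = z a := fun a => by
    simp [hz, mulVec, dotProduct, mul_comm]
  have h0 := dotProduct_self_nonneg' (x - Q *ᵥ z)
  have h1 : (Q *ᵥ z) ⬝ᵥ (Q *ᵥ z) = z ⬝ᵥ z := by
    rw [dotProduct_mulVec, ← mulVec_transpose, mulVec_mulVec, hQ, one_mulVec]
  have h2 : x ⬝ᵥ (Q *ᵥ z) = z ⬝ᵥ z := by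
    rw [dotProduct_mulVec, ← mulVec_transpose]
  have h3 : (Q *ᵥ z) ⬝ᵥ x = z ⬝ᵥ z := by rw [dotProduct_comm, h2]
  rw [sub_dotProduct, dotProduct_sub, dotProduct_sub, h1, h2, h3] at h0
  simp only [hza]
  simp only [dotProduct, ← pow_two] at h0
  linarith

/-- By the eigenvector equation the rows of `Q` are `D⁻¹ Q' M_j`, with `D` the diagonal matrix of the
leading eigenvalues. If `G_j` maps the rows of `Q₀` to `D⁻¹ Q' (Rm)_j`, the difference is
`D⁻¹ Q' (M - Rm)_j`, and `D ≥ c` by Courant–Fischer. -/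
lemma IsLeadingEigenvectors.sum_row_error_le {M Rm : Matrix (Fin p) (Fin p) ℝ}
    {Q Q₀ : Matrix (Fin p) (Fin q) ℝ} (hQ : IsLeadingEigenvectors M Q) {c : ℝ} (hc : 0 < c)
    (A : Matrix (Fin p) (Fin q) ℝ) (hA : ∀ y, A *ᵥ y = 0 → y = 0)
    (hcA : ∀ y, c * ((A *ᵥ y) ⬝ᵥ (A *ᵥ y)) ≤ (A *ᵥ y) ⬝ᵥ (M *ᵥ (A *ᵥ y)))
    (G : Fin p → Matrix (Fin q) (Fin q) ℝ)
    (hG : ∀ j, G j *ᵥ Q₀ j = (Qᵀ * M * Q)⁻¹ *ᵥ fun a => ∑ i, Rm i j * Q i a) :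
    ∑ j, euclNorm (Q j - G j *ᵥ Q₀ j) ^ 2 ≤ (c ^ 2)⁻¹ * ∑ i, ∑ j, (M i j - Rm i j) ^ 2 := by
  obtain ⟨hQ1, hM, hq, hMQ⟩ := hQ
  set l : Fin q → ℝ := fun j => hM.eigenvalues₀ (Fin.castLE hq j) with hl
  have hlc : ∀ a, c ≤ l a := le_eigenvalues₀ hM hq A hA hcA
  have hl0 : ∀ a, l a ≠ 0 := fun a => (hc.trans_le (hlc a)).ne'
  have hD : Qᵀ * M * Q = Matrix.diagonal l := by
    rw [Matrix.mul_assoc, hMQ, ← Matrix.mul_assoc, hQ1, Matrix.one_mul]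
  have hDinv : (Qᵀ * M * Q)⁻¹ = Matrix.diagonal fun a => (l a)⁻¹ := by
    rw [hD]
    refine Matrix.inv_eq_left_inv ?_
    rw [Matrix.diagonal_mul_diagonal, ← Matrix.diagonal_one]
    congr 1; funext a; exact inv_mul_cancel₀ (hl0 a)
  have hrow : ∀ j a, Q j a = (l a)⁻¹ * ∑ i, M i j * Q i a := by
    intro j a
    have h1 := congrFun (congrFun hMQ j) a
    rw [Matrix.mul_diagonal, Matrix.mul_apply] at h1
    have hMt : ∀ i, M i j = M j i := fun i => by simpa using (hM.apply i j).symm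
    simp only [hMt]
    rw [h1, mul_comm (Q j a), inv_mul_cancel_left₀ (hl0 a)]
  have herr : ∀ j a, (Q j - G j *ᵥ Q₀ j) a = (l a)⁻¹ * ∑ i, (M i j - Rm i j) * Q i a := by
    intro j a
    rw [Pi.sub_apply, hG, hDinv, Matrix.mulVec_diagonal, hrow j a, ← mul_sub,
      ← Finset.sum_sub_distrib]
    simp only [sub_mul]
  have hinv : ∀ a, (l a)⁻¹ ^ 2 ≤ (c ^ 2)⁻¹ := fun a => by
    rw [inv_pow]
    exact inv_anti₀ (by positivity) (pow_le_pow_left₀ hc.le (hlc a) 2)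
  rw [Finset.sum_comm, Finset.mul_sum]
  refine Finset.sum_le_sum fun j _ => ?_
  rw [euclNorm_sq]
  calc _ ≤ ∑ a, (c ^ 2)⁻¹ * (∑ i, (M i j - Rm i j) * Q i a) ^ 2 := by
        refine Finset.sum_le_sum fun a _ => ?_
        rw [herr, mul_pow]
        exact mul_le_mul_of_nonneg_right (hinv a) (sq_nonneg _)
    _ ≤ _ := by
        rw [← Finset.mul_sum]
        exact mul_le_mul_of_nonneg_left (sum_sq_vecMul_le hQ1 _) (by positivity)

/-- A quadratic form is bounded by the Frobenius norm. -/
lemma abs_dotProduct_mulVec_le {N : Matrix (Fin p) (Fin p) ℝ} {b : ℝ} (hb : 0 ≤ b)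
    (hN : ∑ i, ∑ j, N i j ^ 2 ≤ b ^ 2) (x : Fin p → ℝ) :
    |x ⬝ᵥ (N *ᵥ x)| ≤ b * (x ⬝ᵥ x) := by
  have h0 := dotProduct_self_nonneg' x
  refine abs_le_of_sq_le_sq ?_ (mul_nonneg hb h0)
  have e1 : x ⬝ᵥ (N *ᵥ x) = ∑ z : Fin p × Fin p, N z.1 z.2 * (x z.1 * x z.2) := by
    rw [Fintype.sum_prod_type]
    simp only [dotProduct, mulVec, Finset.mul_sum]
    exact Finset.sum_congr rfl fun i _ => Finset.sum_congr rfl fun j _ => by ring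
  have e2 : ∑ z : Fin p × Fin p, (x z.1 * x z.2) ^ 2 = (x ⬝ᵥ x) ^ 2 := by
    rw [Fintype.sum_prod_type, pow_two, dotProduct, Finset.sum_mul_sum]
    exact Finset.sum_congr rfl fun i _ => Finset.sum_congr rfl fun j _ => by ring
  rw [e1]
  refine (Finset.sum_mul_sq_le_sq_mul_sq _ _ _).trans ?_
  rw [e2, Fintype.sum_prod_type, mul_pow]
  exact mul_le_mul_of_nonneg_right hN (sq_nonneg _)

/-- If `|Ay|² ≥ m |y|²` for all `y`, then `|A'x|² ≥ m |x|²` for all `x` in the range of `A`. -/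
lemma le_dotProduct_mul_transpose {A : Matrix (Fin p) (Fin q) ℝ} {m : ℝ} (hm : 0 ≤ m)
    (hA : ∀ y, m * (y ⬝ᵥ y) ≤ (A *ᵥ y) ⬝ᵥ (A *ᵥ y)) (y : Fin q → ℝ) :
    m * ((A *ᵥ y) ⬝ᵥ (A *ᵥ y)) ≤ (A *ᵥ y) ⬝ᵥ ((A * Aᵀ) *ᵥ (A *ᵥ y)) := by
  set x := A *ᵥ y with hx
  set v := Aᵀ *ᵥ x with hv
  have e1 : x ⬝ᵥ ((A * Aᵀ) *ᵥ x) = v ⬝ᵥ v := by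
    rw [← mulVec_mulVec, dotProduct_mulVec, ← mulVec_transpose]
  have e2 : x ⬝ᵥ x = y ⬝ᵥ v := by
    conv_lhs => rw [hx]
    rw [hv, dotProduct_comm y, ← dotProduct_comm x, dotProduct_mulVec, ← mulVec_transpose]
  have h1 : (y ⬝ᵥ v) ^ 2 ≤ (y ⬝ᵥ y) * (v ⬝ᵥ v) := by
    have := Finset.sum_mul_sq_le_sq_mul_sq Finset.univ y v
    simpa [dotProduct, pow_two] using this
  have h2 := hA y
  rw [e1]
  have h3 := dotProduct_self_nonneg' x
  have h4 := dotProduct_self_nonneg' v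
  rcases h3.eq_or_lt with h0 | h0
  · rw [← h0]; simpa using h4
  · refine le_of_mul_le_mul_right ?_ h0
    rw [← e2] at h1
    nlinarith

/-- A matrix close to a positive definite matrix has a quadratic form bounded below. -/
lemma exists_pos_le_of_posDef (hq : 0 < q) {B₀ : Matrix (Fin q) (Fin q) ℝ} (hB₀ : B₀.PosDef) :
    ∃ c δ : ℝ, 0 < c ∧ 0 < δ ∧ ∀ B : Matrix (Fin q) (Fin q) ℝ, (∀ a b, |B a b - B₀ a b| ≤ δ) →
      ∀ y, c * (y ⬝ᵥ y) ≤ y ⬝ᵥ (B *ᵥ y) := by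
  have hne : Nonempty (Fin q) := ⟨⟨0, hq⟩⟩
  obtain ⟨i₀, hi₀⟩ := Finite.exists_min hB₀.1.eigenvalues
  set c₀ := hB₀.1.eigenvalues i₀ with hc₀
  have hc₀pos : 0 < c₀ := hB₀.eigenvalues_pos i₀
  have hq' : (0 : ℝ) < q := by exact_mod_cast hq
  refine ⟨c₀ / 2, c₀ / 2 / q, by positivity, by positivity, fun B hB y => ?_⟩
  have h1 : c₀ * (y ⬝ᵥ y) ≤ y ⬝ᵥ (B₀ *ᵥ y) := by
    rw [dotProduct_mulVec_eq_sum hB₀.1, dotProduct_self_eq_sum hB₀.1, Finset.mul_sum]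
    exact Finset.sum_le_sum fun i _ => mul_le_mul_of_nonneg_right (hi₀ i) (sq_nonneg _)
  have h2 := abs_dotProduct_mulVec_le (N := B - B₀) (b := c₀ / 2) (by positivity) (by
    calc ∑ i, ∑ j, (B - B₀) i j ^ 2 ≤ ∑ _i : Fin q, ∑ _j : Fin q, (c₀ / 2 / q) ^ 2 :=
          Finset.sum_le_sum fun i _ => Finset.sum_le_sum fun j _ =>
            sq_le_sq' (abs_le.1 (hB i j)).1 (abs_le.1 (hB i j)).2
      _ = (c₀ / 2) ^ 2 := by simp; field_simp) y
  rw [sub_mulVec, dotProduct_sub] at h2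
  have := (abs_le.1 h2).1
  linarith

end LinearAlgebra

/-! ### The estimator and its covariance matrices -/

section Unfolding

variable {K : ℕ} {d r : Fin K → ℕ}

lemma sum_splitAt (k : Fin K) (f : MultiIndex r → ℝ) :
    ∑ m, f m = ∑ a, ∑ b, f ((Equiv.piSplitAt k fun l => Fin (r l)).symm (a, b)) := by
  rw [← Fintype.sum_prod_type' (f := fun a b => f ((Equiv.piSplitAt k _).symm (a, b)))]
  exact (Equiv.sum_comp (Equiv.piSplitAt k fun l => Fin (r l)).symm f).symm

lemma prod_splitAt (k : Fin K) (B : ∀ l, Fin (d l) → Fin (r l) → ℝ) (i : Fin (d k))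
    (h : CoIndex d k) (a : Fin (r k)) (b : CoIndex r k) :
    ∏ l, B l ((Equiv.piSplitAt k fun l => Fin (d l)).symm (i, h) l)
      ((Equiv.piSplitAt k fun l => Fin (r l)).symm (a, b) l) =
    B k i a * ∏ l : {l // l ≠ k}, B l (h l) (b l) := by
  rw [Fintype.prod_eq_mul_prod_subtype_ne _ k]
  congr 1
  · simp [Equiv.piSplitAt]
  · refine Finset.prod_congr rfl fun l _ => ?_
    simp [Equiv.piSplitAt, l.2]

lemma prod_splitAt_single (k : Fin K) (z : ∀ l, Fin (r l) → ℝ) (a : Fin (r k))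
    (b : CoIndex r k) :
    ∏ l, z l ((Equiv.piSplitAt k fun l => Fin (r l)).symm (a, b) l) =
    z k a * ∏ l : {l // l ≠ k}, z l (b l) :=
  prod_splitAt (d := r) k (fun l _ c => z l c) a b a b

end Unfolding

section Pathwise

variable {Ω : Type*} {K : ℕ} {r re : Fin K → ℕ}

namespace Model

variable (S : Model Ω r re) (k : Fin K)

lemma card_coIndex : (Fintype.card (CoIndex S.d k) : ℝ) = S.dMinus k := by
  rw [dMinus, Fintype.card_pi]
  push_cast
  simp only [Fintype.card_fin]
  exact (Finset.prod_subtype (Finset.univ.erase k) (p := fun l => l ≠ k) (by simp)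
    (fun l => (S.d l : ℝ))).symm

lemma dTot_nonneg : 0 ≤ S.dTot := Finset.prod_nonneg fun _ _ => Nat.cast_nonneg _

lemma avgRowError_nonneg (Qh : Matrix (Fin (S.d k)) (Fin (r k)) ℝ)
    (G : Fin (S.d k) → Matrix (Fin (r k)) (Fin (r k)) ℝ) (ω : Ω) : 0 ≤ S.avgRowError k Qh G ω :=
  mul_nonneg (by positivity) (Finset.sum_nonneg fun j _ => sq_nonneg _)

lemma d_mul_dMinus : (S.d k : ℝ) * S.dMinus k = S.dTot :=
  Finset.mul_prod_erase Finset.univ (fun l => (S.d l : ℝ)) (Finset.mem_univ k)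

/-- `∏_{l ≠ k} tr(A_l' A_l)`. -/
def coTrace (ω : Ω) : ℝ := ∏ l : {l // l ≠ k}, ∑ j, S.Z l ω j

/-- `A_k = Q_k Z_k^{1/2}`, also where `Z_k` vanishes, since the column of `A_k` is then zero. -/
lemma A_eq_Q_mul (l : Fin K) (ω : Ω) (i : Fin (S.d l)) (j : Fin (r l)) :
    S.A l ω i j = S.Q l ω i j * √(S.Z l ω j) := by
  rw [Q, ZinvSqrt, Matrix.mul_diagonal]
  by_cases h : S.Z l ω j = 0
  · have h0 : ∀ i ∈ Finset.univ, S.A l ω i j ^ 2 = 0 :=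
      (Finset.sum_eq_zero_iff_of_nonneg fun i _ => sq_nonneg _).1 (by rw [← Z_eq, h])
    rw [pow_eq_zero_iff two_ne_zero |>.1 (h0 i (Finset.mem_univ i))]; ring
  · have : √(S.Z l ω j) ≠ 0 := by
      rw [Real.sqrt_ne_zero (S.Z_nonneg l ω j)]; exact h
    rw [mul_assoc, inv_mul_cancel₀ this, mul_one]

lemma FZ_eq (t : ℤ) (ω : Ω) (m : MultiIndex r) :
    S.FZ t ω m = (∏ l, √(S.Z l ω (m l))) * S.F t ω m := by
  rw [FZ, multiProd, Finset.sum_eq_single m]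
  · simp [Zsqrt]
  · intro b _ hb
    obtain ⟨l, hl⟩ : ∃ l, b l ≠ m l := by
      by_contra h; push Not at h; exact hb (funext h)
    rw [Finset.prod_eq_zero (Finset.mem_univ l), zero_mul]
    simp [Zsqrt, Matrix.diagonal_apply_ne _ hl.symm]
  · simp

/-- The common component in the terms that define `Hrow` and `Hall`: `Q_{k,i·}' f_{k,h,t}`. -/
lemma comm_eq_dotProduct (t : ℤ) (ω : Ω) (i : Fin (S.d k)) (h : CoIndex S.d k) :
    S.comm t ω ω (S.fiberIndex k i h) = S.Q k ω i ⬝ᵥ S.fvec k h t ω := by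
  rw [comm, multiProd, sum_splitAt k]
  refine Finset.sum_congr rfl fun a _ => ?_
  rw [fvec, Finset.mul_sum]
  refine Finset.sum_congr rfl fun b _ => ?_
  rw [fiberIndex, prod_splitAt k (fun l => S.A l ω), unfold, Matrix.of_apply, FZ_eq,
    prod_splitAt_single k (fun l => fun c => √(S.Z l ω c)), Lam, kronExcept, Matrix.of_apply]
  simp only [S.A_eq_Q_mul, Finset.prod_mul_distrib]
  ring

/-- Given the loadings, the mode-`k` covariance matrix of the common component is a multiple of
`A_k A_k'`. -/
lemma sum_commCov (ω : Ω) (i j : Fin (S.d k)) :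
    ∑ h, S.commCov k ω i j h = (S.A k ω * (S.A k ω)ᵀ) i j * S.coTrace k ω := by
  have e : ∀ h, S.commCov k ω i j h = (S.A k ω * (S.A k ω)ᵀ) i j *
      ∏ l : {l // l ≠ k}, ∑ b, S.A l ω (h l) b ^ 2 := by
    intro h
    rw [commCov, Finset.prod_univ_sum, Fintype.piFinset_univ, Matrix.mul_apply, Finset.sum_mul_sum]
    simp only [commLoad, Fintype.sum_sum_type, Sum.elim_inl, Sum.elim_inr, Pi.zero_apply, mul_zero,
      Finset.sum_const_zero, add_zero]
    rw [sum_splitAt k]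
    refine Finset.sum_congr rfl fun a _ => Finset.sum_congr rfl fun b _ => ?_
    rw [fiberIndex, fiberIndex, prod_splitAt k (fun l => S.A l ω), prod_splitAt k (fun l => S.A l ω),
      Finset.prod_pow, Matrix.transpose_apply]
    ring
  simp_rw [e]
  rw [← Finset.mul_sum, coTrace]
  congr 1
  have h2 : ∀ l : {l // l ≠ k}, ∑ b, S.Z l ω b = ∑ i, ∑ b, S.A l ω i b ^ 2 := fun l => by
    simp_rw [Z_eq]; exact Finset.sum_comm
  simp_rw [h2]
  rw [Finset.prod_univ_sum, Fintype.piFinset_univ]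

lemma Y_eq (t : ℤ) (ω : Ω) (I : MultiIndex S.d) : S.Y t ω I = S.comm t ω ω I + S.E t ω I := rfl

/-- The factor-factor part of the observed covariance matrix. -/
noncomputable def commCovObs (ω : Ω) : Matrix (Fin (S.d k)) (Fin (S.d k)) ℝ :=
  Matrix.of fun i j => ∑ h, ∑ t ∈ S.times, S.weight k i j h ω t *
    (S.comm t ω ω (S.fiberIndex k i h) * S.comm t ω ω (S.fiberIndex k j h))

/-- The factor-factor part of the covariance matrix of the complete data. -/
noncomputable def commCovFull (ω : Ω) : Matrix (Fin (S.d k)) (Fin (S.d k)) ℝ :=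
  Matrix.of fun i j => ∑ h, ∑ t ∈ S.times, (S.T : ℝ)⁻¹ *
    (S.comm t ω ω (S.fiberIndex k i h) * S.comm t ω ω (S.fiberIndex k j h))

lemma Shat_apply (ω : Ω) (i j : Fin (S.d k)) :
    S.Shat k ω i j = ∑ h, ∑ t ∈ S.times, S.weight k i j h ω t *
      (S.Y t ω (S.fiberIndex k i h) * S.Y t ω (S.fiberIndex k j h)) := by
  rw [Shat, Matrix.of_apply]
  exact Finset.sum_congr rfl fun h _ => (sum_weight_mul i j h ω _).symm

/-- `H_{k,j} Q_{k,j·} = D̂⁻¹ Q̂'` times the `j`-th column of the factor-factor part of `Ŝ_k`. -/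
lemma Hrow_mulVec (Qh : Matrix (Fin (S.d k)) (Fin (r k)) ℝ) (j : Fin (S.d k)) (ω : Ω) :
    S.Hrow k Qh j ω *ᵥ S.Q k ω j = (Qhᵀ * S.Shat k ω * Qh)⁻¹ *ᵥ
      fun a => ∑ i, S.commCovObs k ω i j * Qh i a := by
  rw [Hrow, ← mulVec_mulVec, Dhat]
  congr 1
  funext a
  simp only [Matrix.sum_mulVec, Finset.sum_apply, Matrix.smul_mulVec, Pi.smul_apply, smul_eq_mul,
    vecMulVec_mulVec, commCovObs, Matrix.of_apply]
  refine Finset.sum_congr rfl fun i _ => ?_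
  rw [Finset.sum_mul]
  refine Finset.sum_congr rfl fun h _ => ?_
  rw [sum_weight_mul, mul_assoc, Finset.sum_mul]
  congr 1
  refine Finset.sum_congr rfl fun t _ => ?_
  rw [comm_eq_dotProduct, comm_eq_dotProduct, dotProduct_comm (S.Q k ω i),
    dotProduct_comm (S.Q k ω j)]
  simp
  ring

/-- `H_k^a Q_{k,j·} = D̂⁻¹ Q̂'` times the `j`-th column of the factor-factor part of the covariance of
the complete data. -/
lemma Hall_mulVec (Qh : Matrix (Fin (S.d k)) (Fin (r k)) ℝ) (j : Fin (S.d k)) (ω : Ω) :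
    S.Hall k Qh ω *ᵥ S.Q k ω j = (Qhᵀ * S.Shat k ω * Qh)⁻¹ *ᵥ
      fun a => ∑ i, S.commCovFull k ω i j * Qh i a := by
  have hf : ∀ t h a, S.fvec k h t ω a = (unfold k (S.FZ t ω) * (S.Lam k ω)ᵀ) a h := by
    intro t h a
    rw [fvec, Matrix.mul_apply]
    exact Finset.sum_congr rfl fun m _ => mul_comm _ _
  have e : S.Hall k Qh ω = (Qhᵀ * S.Shat k ω * Qh)⁻¹ * (Qhᵀ * ((S.T : ℝ)⁻¹ • ∑ t ∈ S.times,
      S.Q k ω * ((unfold k (S.FZ t ω) * (S.Lam k ω)ᵀ) *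
        (unfold k (S.FZ t ω) * (S.Lam k ω)ᵀ)ᵀ))) := by
    rw [Hall, Dhat, Matrix.mul_smul, Matrix.mul_smul, Matrix.mul_sum, Matrix.mul_sum]
    congr 1
    refine Finset.sum_congr rfl fun t _ => ?_
    simp only [Matrix.transpose_mul, Matrix.transpose_transpose, Matrix.mul_assoc]
  rw [e, ← mulVec_mulVec, ← mulVec_mulVec]
  congr 1
  have hv : ((S.T : ℝ)⁻¹ • ∑ t ∈ S.times, S.Q k ω * ((unfold k (S.FZ t ω) * (S.Lam k ω)ᵀ) *
        (unfold k (S.FZ t ω) * (S.Lam k ω)ᵀ)ᵀ)) *ᵥ S.Q k ω j =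
      fun i => S.commCovFull k ω i j := by
    funext i
    simp only [Matrix.smul_mulVec, Matrix.sum_mulVec, Pi.smul_apply, Finset.sum_apply, smul_eq_mul,
      commCovFull, Matrix.of_apply]
    rw [Finset.sum_comm, Finset.mul_sum]
    refine Finset.sum_congr rfl fun t _ => ?_
    rw [← Finset.mul_sum]
    congr 1
    rw [← mulVec_mulVec, ← mulVec_mulVec]
    change S.Q k ω i ⬝ᵥ _ = _
    rw [dotProduct_mulVec]
    refine Finset.sum_congr rfl fun h _ => ?_
    have hN : ∀ i, (S.Q k ω i ᵥ* (unfold k (S.FZ t ω) * (S.Lam k ω)ᵀ)) h =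
        S.Q k ω i ⬝ᵥ S.fvec k h t ω := fun i => by
      simp only [vecMul, dotProduct, hf]
    rw [comm_eq_dotProduct, comm_eq_dotProduct, Matrix.mulVec_transpose, hN, hN]
  rw [hv]
  funext a
  simp only [mulVec, dotProduct, Matrix.transpose_apply]
  exact Finset.sum_congr rfl fun i _ => mul_comm _ _

/-- The estimated covariance matrix is that of the common component up to four noise terms: the
centered noise-noise term, its mean, and the noise-factor term with its transpose. -/
lemma sum_sq_Shat_sub_commCovObs_le {ω : Ω} {p m : ℝ} (hω : S.ObservedAtLeast k p ω) (hp : 0 < p)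
    (hT : 0 < S.T) (hm : ∑ i, ∑ j, (∑ h, ∑ c, S.noiseLoad (S.fiberIndex k i h) c *
      S.noiseLoad (S.fiberIndex k j h) c) ^ 2 ≤ m) :
    ∑ i, ∑ j, (S.Shat k ω i j - S.commCovObs k ω i j) ^ 2 ≤
      4 * (S.noiseNoise k ω ω + m + 2 * S.noiseComm k ω ω) := by
  set a : Fin (S.d k) → Fin (S.d k) → ℝ := fun i j => ∑ h, ∑ t ∈ S.times, S.weight k i j h ω t *
    (S.E t ω (S.fiberIndex k i h) * S.E t ω (S.fiberIndex k j h) -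
      ∑ c, S.noiseLoad (S.fiberIndex k i h) c * S.noiseLoad (S.fiberIndex k j h) c) with ha
  set b : Fin (S.d k) → Fin (S.d k) → ℝ := fun i j => ∑ h, ∑ c,
    S.noiseLoad (S.fiberIndex k i h) c * S.noiseLoad (S.fiberIndex k j h) c with hb
  set f : Fin (S.d k) → Fin (S.d k) → ℝ := fun i j => ∑ h, ∑ t ∈ S.times, S.weight k i j h ω t *
    (S.E t ω (S.fiberIndex k i h) * S.comm t ω ω (S.fiberIndex k j h)) with hf
  have key : ∀ i j, S.Shat k ω i j - S.commCovObs k ω i j = a i j + b i j + f i j + f j i := by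
    intro i j
    rw [Shat_apply, commCovObs, Matrix.of_apply, ha, hb, hf, ← Finset.sum_sub_distrib,
      ← Finset.sum_add_distrib, ← Finset.sum_add_distrib, ← Finset.sum_add_distrib]
    refine Finset.sum_congr rfl fun h _ => ?_
    have hb' : ∑ c, S.noiseLoad (S.fiberIndex k i h) c * S.noiseLoad (S.fiberIndex k j h) c =
        ∑ t ∈ S.times, S.weight k i j h ω t * ∑ c, S.noiseLoad (S.fiberIndex k i h) c *
          S.noiseLoad (S.fiberIndex k j h) c := by
      rw [← Finset.sum_mul, hω.sum_weight hp hT, one_mul]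
    conv_rhs => enter [1, 1, 2]; rw [hb']
    rw [← Finset.sum_sub_distrib, ← Finset.sum_add_distrib, ← Finset.sum_add_distrib,
      ← Finset.sum_add_distrib]
    refine Finset.sum_congr rfl fun t _ => ?_
    rw [S.weight_comm j i, Y_eq, Y_eq]
    ring
  have h4 : ∀ x y z u : ℝ, (x + y + z + u) ^ 2 ≤ 4 * (x ^ 2 + y ^ 2 + z ^ 2 + u ^ 2) := by
    intro x y z u
    nlinarith [sq_nonneg (x - y), sq_nonneg (x - z), sq_nonneg (x - u), sq_nonneg (y - z),
      sq_nonneg (y - u), sq_nonneg (z - u)]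
  calc _ ≤ ∑ i, ∑ j, 4 * (a i j ^ 2 + b i j ^ 2 + f i j ^ 2 + f j i ^ 2) :=
        Finset.sum_le_sum fun i _ => Finset.sum_le_sum fun j _ => by rw [key]; exact h4 _ _ _ _
    _ = 4 * ((∑ i, ∑ j, a i j ^ 2) + (∑ i, ∑ j, b i j ^ 2) + 2 * ∑ i, ∑ j, f i j ^ 2) := by
        simp_rw [← Finset.mul_sum, Finset.sum_add_distrib]
        rw [Finset.sum_comm (f := fun i j => f j i ^ 2)]
        ring
    _ ≤ _ := by
        refine mul_le_mul_of_nonneg_left ?_ (by norm_num)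
        exact add_le_add (add_le_add le_rfl hm) le_rfl

lemma sum_sq_commCovObs_sub_eq {ω : Ω} {p : ℝ} (hω : S.ObservedAtLeast k p ω) (hp : 0 < p)
    (hT : 0 < S.T) :
    ∑ i, ∑ j, (S.commCovObs k ω i j - (S.A k ω * (S.A k ω)ᵀ) i j * S.coTrace k ω) ^ 2 =
      S.commComm k ω ω := by
  refine Finset.sum_congr rfl fun i _ => Finset.sum_congr rfl fun j _ => ?_
  rw [commCovObs, Matrix.of_apply, ← sum_commCov, ← Finset.sum_sub_distrib]
  congr 1
  refine Finset.sum_congr rfl fun h _ => ?_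
  simp_rw [mul_sub]
  rw [Finset.sum_sub_distrib, ← Finset.sum_mul, hω.sum_weight hp hT, one_mul]

/-- Both families of weights have total `1`, so the difference may be centered at the conditional
mean of the common component. -/
lemma sum_sq_commCovObs_sub_full_eq {ω : Ω} {p : ℝ} (hω : S.ObservedAtLeast k p ω) (hp : 0 < p)
    (hT : 0 < S.T) :
    ∑ i, ∑ j, (S.commCovObs k ω i j - S.commCovFull k ω i j) ^ 2 = S.commGap k ω ω := by
  have hT' : (S.T : ℝ) ≠ 0 := by exact_mod_cast hT.ne'
  refine Finset.sum_congr rfl fun i _ => Finset.sum_congr rfl fun j _ => ?_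
  rw [commCovObs, Matrix.of_apply, commCovFull, Matrix.of_apply, ← Finset.sum_sub_distrib]
  congr 1
  refine Finset.sum_congr rfl fun h _ => ?_
  simp_rw [mul_sub (S.weight k i j h ω _ - (S.T : ℝ)⁻¹)]
  rw [Finset.sum_sub_distrib, ← Finset.sum_mul, Finset.sum_sub_distrib, hω.sum_weight hp hT,
    Finset.sum_const, card_times, nsmul_eq_mul, mul_inv_cancel₀ hT', sub_self, zero_mul, sub_zero,
    ← Finset.sum_sub_distrib]
  exact Finset.sum_congr rfl fun t _ => (sub_mul _ _ _).symm

lemma avgRowError_Hall_eq (Qh : Matrix (Fin (S.d k)) (Fin (r k)) ℝ) (ω : Ω) :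
    S.avgRowError k Qh (fun _ => S.Hall k Qh ω) ω =
      (S.d k : ℝ)⁻¹ * frobNorm (Qh - S.Q k ω * (S.Hall k Qh ω)ᵀ) ^ 2 := by
  rw [avgRowError, frobNorm_sq]
  congr 1
  refine Finset.sum_congr rfl fun j _ => ?_
  rw [euclNorm_sq]
  refine Finset.sum_congr rfl fun a _ => ?_
  congr 1
  simp only [Pi.sub_apply, Matrix.sub_apply, Matrix.mul_apply, mulVec, dotProduct,
    Matrix.transpose_apply]
  congr 1
  exact Finset.sum_congr rfl fun b _ => mul_comm _ _

end Model

end Pathwise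

/-! ### Error of the leading eigenvectors on a good event -/

section PathwiseBounds

variable {Ω : Type*} {K : ℕ} {r re : Fin K → ℕ}

namespace Model

variable {S : Model Ω r re} {k : Fin K}

/-- The smallest eigenvalue of `A_k' A_k` is at least that of `Z_k^{-1/2} A_k' A_k Z_k^{-1/2}`
times the smallest diagonal entry of `Z_k`. -/
lemma le_dotProduct_A_mulVec {ω : Ω} {c z : ℝ} (hc : 0 ≤ c) (hz : 0 < z)
    (hZ : ∀ j, z ≤ S.Z k ω j)
    (hB : ∀ y, c * (y ⬝ᵥ y) ≤
      y ⬝ᵥ ((S.ZinvSqrt k ω * (S.A k ω)ᵀ * S.A k ω * S.ZinvSqrt k ω) *ᵥ y))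
    (y : Fin (r k) → ℝ) :
    c * z * (y ⬝ᵥ y) ≤ (S.A k ω *ᵥ y) ⬝ᵥ (S.A k ω *ᵥ y) := by
  set u : Fin (r k) → ℝ := fun j => √(S.Z k ω j) * y j with hu
  have hZu : S.ZinvSqrt k ω *ᵥ u = y := by
    funext j
    rw [ZinvSqrt, Matrix.mulVec_diagonal, hu]
    have : √(S.Z k ω j) ≠ 0 := (Real.sqrt_pos.2 (hz.trans_le (hZ j))).ne'
    field_simp
  have hsymm : (S.ZinvSqrt k ω)ᵀ = S.ZinvSqrt k ω := Matrix.diagonal_transpose _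
  have e1 : u ⬝ᵥ ((S.ZinvSqrt k ω * (S.A k ω)ᵀ * S.A k ω * S.ZinvSqrt k ω) *ᵥ u) =
      (S.A k ω *ᵥ y) ⬝ᵥ (S.A k ω *ᵥ y) := by
    rw [← mulVec_mulVec, hZu, ← mulVec_mulVec, ← mulVec_mulVec, dotProduct_mulVec,
      ← mulVec_transpose, hsymm, hZu, dotProduct_mulVec, vecMul_transpose]
  have e2 : z * (y ⬝ᵥ y) ≤ u ⬝ᵥ u := by
    simp only [dotProduct, Finset.mul_sum, hu]
    refine Finset.sum_le_sum fun j _ => ?_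
    have := Real.mul_self_sqrt (S.Z_nonneg k ω j)
    calc z * (y j * y j) ≤ S.Z k ω j * (y j * y j) :=
          mul_le_mul_of_nonneg_right (hZ j) (mul_self_nonneg _)
      _ = √(S.Z k ω j) * y j * (√(S.Z k ω j) * y j) := by
          conv_lhs => rw [← this]
          ring
  have := hB u
  rw [e1] at this
  refine le_trans ?_ this
  rw [mul_assoc]
  exact mul_le_mul_of_nonneg_left e2 hc

/-- If the observed covariance matrix is close to `∏_{l ≠ k} tr(A_l' A_l) A_k A_k'` relative to the
smallest nonzero eigenvalue of the latter, the error of the leading eigenvectors is controlled by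
the distance of the observed covariance from the matrix that defines the rotations. -/
lemma avgRowError_le {ω : Ω} {Qh : Matrix (Fin (S.d k)) (Fin (r k)) ℝ}
    (hQ : IsLeadingEigenvectors (S.Shat k ω) Qh) {m τ V : ℝ} (hm : 0 < m) (hτ : 0 < τ)
    (hA : ∀ y, m * (y ⬝ᵥ y) ≤ (S.A k ω *ᵥ y) ⬝ᵥ (S.A k ω *ᵥ y)) (hco : τ ≤ S.coTrace k ω)
    (hF : ∑ i, ∑ j, (S.Shat k ω i j - (S.A k ω * (S.A k ω)ᵀ) i j * S.coTrace k ω) ^ 2 ≤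
      (m * τ / 2) ^ 2)
    {Rm : Matrix (Fin (S.d k)) (Fin (S.d k)) ℝ}
    {G : Fin (S.d k) → Matrix (Fin (r k)) (Fin (r k)) ℝ}
    (hG : ∀ j, G j *ᵥ S.Q k ω j =
      (Qhᵀ * S.Shat k ω * Qh)⁻¹ *ᵥ fun a => ∑ i, Rm i j * Qh i a)
    (hV : ∑ i, ∑ j, (S.Shat k ω i j - Rm i j) ^ 2 ≤ V) :
    S.avgRowError k Qh G ω ≤ (S.d k : ℝ)⁻¹ * (((m * τ / 2) ^ 2)⁻¹ * V) := by
  have hc : 0 < m * τ / 2 := by positivity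
  rw [avgRowError]
  refine mul_le_mul_of_nonneg_left ?_ (by positivity)
  refine (hQ.sum_row_error_le hc (S.A k ω) ?_ ?_ G hG).trans
    (mul_le_mul_of_nonneg_left hV (by positivity))
  · intro y hy
    have h1 := hA y
    rw [hy, dotProduct_zero] at h1
    have h2 := dotProduct_self_nonneg' y
    exact dotProduct_self_eq_zero.1 (by nlinarith)
  · intro y
    set x := S.A k ω *ᵥ y
    have h1 := abs_dotProduct_mulVec_le (N := S.Shat k ω -
      S.coTrace k ω • (S.A k ω * (S.A k ω)ᵀ)) hc.le (by
        refine le_trans (le_of_eq ?_) hF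
        refine Finset.sum_congr rfl fun i _ => Finset.sum_congr rfl fun j _ => ?_
        rw [Matrix.sub_apply, Matrix.smul_apply, smul_eq_mul, mul_comm]) x
    rw [sub_mulVec, dotProduct_sub, smul_mulVec, dotProduct_smul, smul_eq_mul] at h1
    have h2 := le_dotProduct_mul_transpose hm.le hA y
    have h3 := dotProduct_self_nonneg' x
    have h4 : τ * (m * (x ⬝ᵥ x)) ≤ S.coTrace k ω * (x ⬝ᵥ ((S.A k ω * (S.A k ω)ᵀ) *ᵥ x)) :=
      mul_le_mul hco h2 (by positivity) (hτ.le.trans hco)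
    have := (abs_le.1 h1).1
    linarith

lemma sum_sq_sub_add_le {p : ℕ} (X Y W : Fin p → Fin p → ℝ) :
    ∑ i, ∑ j, (X i j - W i j) ^ 2 ≤
      2 * (∑ i, ∑ j, (X i j - Y i j) ^ 2) + 2 * ∑ i, ∑ j, (Y i j - W i j) ^ 2 := by
  simp_rw [Finset.mul_sum, ← Finset.sum_add_distrib]
  refine Finset.sum_le_sum fun i _ => Finset.sum_le_sum fun j _ => ?_
  nlinarith [sq_nonneg (X i j - Y i j - (Y i j - W i j))]

end Model

end PathwiseBounds

/-! ### Rates -/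

section RateAlgebra

variable {Ω : Type*} {K : ℕ} {r re : Fin K → ℕ} (hr : ∀ k, 0 < r k) (α : ∀ k, Fin (r k) → ℝ)
  (k : Fin K) (S : Model Ω r re)

/-- The order of the smallest nonzero eigenvalue of the mode-`k` covariance matrix of the common
component. -/
noncomputable def weakStrength : ℝ :=
  gs hr α S * (S.d k : ℝ) ^ (alphaLast hr α k - alphaFirst hr α k)

variable {S}

lemma gs_pos (hd : ∀ l, 0 < S.d l) : 0 < gs hr α S :=
  Finset.prod_pos fun l _ => Real.rpow_pos_of_pos (by exact_mod_cast hd l) _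

lemma weakStrength_pos (hd : ∀ l, 0 < S.d l) : 0 < weakStrength hr α k S :=
  mul_pos (gs_pos hr α hd) (Real.rpow_pos_of_pos (by exact_mod_cast hd k) _)

lemma dTot_pos (hd : ∀ l, 0 < S.d l) : 0 < S.dTot :=
  Finset.prod_pos fun l _ => by exact_mod_cast hd l

lemma dMinus_pos (hd : ∀ l, 0 < S.d l) : 0 < S.dMinus k :=
  Finset.prod_pos fun l _ => by exact_mod_cast hd l

lemma gs_le_dTot (hd : ∀ l, 0 < S.d l) (hα : ∀ k j, α k j ≤ 1) : gs hr α S ≤ S.dTot := by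
  refine Finset.prod_le_prod (fun l _ => by positivity) fun l _ => ?_
  have h1 : (1 : ℝ) ≤ S.d l := by exact_mod_cast hd l
  calc (S.d l : ℝ) ^ alphaFirst hr α l ≤ (S.d l : ℝ) ^ (1 : ℝ) :=
        Real.rpow_le_rpow_of_exponent_le h1 (hα l _)
    _ = S.d l := Real.rpow_one _

lemma weakStrength_sq (hd : ∀ l, 0 < S.d l) :
    (weakStrength hr α k S ^ 2)⁻¹ = (gs hr α S ^ 2)⁻¹ *
      (S.d k : ℝ) ^ (2 * (alphaFirst hr α k - alphaLast hr α k)) := by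
  have hD : (0 : ℝ) < S.d k := by exact_mod_cast hd k
  have e : ((S.d k : ℝ) ^ (alphaLast hr α k - alphaFirst hr α k)) ^ 2 =
      (S.d k : ℝ) ^ (2 * (alphaLast hr α k - alphaFirst hr α k)) := by
    rw [← Real.rpow_natCast, ← Real.rpow_mul hD.le, mul_comm]; rfl
  rw [weakStrength, mul_pow, mul_inv, e, ← Real.rpow_neg hD.le]
  congr 2
  ring

/-- The weakest column of `A_k` together with the strongest columns of the other loadings. -/
lemma prod_eq_weakStrength (hd : ∀ l, 0 < S.d l) :
    (S.d k : ℝ) ^ alphaLast hr α k * ∏ l : {l // l ≠ k}, (S.d l : ℝ) ^ alphaFirst hr α l =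
      weakStrength hr α k S := by
  have hD : (0 : ℝ) < S.d k := by exact_mod_cast hd k
  rw [weakStrength, gs, Fintype.prod_eq_mul_prod_subtype_ne _ k, mul_right_comm,
    ← Real.rpow_add hD]
  congr 2
  ring

lemma strengthFactor_eq (hd : ∀ l, 0 < S.d l) :
    strengthFactor hr α k S =
      (S.d k : ℝ)⁻¹ * ((weakStrength hr α k S ^ 2)⁻¹ * gs hr α S ^ 2) := by
  have hD : (0 : ℝ) < S.d k := by exact_mod_cast hd k
  have hg := gs_pos hr α hd
  rw [weakStrength_sq hr α k hd, strengthFactor, Real.rpow_sub_one hD.ne']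
  field_simp

lemma strengthFactor_mul_baseRate (hd : ∀ l, 0 < S.d l) (hT : 0 < S.T) :
    strengthFactor hr α k S * baseRate hr α k S = (S.d k : ℝ)⁻¹ *
      ((weakStrength hr α k S ^ 2)⁻¹ * (S.d k * S.dTot / S.T + S.dTot * S.dMinus k)) := by
  have hD : (0 : ℝ) < S.d k := by exact_mod_cast hd k
  have hg := gs_pos hr α hd
  have hm := dMinus_pos k hd
  have hT' : (0 : ℝ) < S.T := by exact_mod_cast hT
  rw [strengthFactor_eq hr α k hd, baseRate, ← S.d_mul_dMinus k]
  field_simp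

end RateAlgebra

section RateLimits

variable {Ω : Type*} {K : ℕ} {r re : Fin K → ℕ} {hr : ∀ k, 0 < r k} {α : ∀ k, Fin (r k) → ℝ}
  {S : ℕ → Model Ω r re}

/-- The two noise terms are negligible by the first and by the square of the third condition of
`AssumptionR1`. -/
lemma tendsto_noise_rate (hR1 : AssumptionR1 hr α S) (hd : ∀ᶠ n in atTop, ∀ l, 0 < (S n).d l)
    (k : Fin K) :
    Tendsto (fun n => (weakStrength hr α k (S n) ^ 2)⁻¹ *
      ((S n).d k * (S n).dTot / (S n).T + (S n).dTot * (S n).dMinus k)) atTop (𝓝 0) := by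
  have h := (hR1 k).1.add ((hR1 k).2.2.pow 2)
  rw [zero_pow two_ne_zero, add_zero] at h
  refine h.congr' ?_
  filter_upwards [hd] with n hn
  have hD : (0 : ℝ) < (S n).d k := by exact_mod_cast hn k
  have hg := gs_pos hr α hn
  have e1 : (((S n).d k : ℝ) ^ (alphaFirst hr α k - alphaLast hr α k - 1 / 2)) ^ 2 =
      ((S n).d k : ℝ) ^ (2 * (alphaFirst hr α k - alphaLast hr α k)) / (S n).d k := by
    rw [← Real.rpow_natCast, ← Real.rpow_mul hD.le, ← Real.rpow_sub_one hD.ne']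
    congr 1
    push_cast
    ring
  rw [weakStrength_sq hr α k hn, Real.rpow_add_one hD.ne', mul_pow, e1, ← (S n).d_mul_dMinus k]
  field_simp

/-- The second condition of `AssumptionR1` carries an additional factor `d / g_s ≥ 1`. -/
lemma tendsto_comm_rate (hR1 : AssumptionR1 hr α S) (hα : ∀ k j, α k j ≤ 1)
    (hd : ∀ᶠ n in atTop, ∀ l, 0 < (S n).d l) (k : Fin K) :
    Tendsto (fun n => (weakStrength hr α k (S n) ^ 2)⁻¹ * (gs hr α (S n) ^ 2 / (S n).T))
      atTop (𝓝 0) := by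
  refine squeeze_zero' (Eventually.of_forall fun n => by positivity) ?_ (hR1 k).2.1
  filter_upwards [hd] with n hn
  have hD : (0 : ℝ) < (S n).d k := by exact_mod_cast hn k
  have hg := gs_pos hr α hn
  have h1 : 1 ≤ (S n).dTot / gs hr α (S n) := (one_le_div hg).2 (gs_le_dTot hr α hn hα)
  have h2 : 0 ≤ ((S n).T : ℝ)⁻¹ * ((S n).d k : ℝ) ^ (2 * (alphaFirst hr α k - alphaLast hr α k)) :=
    by positivity
  calc _ = 1 * (((S n).T : ℝ)⁻¹ *
        ((S n).d k : ℝ) ^ (2 * (alphaFirst hr α k - alphaLast hr α k))) := by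
        rw [weakStrength_sq hr α k hn]; field_simp
    _ ≤ (S n).dTot / gs hr α (S n) * (((S n).T : ℝ)⁻¹ *
        ((S n).d k : ℝ) ^ (2 * (alphaFirst hr α k - alphaLast hr α k))) :=
        mul_le_mul_of_nonneg_right h1 h2
    _ = _ := by ring

end RateLimits

/-! ### Events of high probability -/

section HighProbability

variable {Ω : Type*} [MeasurableSpace Ω] {μ : Measure Ω} {ε ε₁ ε₂ : ℝ} {P Q : ℕ → Ω → Prop}

/-- For all large `n`, the event `P n` fails with (outer) probability at most `ε`. -/
def EventuallyProb (μ : Measure Ω) (ε : ℝ) (P : ℕ → Ω → Prop) : Prop :=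
  ∀ᶠ n in atTop, μ {ω | ¬ P n ω} ≤ ENNReal.ofReal ε

namespace EventuallyProb

lemma and (h₁ : EventuallyProb μ ε₁ P) (h₂ : EventuallyProb μ ε₂ Q) (hε₁ : 0 ≤ ε₁)
    (hε₂ : 0 ≤ ε₂) : EventuallyProb μ (ε₁ + ε₂) fun n ω => P n ω ∧ Q n ω := by
  filter_upwards [h₁, h₂] with n hn₁ hn₂
  rw [ENNReal.ofReal_add hε₁ hε₂]
  refine le_trans (measure_mono fun ω hω => ?_) ((measure_union_le _ _).trans (add_le_add hn₁ hn₂))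
  by_cases h : P n ω
  · exact Or.inr fun h' => hω ⟨h, h'⟩
  · exact Or.inl h

lemma mono (h : EventuallyProb μ ε P) (hPQ : ∀ᶠ n in atTop, ∀ ω, P n ω → Q n ω) :
    EventuallyProb μ ε Q := by
  filter_upwards [h, hPQ] with n hn hn'
  refine (measure_mono fun ω hω => ?_).trans hn
  rw [Set.mem_ofPred_eq] at hω ⊢
  exact fun hP => hω (hn' ω hP)

lemma of_ae (h : ∀ᶠ n in atTop, ∀ᵐ ω ∂μ, P n ω) : EventuallyProb μ ε P := by
  filter_upwards [h] with n hn
  rw [ae_iff.1 hn]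
  exact bot_le

lemma forall_finite {ι : Type*} [Fintype ι] {P : ι → ℕ → Ω → Prop} (hε : 0 ≤ ε)
    (h : ∀ i, EventuallyProb μ (ε / (Fintype.card ι + 1)) (P i)) :
    EventuallyProb μ ε fun n ω => ∀ i, P i n ω := by
  filter_upwards [eventually_all.2 h] with n hn
  have hsub : {ω | ¬ ∀ i, P i n ω} ⊆ ⋃ i, {ω | ¬ P i n ω} := fun ω hω => by
    obtain ⟨i, hi⟩ := not_forall.1 hω
    exact Set.mem_iUnion.2 ⟨i, hi⟩
  refine (measure_mono hsub).trans ((measure_iUnion_fintype_le μ _).trans ?_)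
  refine (Finset.sum_le_sum fun i _ => hn i).trans ?_
  rw [← ENNReal.ofReal_sum_of_nonneg fun i _ => by positivity]
  refine ENNReal.ofReal_le_ofReal ?_
  rw [Finset.sum_const, nsmul_eq_mul, Finset.card_univ, mul_div_assoc',
    div_le_iff₀ (by positivity)]
  nlinarith

lemma of_tendstoInMeasure {f : ℕ → Ω → ℝ} {a δ : ℝ}
    (h : TendstoInMeasure μ f atTop fun _ => a) (hε : 0 < ε) (hδ : 0 < δ) :
    EventuallyProb μ ε fun n ω => |f n ω - a| ≤ δ := by
  have h1 := (tendstoInMeasure_iff_dist.1 h) δ hδ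
  have h2 : ∀ᶠ n in atTop, μ {ω | δ ≤ dist (f n ω) a} ≤ ENNReal.ofReal ε :=
    h1.eventually_le_const (by simpa using hε)
  filter_upwards [h2] with n hn
  refine (measure_mono fun ω hω => ?_).trans hn
  rw [Set.mem_ofPred_eq, Real.dist_eq]
  exact (not_le.1 hω).le

end EventuallyProb

lemma isBigOP_of_eventuallyProb {X : ℕ → Ω → ℝ} {b : ℕ → ℝ} (hX : ∀ n ω, 0 ≤ X n ω)
    (h : ∀ ε : ℝ, 0 < ε → ∃ C : ℝ, 0 < C ∧ EventuallyProb μ ε fun n ω => X n ω ≤ C * b n) :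
    IsBigOP μ X b := by
  intro ε hε
  obtain ⟨C, hC, hCε⟩ := h ε hε
  refine ⟨C, hC, ?_⟩
  filter_upwards [hCε] with n hn
  refine (measure_mono fun ω hω => ?_).trans hn
  intro hle
  have h1 : C * |b n| < |X n ω| := hω
  rw [abs_of_nonneg (hX n ω)] at h1
  exact absurd (hle.trans (mul_le_mul_of_nonneg_left (le_abs_self _) hC.le)) (not_le.2 h1)

lemma IsBigOP.isLittleOPOne {X : ℕ → Ω → ℝ} {b : ℕ → ℝ} (h : IsBigOP μ X b)
    (hb : Tendsto b atTop (𝓝 0)) : IsLittleOPOne μ X := by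
  rw [IsLittleOPOne, tendstoInMeasure_iff_dist]
  intro δ hδ
  rw [ENNReal.tendsto_nhds_zero]
  intro e he
  obtain ⟨ε, hε0, hεe⟩ : ∃ ε : ℝ, 0 < ε ∧ ENNReal.ofReal ε ≤ e := by
    rcases eq_or_ne e ⊤ with rfl | htop
    · exact ⟨1, one_pos, le_top⟩
    · exact ⟨e.toReal, ENNReal.toReal_pos he.ne' htop, (ENNReal.ofReal_toReal htop).le⟩
  obtain ⟨C, hC, hCn⟩ := h ε hε0
  have hsmall : ∀ᶠ n in atTop, C * |b n| < δ := by
    have : Tendsto (fun n => C * |b n|) atTop (𝓝 (C * |0|)) := (hb.abs).const_mul C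
    rw [abs_zero, mul_zero] at this
    exact this.eventually_lt_const hδ
  filter_upwards [hCn, hsmall] with n hn hs
  refine le_trans (measure_mono fun ω hω => ?_) (hn.trans hεe)
  have h1 : δ ≤ dist (X n ω) 0 := hω
  rw [Real.dist_eq, sub_zero] at h1
  exact hs.trans_le h1

end HighProbability

/-! ### High-probability bounds along the sequence of models -/

section Sequence

variable {Ω : Type*} [MeasurableSpace Ω] {μ : Measure Ω} {K : ℕ}
  {r re : Fin K → ℕ} {S : ℕ → Model Ω r re} {af ae aeps : ℕ → ℝ} {α : ∀ k, Fin (r k) → ℝ}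
  {SigA : ∀ k, Matrix (Fin (r k)) (Fin (r k)) ℝ}

/-- The constants are common to all the models of the sequence. -/
lemma exists_hasNoiseBounds [IsProbabilityMeasure μ]
    (hmeas : ∀ n, IsMeasurableModel (S n)) (hF1 : AssumptionF1 μ S af)
    (hE1 : AssumptionE1 μ S) (hE2 : AssumptionE2 μ S ae aeps) :
    ∃ (κ L Γ : ℝ) (R : ℤ → ℝ), ∀ n, HasNoiseBounds μ (S n) κ L Γ R ((S n).coeffs af ae aeps) := by
  obtain ⟨κf, hf⟩ := hF1.innov
  obtain ⟨κe, he⟩ := hE2.innov_e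
  obtain ⟨κs, hs⟩ := hE2.innov_eps
  obtain ⟨Cs, hCs⟩ := hE1.sig
  obtain ⟨Ca, hCa⟩ := hE1.sparse
  set κ := max 0 (max κf (max κe κs)) with hκ
  have up : ∀ {ι : Type} {X : ℤ → Ω → ι → ℝ} {κ' : ℝ}, κ' ≤ κ → IsInnovation μ κ' X →
      IsInnovation μ κ X := fun hle h => ⟨h.indep, h.mean, h.var,
    fun t i => ⟨(h.fourth t i).1, (h.fourth t i).2.trans hle⟩⟩
  refine ⟨κ, (∑' q, |af q|) ^ 2 + (∑' q, |ae q|) ^ 2 + (∑' q, |aeps q|) ^ 2,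
    Fintype.card (MultiIndex re) * (max Ca 0 ^ K * max Ca 0 ^ K) + Cs ^ 2,
    fun τ => autocovBound af τ + autocovBound ae τ + autocovBound aeps τ, fun n => ?_⟩
  refine ⟨hmeas n, ?_, ?_, ?_, ?_, ?_, ?_, le_max_left _ _, by positivity, ?_⟩
  · exact isStdNoise_innov (S n) (hmeas n) (up (by simp [hκ]) (hf n)) (up (by simp [hκ]) (he n))
      (up (by simp [hκ]) (hs n)) (hE2.indep_e_eps n) (hE2.indep_f n)
  · rintro t (m | m | m)
    exacts [hF1.linear n t m, hE2.linear_e n t m, hE2.linear_eps n t m]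
  · rintro (m | m | m)
    exacts [hF1.coeff, hE2.coeff_e, hE2.coeff_eps]
  · have h1 := autocovBound_nonneg af
    have h2 := autocovBound_nonneg ae
    have h3 := autocovBound_nonneg aeps
    rintro (m | m | m) τ
    · change autocovBound af τ ≤ _
      linarith [h1 τ, h2 τ, h3 τ]
    · change autocovBound ae τ ≤ _
      linarith [h1 τ, h2 τ, h3 τ]
    · change autocovBound aeps τ ≤ _
      linarith [h1 τ, h2 τ, h3 τ]
  · exact fun τ => add_nonneg (add_nonneg (autocovBound_nonneg af τ) (autocovBound_nonneg ae τ))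
      (autocovBound_nonneg aeps τ)
  · intro F
    rw [Finset.sum_add_distrib, Finset.sum_add_distrib]
    exact add_le_add (add_le_add (sum_autocovBound_le hF1.coeff.abs F)
      (sum_autocovBound_le hE2.coeff_e.abs F)) (sum_autocovBound_le hE2.coeff_eps.abs F)
  · exact (S n).sum_absGram_noiseLoad_le (le_max_right _ _)
      (fun k j => (hCa n k j).trans (le_max_left _ _)) (hCs n)

/-- Common constants for the factor strengths of all columns of all loadings. -/
lemma exists_strength_bounds (hL1 : AssumptionL1 μ S α SigA) {ε : ℝ} (hε : 0 < ε) :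
    ∃ c C : ℝ, 0 < c ∧ 0 < C ∧ EventuallyProb μ ε fun n ω => ∀ l j,
      c * ((S n).d l : ℝ) ^ α l j ≤ (S n).Z l ω j ∧
      (S n).Z l ω j ≤ C * ((S n).d l : ℝ) ^ α l j := by
  have hε' : 0 < ε / (Fintype.card (Σ l, Fin (r l)) + 1) := by positivity
  choose c C hc hC h using fun i : Σ l, Fin (r l) => hL1.strength i.1 i.2 _ hε'
  refine ⟨(∑ i, (c i)⁻¹ + 1)⁻¹, ∑ i, C i + 1, ?_, ?_, ?_⟩
  · have := Finset.sum_nonneg fun i (_ : i ∈ Finset.univ) => (inv_pos.2 (hc i)).le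
    positivity
  · have := Finset.sum_nonneg fun i (_ : i ∈ Finset.univ) => (hC i).le
    positivity
  · have H := EventuallyProb.forall_finite (μ := μ) hε.le
      (P := fun (i : Σ l, Fin (r l)) n ω => c i * ((S n).d i.1 : ℝ) ^ α i.1 i.2 ≤ (S n).Z i.1 ω i.2 ∧
        (S n).Z i.1 ω i.2 ≤ C i * ((S n).d i.1 : ℝ) ^ α i.1 i.2) h
    refine H.mono (Eventually.of_forall fun n ω hω l j => ?_)
    have h0 : 0 ≤ ((S n).d l : ℝ) ^ α l j := by positivity
    have h1 : (∑ i, (c i)⁻¹ + 1)⁻¹ ≤ c ⟨l, j⟩ := by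
      rw [inv_le_comm₀ (by
        have := Finset.sum_nonneg fun i (_ : i ∈ Finset.univ) => (inv_pos.2 (hc i)).le
        positivity) (hc _)]
      have := Finset.single_le_sum (f := fun i => (c i)⁻¹) (fun i _ => (inv_pos.2 (hc i)).le)
        (Finset.mem_univ ⟨l, j⟩)
      linarith
    have h2 : C ⟨l, j⟩ ≤ ∑ i, C i + 1 := by
      have := Finset.single_le_sum (f := C) (fun i _ => (hC i).le) (Finset.mem_univ ⟨l, j⟩)
      linarith
    exact ⟨(mul_le_mul_of_nonneg_right h1 h0).trans (hω ⟨l, j⟩).1,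
      (hω ⟨l, j⟩).2.trans (mul_le_mul_of_nonneg_right h2 h0)⟩

/-- With probability close to one, the loadings have the strengths `α`: the smallest nonzero
eigenvalue of the covariance of the common component is at least of order `weakStrength`, and its
trace at most of order `g_s`. -/
lemma exists_loading_bounds (hr : ∀ k, 0 < r k) (hL1 : AssumptionL1 μ S α SigA)
    (hd : ∀ᶠ n in atTop, ∀ l, 0 < (S n).d l) (k : Fin K) {ε : ℝ} (hε : 0 < ε) :
    ∃ c₁ c₂ : ℝ, 0 < c₁ ∧ 0 < c₂ ∧ EventuallyProb μ ε fun n ω =>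
      (∃ m τ : ℝ, 0 < m ∧ 0 < τ ∧
        (∀ y, m * (y ⬝ᵥ y) ≤ ((S n).A k ω *ᵥ y) ⬝ᵥ ((S n).A k ω *ᵥ y)) ∧
        τ ≤ (S n).coTrace k ω ∧ c₁ * weakStrength hr α k (S n) ≤ m * τ / 2) ∧
      (S n).traceProd ω ≤ c₂ * gs hr α (S n) := by
  obtain ⟨c₀, δ, hc₀, hδ, hpd⟩ := exists_pos_le_of_posDef (hr k) (hL1.posDef k)
  obtain ⟨c, C, hc, hC, hZ⟩ := exists_strength_bounds (μ := μ) hL1 (half_pos hε)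
  have hlim := EventuallyProb.forall_finite (μ := μ) (half_pos hε).le
    (P := fun (z : Fin (r k) × Fin (r k)) n ω => |((S n).ZinvSqrt k ω * ((S n).A k ω)ᵀ *
      (S n).A k ω * (S n).ZinvSqrt k ω) z.1 z.2 - SigA k z.1 z.2| ≤ δ)
    fun z => EventuallyProb.of_tendstoInMeasure (hL1.limit k z.1 z.2) (by positivity) hδ
  have hrpos : ∀ l, (0 : ℝ) < r l := fun l => by exact_mod_cast hr l
  refine ⟨c₀ * c * (∏ _l : {l // l ≠ k}, c) / 2, ∏ l, (r l * C), by positivity,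
    Finset.prod_pos fun l _ => mul_pos (hrpos l) hC, ?_⟩
  have hboth := hZ.and hlim (half_pos hε).le (half_pos hε).le
  rw [add_halves] at hboth
  refine hboth.mono ?_
  filter_upwards [hd] with n hn ω hω
  obtain ⟨hω1, hω2⟩ := hω
  have hd1 : ∀ l, (1 : ℝ) ≤ (S n).d l := fun l => by exact_mod_cast hn l
  have hd0 : ∀ l, (0 : ℝ) < (S n).d l := fun l => one_pos.trans_le (hd1 l)
  have hlast : ∀ j, ((S n).d k : ℝ) ^ alphaLast hr α k ≤ ((S n).d k : ℝ) ^ α k j := fun j =>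
    Real.rpow_le_rpow_of_exponent_le (hd1 k)
      (hL1.anti k (Fin.mk_le_mk.2 (Nat.le_sub_one_of_lt j.2)))
  have hfirst : ∀ l j, ((S n).d l : ℝ) ^ α l j ≤ ((S n).d l : ℝ) ^ alphaFirst hr α l := fun l j =>
    Real.rpow_le_rpow_of_exponent_le (hd1 l) (hL1.anti l (Fin.mk_le_mk.2 (Nat.zero_le _)))
  refine ⟨⟨c₀ * (c * ((S n).d k : ℝ) ^ alphaLast hr α k),
    ∏ l : {l // l ≠ k}, (c * ((S n).d l : ℝ) ^ alphaFirst hr α l), ?_, ?_, ?_, ?_, ?_⟩, ?_⟩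
  · have := Real.rpow_pos_of_pos (hd0 k) (alphaLast hr α k)
    positivity
  · exact Finset.prod_pos fun l _ => mul_pos hc (Real.rpow_pos_of_pos (hd0 l) _)
  · refine Model.le_dotProduct_A_mulVec hc₀.le
      (mul_pos hc (Real.rpow_pos_of_pos (hd0 k) _)) (fun j => ?_)
      (hpd _ fun a b => hω2 (a, b))
    exact (mul_le_mul_of_nonneg_left (hlast j) hc.le).trans (hω1 k j).1
  · refine Finset.prod_le_prod (fun l _ => by positivity) fun l _ => ?_
    exact (hω1 l ⟨0, hr l⟩).1.trans (Finset.single_le_sum (f := fun j => (S n).Z l ω j)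
      (fun j _ => (S n).Z_nonneg l ω j) (Finset.mem_univ _))
  · rw [← prod_eq_weakStrength hr α k hn, Finset.prod_mul_distrib]
    exact le_of_eq (by ring)
  · rw [Model.traceProd, gs, ← Finset.prod_mul_distrib]
    refine Finset.prod_le_prod (fun l _ => Finset.sum_nonneg fun j _ => (S n).Z_nonneg l ω j)
      fun l _ => ?_
    calc _ ≤ ∑ _j : Fin (r l), C * ((S n).d l : ℝ) ^ alphaFirst hr α l :=
          Finset.sum_le_sum fun j _ => (hω1 l j).2.trans
            (mul_le_mul_of_nonneg_left (hfirst l j) hC.le)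
      _ = _ := by simp; ring

end Sequence

/-! ### Convergence rates of the leading eigenvectors -/

section Consistency

variable {Ω : Type*} [MeasurableSpace Ω] {μ : Measure Ω} [IsProbabilityMeasure μ] {K : ℕ}
  {r re : Fin K → ℕ} {S : ℕ → Model Ω r re} {af ae aeps : ℕ → ℝ} {α : ∀ k, Fin (r k) → ℝ}
  {SigA : ∀ k, Matrix (Fin (r k)) (Fin (r k)) ℝ} {κ L Γ p : ℝ} {R : ℤ → ℝ}
  {ac : ∀ n, SeriesIndex (S n) → ℕ → ℝ}

/-- High-probability bounds for the noise terms and for the sampling error of the factors. -/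
lemma exists_error_bounds (hr : ∀ k, 0 < r k) (hS : ∀ n, HasNoiseBounds μ (S n) κ L Γ R (ac n))
    (hI : ∀ n, PatternLoadingsIndep μ (S n)) (hp : 0 < p) (hα : ∀ k j, α k j ≤ 1)
    (hT : ∀ᶠ n in atTop, 0 < (S n).T) (hd : ∀ᶠ n in atTop, ∀ l, 0 < (S n).d l) (k : Fin K)
    {c₂ : ℝ} (hc₂ : 0 < c₂) {ε : ℝ} (hε : 0 < ε) :
    ∃ C : ℝ, 0 < C ∧ EventuallyProb μ ε fun n ω => (S n).ObservedAtLeast k p ω →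
      (S n).traceProd ω ≤ c₂ * gs hr α (S n) →
      ∑ i, ∑ j, ((S n).Shat k ω i j - (S n).commCovObs k ω i j) ^ 2 ≤
        C * ((S n).d k * (S n).dTot / (S n).T + (S n).dTot * (S n).dMinus k) ∧
      (S n).commComm k ω ω ≤ C * (gs hr α (S n) ^ 2 / (S n).T) := by
  have hκ := (hS 0).κ_nonneg
  have hΓ := (hS 0).Γ_nonneg
  have hε3 : 0 < ε / 3 := by positivity
  set a := 2 * (κ + 1) * (L ^ 2 * (p ^ 2)⁻¹) with ha
  have ha0 : 0 ≤ a := by positivity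
  set C₁ := (ε / 3)⁻¹ * (a * Γ ^ 2)
  set C₂ := (ε / 3)⁻¹ * (a * (Γ * c₂))
  set C₃ := (ε / 3)⁻¹ * (a * c₂ ^ 2)
  have e1 : EventuallyProb μ (ε / 3) fun n ω => (S n).ObservedAtLeast k p ω →
      (S n).noiseNoise k ω ω ≤ C₁ * ((S n).d k * (S n).dTot / (S n).T) := by
    filter_upwards [hT] with n hn
    have hn' : (0 : ℝ) < (S n).T := by exact_mod_cast hn
    have h := (hS n).measure_noiseNoise_le (hI n) k hp hn
      (B := a * (Γ ^ 2 * ((S n).d k * (S n).dTot / (S n).T)))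
      (by have := (S n).dTot_nonneg; positivity) (inv_pos.2 hε3) (le_of_eq (by
        rw [(S n).card_coIndex, ← (S n).d_mul_dMinus k, ha]; field_simp))
    rw [inv_inv] at h
    refine (measure_mono fun ω hω => ?_).trans h
    rw [Set.mem_ofPred_eq] at hω ⊢
    push Not at hω
    refine ⟨hω.1, lt_of_eq_of_lt ?_ hω.2⟩
    ring
  have e2 : EventuallyProb μ (ε / 3) fun n ω => (S n).ObservedAtLeast k p ω →
      (S n).traceProd ω ≤ c₂ * gs hr α (S n) →
      (S n).noiseComm k ω ω ≤ C₂ * ((S n).d k * (S n).dTot / (S n).T) := by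
    filter_upwards [hT, hd] with n hn hdn
    have hn' : (0 : ℝ) < (S n).T := by exact_mod_cast hn
    have hg := gs_pos hr α hdn
    have h := (hS n).measure_noiseComm_le (hI n) k hp hn (τ := c₂ * gs hr α (S n))
      (B := a * (Γ * c₂) * ((S n).d k * (S n).dTot / (S n).T))
      (by have := (S n).dTot_nonneg; positivity) (inv_pos.2 hε3) (by
        calc _ = a * (Γ * c₂) * ((S n).d k * gs hr α (S n) / (S n).T) := by rw [ha]; field_simp
          _ ≤ _ := by
            have := gs_le_dTot hr α hdn hα
            gcongr)
    rw [inv_inv] at h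
    refine (measure_mono fun ω hω => ?_).trans h
    rw [Set.mem_ofPred_eq] at hω ⊢
    push Not at hω
    refine ⟨hω.1, hω.2.1, lt_of_eq_of_lt ?_ hω.2.2⟩
    ring
  have e3 : EventuallyProb μ (ε / 3) fun n ω => (S n).ObservedAtLeast k p ω →
      (S n).traceProd ω ≤ c₂ * gs hr α (S n) →
      (S n).commComm k ω ω ≤ C₃ * (gs hr α (S n) ^ 2 / (S n).T) := by
    filter_upwards [hT] with n hn
    have hn' : (0 : ℝ) < (S n).T := by exact_mod_cast hn
    have h := (hS n).measure_commComm_le (hI n) k hp hn (τ := c₂ * gs hr α (S n))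
      (B := a * c₂ ^ 2 * (gs hr α (S n) ^ 2 / (S n).T)) (by positivity) (inv_pos.2 hε3)
      (le_of_eq (by rw [ha]; field_simp))
    rw [inv_inv] at h
    refine (measure_mono fun ω hω => ?_).trans h
    rw [Set.mem_ofPred_eq] at hω ⊢
    push Not at hω
    refine ⟨hω.1, hω.2.1, lt_of_eq_of_lt ?_ hω.2.2⟩
    ring
  have hC₁ : 0 ≤ C₁ := by positivity
  have hC₂ : 0 ≤ C₂ := by positivity
  have hC₃ : 0 ≤ C₃ := by positivity
  have hall := (e1.and e2 hε3.le hε3.le).and e3 (by positivity) hε3.le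
  rw [show ε / 3 + ε / 3 + ε / 3 = ε by ring] at hall
  refine ⟨4 * C₁ + 4 * Γ ^ 2 + 8 * C₂ + C₃ + 1, by positivity, hall.mono ?_⟩
  filter_upwards [hT, hd] with n hn hdn ω hω hobs htr
  obtain ⟨⟨h1, h2⟩, h3⟩ := hω
  replace h1 := h1 hobs
  replace h2 := h2 hobs htr
  replace h3 := h3 hobs htr
  have hdT := dTot_pos hdn
  have hdm := dMinus_pos k hdn
  constructor
  · refine ((S n).sum_sq_Shat_sub_commCovObs_le k hobs hp hn
      ((hS n).sum_sq_noise_mean_le k)).trans ?_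
    rw [(S n).card_coIndex, show ((S n).d k : ℝ) * (S n).dMinus k ^ 2 =
      (S n).dTot * (S n).dMinus k by rw [← (S n).d_mul_dMinus k]; ring]
    set x := ((S n).d k : ℝ) * (S n).dTot / (S n).T
    set y := (S n).dTot * (S n).dMinus k
    have hx : 0 ≤ x := by positivity
    have hy : 0 ≤ y := by positivity
    have hΓ2 : 0 ≤ Γ ^ 2 := by positivity
    nlinarith [mul_nonneg hC₁ hy, mul_nonneg hC₂ hy, mul_nonneg hC₃ hx, mul_nonneg hC₃ hy,
      mul_nonneg hΓ2 hx]
  · refine h3.trans (mul_le_mul_of_nonneg_right ?_ (by positivity))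
    nlinarith [sq_nonneg Γ]

/-- High-probability bound for the effect of the missing observations on the factor part. -/
lemma exists_gap_bound (hr : ∀ k, 0 < r k) (hS : ∀ n, HasNoiseBounds μ (S n) κ L Γ R (ac n))
    (hI : ∀ n, PatternLoadingsIndep μ (S n)) (hp : 0 < p)
    (hT : ∀ᶠ n in atTop, 0 < (S n).T) (k : Fin K)
    {η : ℕ → ℝ} (hη : ∀ n, 0 ≤ η n ∧ η n < 1) {c₂ : ℝ} {ε : ℝ} (hε : 0 < ε) :
    ∃ C : ℝ, 0 ≤ C ∧ EventuallyProb μ ε fun n ω => (S n).ObservedAtLeast k p ω →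
      (S n).ObservedAtLeast k (1 - η n) ω → (S n).traceProd ω ≤ c₂ * gs hr α (S n) →
      (S n).commGap k ω ω ≤ C * (gs hr α (S n) ^ 2 *
        min (1 / ((S n).T : ℝ)) (η n ^ 2 / (1 - η n) ^ 2)) := by
  have hκ := (hS 0).κ_nonneg
  set a := 2 * (κ + 1) * (L ^ 2 * ((p ^ 2)⁻¹ + 4)) with ha
  refine ⟨ε⁻¹ * (a * c₂ ^ 2), by positivity, ?_⟩
  filter_upwards [hT] with n hn
  have hn' : (0 : ℝ) < (S n).T := by exact_mod_cast hn
  have h1η : 0 < 1 - η n := by linarith [(hη n).2]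
  -- the total variation bound `2 η` is stronger than needed, since `1 - η ≤ 1`
  have hη2 : η n ^ 2 ≤ η n ^ 2 / (1 - η n) ^ 2 := by
    refine le_div_self (sq_nonneg _) (by positivity) (pow_le_one₀ h1η.le ?_)
    linarith [(hη n).1]
  set u := min (1 / ((S n).T : ℝ)) (η n ^ 2 / (1 - η n) ^ 2) with hu
  have hmin : min ((p * (S n).T)⁻¹ ^ 2 * (S n).T) ((2 * η n) ^ 2) ≤ ((p ^ 2)⁻¹ + 4) * u := by
    have hp2 : 0 < (p ^ 2)⁻¹ := by positivity
    rw [hu, mul_min_of_nonneg _ _ (by positivity)]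
    refine min_le_min ?_ ?_
    · calc (p * (S n).T)⁻¹ ^ 2 * (S n).T = (p ^ 2)⁻¹ * (1 / (S n).T) := by field_simp
        _ ≤ _ := mul_le_mul_of_nonneg_right (by linarith) (by positivity)
    · have h0 : 0 ≤ η n ^ 2 / (1 - η n) ^ 2 := by positivity
      nlinarith
  have hu0 : 0 ≤ u := le_min (by positivity) (by positivity)
  have h := (hS n).measure_commGap_le (hI n) k hp hn (τ := c₂ * gs hr α (S n))
    (B := a * c₂ ^ 2 * (gs hr α (S n) ^ 2 * u)) (by positivity) (inv_pos.2 hε) (hη n).2 (by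
      calc _ ≤ 2 * (κ + 1) * (L ^ 2 * (((p ^ 2)⁻¹ + 4) * u)) * (c₂ * gs hr α (S n)) ^ 2 := by
            gcongr
        _ = _ := by rw [ha]; ring)
  rw [inv_inv] at h
  refine (measure_mono fun ω hω => ?_).trans h
  rw [Set.mem_ofPred_eq] at hω ⊢
  push Not at hω
  refine ⟨hω.1, hω.2.1, hω.2.2.1, lt_of_eq_of_lt ?_ hω.2.2.2⟩
  ring

/-- With probability close to one the error of the leading eigenvectors, relative to any rotations
of the form used in the theorem, is at most the distance between two covariance matrices in units
of the smallest nonzero eigenvalue. -/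
lemma exists_rowError_bounds (hr : ∀ k, 0 < r k)
    (hS : ∀ n, HasNoiseBounds μ (S n) κ L Γ R (ac n))
    (hI : ∀ n, PatternLoadingsIndep μ (S n)) (hp : 0 < p)
    (hobs : ∀ᶠ n in atTop, ∀ k, ∀ᵐ ω ∂μ, (S n).ObservedAtLeast k p ω)
    (hL1 : AssumptionL1 μ S α SigA) (hR1 : AssumptionR1 hr α S)
    (hT : ∀ᶠ n in atTop, 0 < (S n).T) (hd : ∀ᶠ n in atTop, ∀ l, 0 < (S n).d l)
    (Qhat : ∀ n k, Ω → Matrix (Fin ((S n).d k)) (Fin (r k)) ℝ)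
    (hQhat : ∀ n k, ∀ᵐ ω ∂μ, IsLeadingEigenvectors ((S n).Shat k ω) (Qhat n k ω))
    (k : Fin K) {ε : ℝ} (hε : 0 < ε) :
    ∃ C c₂ : ℝ, 0 < C ∧ EventuallyProb μ ε fun n ω => (S n).ObservedAtLeast k p ω ∧
      (S n).traceProd ω ≤ c₂ * gs hr α (S n) ∧
      ∑ i, ∑ j, ((S n).Shat k ω i j - (S n).commCovObs k ω i j) ^ 2 ≤
        C * ((S n).d k * (S n).dTot / (S n).T + (S n).dTot * (S n).dMinus k) ∧
      ∀ (G : Fin ((S n).d k) → Matrix (Fin (r k)) (Fin (r k)) ℝ)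
        (Rm : Matrix (Fin ((S n).d k)) (Fin ((S n).d k)) ℝ) (V : ℝ),
        (∀ j, G j *ᵥ (S n).Q k ω j = ((Qhat n k ω)ᵀ * (S n).Shat k ω * Qhat n k ω)⁻¹ *ᵥ
          fun a => ∑ i, Rm i j * Qhat n k ω i a) →
        ∑ i, ∑ j, ((S n).Shat k ω i j - Rm i j) ^ 2 ≤ V →
        (S n).avgRowError k (Qhat n k ω) G ω ≤
          C * (((S n).d k : ℝ)⁻¹ * ((weakStrength hr α k (S n) ^ 2)⁻¹ * V)) := by
  have hε2 := half_pos hε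
  obtain ⟨c₁, c₂, hc₁, hc₂, hload⟩ := exists_loading_bounds (μ := μ) hr hL1 hd k hε2
  obtain ⟨C, hC, herr⟩ := exists_error_bounds hr hS hI hp hL1.le_one hT hd k hc₂ hε2
  refine ⟨C + (c₁ ^ 2)⁻¹, c₂, by positivity, ?_⟩
  -- by the rate conditions, the errors are eventually smaller than the smallest nonzero eigenvalue
  have hsmall : ∀ᶠ n in atTop, 2 * C * ((weakStrength hr α k (S n) ^ 2)⁻¹ *
      ((S n).d k * (S n).dTot / (S n).T + (S n).dTot * (S n).dMinus k)) +
      2 * C * ((weakStrength hr α k (S n) ^ 2)⁻¹ * (gs hr α (S n) ^ 2 / (S n).T)) ≤ c₁ ^ 2 := by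
    have h := ((tendsto_noise_rate hR1 hd k).const_mul (2 * C)).add
      ((tendsto_comm_rate hR1 hL1.le_one hd k).const_mul (2 * C))
    rw [mul_zero, add_zero] at h
    exact h.eventually_le_const (by positivity)
  have hae : EventuallyProb μ 0 fun n ω => (S n).ObservedAtLeast k p ω ∧
      IsLeadingEigenvectors ((S n).Shat k ω) (Qhat n k ω) := by
    refine EventuallyProb.of_ae ?_
    filter_upwards [hobs] with n hn
    filter_upwards [hn k, hQhat n k] with ω h1 h2 using ⟨h1, h2⟩
  have hall := (hload.and herr hε2.le hε2.le).and hae (by positivity) le_rfl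
  rw [add_halves, add_zero] at hall
  refine hall.mono ?_
  filter_upwards [hT, hd, hsmall] with n hTn hdn hsn ω hω
  obtain ⟨⟨⟨⟨m, τ, hm, hτ, hA, hco, hmτ⟩, htr⟩, herrω⟩, hobsω, hQω⟩ := hω
  obtain ⟨hV, hcc⟩ := herrω hobsω htr
  have hw := weakStrength_pos hr α k hdn
  have hdT := dTot_pos hdn
  have hdm := dMinus_pos k hdn
  have hT' : (0 : ℝ) < (S n).T := by exact_mod_cast hTn
  set w := weakStrength hr α k (S n)
  set N := ((S n).d k : ℝ) * (S n).dTot / (S n).T + (S n).dTot * (S n).dMinus k with hN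
  have hN0 : 0 ≤ N := by positivity
  refine ⟨hobsω, htr, hV.trans (mul_le_mul_of_nonneg_right ?_ hN0), fun G Rm V hG hRm => ?_⟩
  · have : 0 < (c₁ ^ 2)⁻¹ := by positivity
    linarith
  have hV0 : 0 ≤ V := le_trans (Finset.sum_nonneg fun i _ => Finset.sum_nonneg fun j _ =>
    sq_nonneg _) hRm
  have hF : ∑ i, ∑ j, ((S n).Shat k ω i j -
      ((S n).A k ω * ((S n).A k ω)ᵀ) i j * (S n).coTrace k ω) ^ 2 ≤ (m * τ / 2) ^ 2 := by
    refine (Model.sum_sq_sub_add_le _ (fun i j => (S n).commCovObs k ω i j) _).trans ?_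
    rw [(S n).sum_sq_commCovObs_sub_eq k hobsω hp hTn]
    calc _ ≤ 2 * (C * N) + 2 * (C * (gs hr α (S n) ^ 2 / (S n).T)) := by linarith
      _ = w ^ 2 * (2 * C * ((w ^ 2)⁻¹ * N) +
          2 * C * ((w ^ 2)⁻¹ * (gs hr α (S n) ^ 2 / (S n).T))) := by field_simp
      _ ≤ w ^ 2 * c₁ ^ 2 := mul_le_mul_of_nonneg_left hsn (by positivity)
      _ = (c₁ * w) ^ 2 := by ring
      _ ≤ (m * τ / 2) ^ 2 := pow_le_pow_left₀ (by positivity) hmτ 2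
  refine (Model.avgRowError_le hQω hm hτ hA hco hF hG hRm).trans ?_
  have hinv : ((m * τ / 2) ^ 2)⁻¹ ≤ (c₁ ^ 2)⁻¹ * (w ^ 2)⁻¹ := by
    rw [← mul_inv, ← mul_pow]
    exact inv_anti₀ (by positivity) (pow_le_pow_left₀ (by positivity) hmτ 2)
  have hx : 0 ≤ ((S n).d k : ℝ)⁻¹ * ((w ^ 2)⁻¹ * V) := by positivity
  calc _ ≤ ((S n).d k : ℝ)⁻¹ * ((c₁ ^ 2)⁻¹ * (w ^ 2)⁻¹ * V) := by gcongr
    _ = (c₁ ^ 2)⁻¹ * (((S n).d k : ℝ)⁻¹ * ((w ^ 2)⁻¹ * V)) := by ring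
    _ ≤ _ := by nlinarith

end Consistency

end TensorPCA

theorem theorem1 {Ω : Type*} [MeasurableSpace Ω] (μ : Measure Ω) [IsProbabilityMeasure μ]
    {K : ℕ} {r re : Fin K → ℕ} (hr : ∀ k, 0 < r k)
    (S : ℕ → Model Ω r re)
    (hmeas : ∀ n, IsMeasurableModel (S n))
    (hT : Tendsto (fun n => (S n).T) atTop atTop)
    (hd : ∀ k, Tendsto (fun n => (S n).d k) atTop atTop)
    (af ae aeps : ℕ → ℝ) (α : ∀ k, Fin (r k) → ℝ)
    (SigA : ∀ k, Matrix (Fin (r k)) (Fin (r k)) ℝ)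
    (hindep : ∀ n, PatternLoadingsIndep μ (S n))
    (hO1 : AssumptionO1 μ S) (hM1 : AssumptionM1 μ S) (hF1 : AssumptionF1 μ S af)
    (hL1 : AssumptionL1 μ S α SigA) (hE1 : AssumptionE1 μ S) (hE2 : AssumptionE2 μ S ae aeps)
    (hR1 : AssumptionR1 hr α S)
    (Qhat : ∀ n k, Ω → Matrix (Fin ((S n).d k)) (Fin (r k)) ℝ)
    (hQhat : ∀ n k, ∀ᵐ ω ∂μ, IsLeadingEigenvectors ((S n).Shat k ω) (Qhat n k ω))
    (k : Fin K) :
    (IsBigOP μ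
        (fun n ω => (S n).avgRowError k (Qhat n k ω)
          (fun j => (S n).Hrow k (Qhat n k ω) j ω) ω)
        (fun n => strengthFactor hr α k (S n) * baseRate hr α k (S n)) ∧
      IsLittleOPOne μ
        (fun n ω => (S n).avgRowError k (Qhat n k ω)
          (fun j => (S n).Hrow k (Qhat n k ω) j ω) ω)) ∧
    ∀ η : ℕ → ℝ, (∀ n, 0 ≤ η n ∧ η n < 1) →
      (∀ n, ∀ᵐ ω ∂μ, ∀ i j h, 1 - η n ≤ (((S n).psi k i j h ω).card : ℝ) / (S n).T) →
      (∀ n ω, (S n).avgRowError k (Qhat n k ω) (fun _ => (S n).Hall k (Qhat n k ω) ω) ω =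
        ((S n).d k : ℝ)⁻¹ *
          frobNorm (Qhat n k ω - (S n).Q k ω * ((S n).Hall k (Qhat n k ω) ω)ᵀ) ^ 2) ∧
      IsBigOP μ
        (fun n ω => (S n).avgRowError k (Qhat n k ω)
          (fun _ => (S n).Hall k (Qhat n k ω) ω) ω)
        (fun n => strengthFactor hr α k (S n) *
          (baseRate hr α k (S n) +
            min (1 / ((S n).T : ℝ)) (η n ^ 2 / (1 - η n) ^ 2))) ∧
      IsLittleOPOne μ
        (fun n ω => (S n).avgRowError k (Qhat n k ω)
          (fun _ => (S n).Hall k (Qhat n k ω) ω) ω) := by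
  obtain ⟨p, hp, hO1⟩ := hO1
  obtain ⟨κ, L, Γ, R, hS⟩ := exists_hasNoiseBounds hmeas hF1 hE1 hE2
  have hT1 : ∀ᶠ n in atTop, 0 < (S n).T := hT.eventually_gt_atTop 0
  have hd1 : ∀ᶠ n in atTop, ∀ l, 0 < (S n).d l :=
    eventually_all.2 fun l => (hd l).eventually_gt_atTop 0
  have hobs : ∀ᶠ n in atTop, ∀ k, ∀ᵐ ω ∂μ, (S n).ObservedAtLeast k p ω := by
    filter_upwards [hT1] with n hn k
    filter_upwards [hO1 n] with ω hω i j h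
    exact (le_div_iff₀ (by exact_mod_cast hn)).1 (hω k i j h)
  have hDinv : ∀ᶠ n in atTop, ((S n).d k : ℝ)⁻¹ ≤ 1 := by
    filter_upwards [hd1] with n hn
    exact inv_le_one_of_one_le₀ (by exact_mod_cast hn k)
  have hnoise := tendsto_noise_rate hR1 hd1 k
  have hcomm := tendsto_comm_rate hR1 hL1.le_one hd1 k
  -- the rate is `1 / d_k` times the one that tends to zero in `hnoise`
  have hrate : Tendsto (fun n => strengthFactor hr α k (S n) * baseRate hr α k (S n)) atTop
      (𝓝 0) := by
    refine squeeze_zero' ?_ ?_ hnoise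
    · filter_upwards [hT1, hd1] with n hTn hdn
      have h1 := dTot_pos hdn
      have h2 := dMinus_pos k hdn
      rw [strengthFactor_mul_baseRate hr α k hdn hTn]
      positivity
    · filter_upwards [hT1, hd1, hDinv] with n hTn hdn hDn
      have h1 := dTot_pos hdn
      have h2 := dMinus_pos k hdn
      rw [strengthFactor_mul_baseRate hr α k hdn hTn]
      exact mul_le_of_le_one_left (by positivity) hDn
  have hrow : IsBigOP μ (fun n ω => (S n).avgRowError k (Qhat n k ω)
      (fun j => (S n).Hrow k (Qhat n k ω) j ω) ω)
      (fun n => strengthFactor hr α k (S n) * baseRate hr α k (S n)) := by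
    refine isBigOP_of_eventuallyProb (fun n ω => (S n).avgRowError_nonneg k _ _ ω) fun ε hε => ?_
    obtain ⟨C, c₂, hC, h⟩ := exists_rowError_bounds hr hS hindep hp hobs hL1 hR1 hT1 hd1 Qhat
      hQhat k hε
    refine ⟨C * C, by positivity, h.mono ?_⟩
    filter_upwards [hT1, hd1] with n hTn hdn ω hω
    refine (hω.2.2.2 _ _ _ (fun j => (S n).Hrow_mulVec k _ j ω) hω.2.2.1).trans (le_of_eq ?_)
    rw [strengthFactor_mul_baseRate hr α k hdn hTn]
    ring
  refine ⟨⟨hrow, hrow.isLittleOPOne hrate⟩, fun η hη hobsη => ?_⟩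
  have hrateη : Tendsto (fun n => strengthFactor hr α k (S n) * (baseRate hr α k (S n) +
      min (1 / ((S n).T : ℝ)) (η n ^ 2 / (1 - η n) ^ 2))) atTop (𝓝 0) := by
    have hsum := hrate.add hcomm
    rw [add_zero] at hsum
    have hmin0 : ∀ n, 0 ≤ min (1 / ((S n).T : ℝ)) (η n ^ 2 / (1 - η n) ^ 2) := fun n =>
      le_min (by positivity) (by positivity)
    refine squeeze_zero' ?_ ?_ hsum
    · filter_upwards [hT1, hd1] with n hTn hdn
      have h1 := dTot_pos hdn
      have h2 := dMinus_pos k hdn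
      rw [mul_add, strengthFactor_mul_baseRate hr α k hdn hTn]
      have h3 : 0 ≤ strengthFactor hr α k (S n) := by unfold strengthFactor; positivity
      have := mul_nonneg h3 (hmin0 n)
      positivity
    · filter_upwards [hT1, hd1, hDinv] with n hTn hdn hDn
      rw [mul_add]
      refine add_le_add le_rfl ?_
      rw [strengthFactor_eq hr α k hdn]
      calc _ ≤ 1 * ((weakStrength hr α k (S n) ^ 2)⁻¹ * gs hr α (S n) ^ 2) * (1 / ((S n).T : ℝ)) :=
            mul_le_mul (mul_le_mul_of_nonneg_right hDn (by positivity)) (min_le_left _ _) (hmin0 n)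
              (by positivity)
        _ = _ := by ring
  have hobsη' : EventuallyProb μ 0 fun n ω => (S n).ObservedAtLeast k (1 - η n) ω := by
    refine EventuallyProb.of_ae ?_
    filter_upwards [hT1] with n hn
    filter_upwards [hobsη n] with ω hω i j h
    exact (le_div_iff₀ (by exact_mod_cast hn)).1 (hω i j h)
  have hall : IsBigOP μ (fun n ω => (S n).avgRowError k (Qhat n k ω)
      (fun _ => (S n).Hall k (Qhat n k ω) ω) ω)
      (fun n => strengthFactor hr α k (S n) * (baseRate hr α k (S n) +
        min (1 / ((S n).T : ℝ)) (η n ^ 2 / (1 - η n) ^ 2))) := by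
    refine isBigOP_of_eventuallyProb (fun n ω => (S n).avgRowError_nonneg k _ _ ω) fun ε hε => ?_
    obtain ⟨C, c₂, hC, h⟩ := exists_rowError_bounds hr hS hindep hp hobs hL1 hR1 hT1 hd1 Qhat
      hQhat k (half_pos hε)
    obtain ⟨C', hC', hgap⟩ := exists_gap_bound (α := α) (c₂ := c₂) hr hS hindep hp hT1 k hη
      (half_pos hε)
    have hev := (h.and hgap (half_pos hε).le (half_pos hε).le).and hobsη' (by positivity) le_rfl
    rw [add_halves, add_zero] at hev
    refine ⟨C * (2 * C + 2 * C'), by positivity, hev.mono ?_⟩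
    filter_upwards [hT1, hd1] with n hTn hdn ω hω
    obtain ⟨⟨⟨hω1, hω2, hω3, hω4⟩, hω5⟩, hω6⟩ := hω
    have hg := hω5 hω1 hω6 hω2
    have h1 := dTot_pos hdn
    have h2 := dMinus_pos k hdn
    set x := ((S n).d k : ℝ) * (S n).dTot / (S n).T + (S n).dTot * (S n).dMinus k with hx
    set u := min (1 / ((S n).T : ℝ)) (η n ^ 2 / (1 - η n) ^ 2)
    have hx0 : 0 ≤ x := by positivity
    have hu0 : 0 ≤ u := le_min (by positivity) (by positivity)
    -- replacing the weights of the observed times by `1 / T` costs the gap of the factor part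
    have hV : ∑ i, ∑ j, ((S n).Shat k ω i j - (S n).commCovFull k ω i j) ^ 2 ≤
        (2 * C + 2 * C') * (x + gs hr α (S n) ^ 2 * u) := by
      refine (Model.sum_sq_sub_add_le _ (fun i j => (S n).commCovObs k ω i j) _).trans ?_
      rw [(S n).sum_sq_commCovObs_sub_full_eq k hω1 hp hTn]
      have h3 : 0 ≤ gs hr α (S n) ^ 2 * u := by positivity
      nlinarith [mul_nonneg hC.le h3, mul_nonneg hC' hx0]
    refine (hω4 _ _ _ (fun j => (S n).Hall_mulVec k _ j ω) hV).trans (le_of_eq ?_)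
    rw [mul_add (strengthFactor hr α k (S n)), strengthFactor_mul_baseRate hr α k hdn hTn,
      strengthFactor_eq hr α k hdn]
    ring
  exact ⟨fun n ω => (S n).avgRowError_Hall_eq k _ ω, hall, hall.isLittleOPOne hrateη⟩
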